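/- Let $\underline M(\xi)=\rho\,(4\pi e/3)^{-3/2}\exp\!\big(-\tfrac{|\xi-v|^2}{4e/3}\big)$, $\xi\in\mathbb R^3$, be a Maxwellian with $\rho>0$, $e>0$, $v\in\mathbb R^3$. Let $$Q(g,h)(\xi)=\int_{\mathbb R^3}\int_{S^2}\big(g(\xi')h(\xi'_*)-g(\xi)h(\xi_*)\big)\,|\Omega\cdot(\xi-\xi_*)|\,d\Omega\,d\xi_*,$$ $$\xi'=\xi+(\Omega\cdot(\xi_*-\xi))\Omega,\qquad \xi'_*=\xi_*-(\Omega\cdot(\xi_*-\xi))\Omega,$$ be the hard-sphere collision operator, and put $L_a g=Q(a,g)+Q(g,a)$, $\underline L=L_{\underline M}$, $(Af)(\xi)=\xi_1f(\xi)$, $\langle\xi\rangle=(1+|\xi|^2)^{1/2}$. For $s\in[\tfrac12,1)$ and $\lambda\ge0$ let $\widetilde{\mathbb H}^s$ be the real Hilbert space of measurable $f:\mathbb R^3\to\mathbb R$ with finite norm, with scalar product $$(f,g)_{\widetilde{\mathbb H}^s}=\int\big(\underline M^{-2s}+\lambda\underline M^{-1}\big)f\,g\,d\xi,$$ which is also used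 as the duality between $\langle\xi\rangle^{1/2}\widetilde{\mathbb H}^s$ and $\langle\xi\rangle^{-1/2}\widetilde{\mathbb H}^s$; let $\mathbb H^{1/2}$ be the space with weight $\underline M^{-1}$. For every $s\in[\tfrac12,1)$ there are constants $C,\delta>0$, $\lambda\ge0$ and a finite rank bounded operator $K:\langle\xi\rangle^{1/2}\widetilde{\mathbb H}^s\to\langle\xi\rangle^{-1/2}\widetilde{\mathbb H}^s$, which is also bounded for the norms of $\langle\xi\rangle^{1/2}\mathbb H^{1/2}$ and $\langle\xi\rangle^{-1/2}\mathbb H^{1/2}$, such that $K$ is skew symmetric, $(Kf,g)_{\widetilde{\mathbb H}^s}=-(f,Kg)_{\widetilde{\mathbb H}^s}$ for all $f,g\in\langle\xi\rangle^{1/2}\widetilde{\mathbb H}^s$, and $\mathrm{Re}(KA-\underline L)\ge\delta\langle\xi\rangle\,\mathrm{Id}$ in the following sense: for $a=\underline M$ and all $f\in\langle\xi\rangle^{-1/2}\widetilde{\mathbb H}^s$, the integrals defining $L_af(\xi)$ converge absolutely for almost every $\xi$, $L_af\in\langle\xi\rangle^{1/2}\widetilde{\mathbb H}^s$, and $$\delta\,\big\|\langle\xi\rangle^{1/2}f\big\|^2_{\widetilde{\mathbb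 H}^s}\le\big((KA-L_a)f,f\big)_{\widetilde{\mathbb H}^s}\le C\,\big\|\langle\xi\rangle^{1/2}f\big\|^2_{\widetilde{\mathbb H}^s}.$$ Moreover there is $\varepsilon_0>0$ such that the same holds, with the same $K,\delta,C,\lambda$, for every $a\in\langle\xi\rangle^{-1/2}\widetilde{\mathbb H}^s$ with $\|\langle\xi\rangle^{1/2}(a-\underline M)\|_{\widetilde{\mathbb H}^s}\le\varepsilon_0$. -/

import Mathlib

open MeasureTheory

noncomputable section

namespace Boltzmann

/-- Velocity space `ℝ³` with its Euclidean norm. The coordinates `ξ₁, ξ₂, ξ₃` are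
`ξ 0, ξ 1, ξ 2`. -/
abbrev Vel : Type := EuclideanSpace ℝ (Fin 3)

/-- The unit sphere `S²`. -/
abbrev Sph : Type := Metric.sphere (0 : Vel) 1

/-- The product of Lebesgue measure `dξ_*` on `ℝ³` and surface measure `dΩ` on `S²`. -/
def collisionMeasure : Measure (Vel × Sph) :=
  (volume : Measure Vel).prod (volume : Measure Vel).toSphere

/-- `ξ' = ξ + (Ω · (ξ_* - ξ)) Ω`. -/
def postVel (ξ ξs : Vel) (Ω : Sph) : Vel :=
  ξ + (inner ℝ (Ω : Vel) (ξs - ξ)) • (Ω : Vel)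

/-- `ξ'_* = ξ_* - (Ω · (ξ_* - ξ)) Ω`. -/
def postVelStar (ξ ξs : Vel) (Ω : Sph) : Vel :=
  ξs - (inner ℝ (Ω : Vel) (ξs - ξ)) • (Ω : Vel)

/-- The hard-sphere kernel `C(Ω, ξ) = |Ω · ξ|`. -/
def hardSphere (Ω : Sph) (ξ : Vel) : ℝ := |inner ℝ (Ω : Vel) ξ|

/-- `(g(ξ') h(ξ'_*) - g(ξ) h(ξ_*)) C(Ω, ξ - ξ_*)` as a function of `(ξ_*, Ω)`. -/
def collisionIntegrand (g h : Vel → ℝ) (ξ : Vel) (p : Vel × Sph) : ℝ :=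
  (g (postVel ξ p.1 p.2) * h (postVelStar ξ p.1 p.2) - g ξ * h p.1) * hardSphere p.2 (ξ - p.1)

/-- The collision operator `Q(g, h)`. -/
def collision (g h : Vel → ℝ) (ξ : Vel) : ℝ :=
  ∫ p, collisionIntegrand g h ξ p ∂collisionMeasure

/-- The linearized collision operator `L_a g = Q(a, g) + Q(g, a)`. -/
def linCollision (a g : Vel → ℝ) (ξ : Vel) : ℝ :=
  collision a g ξ + collision g a ξ

/-- A fluid-dynamical state: density, velocity and internal energy. -/
structure FluidState where
  ρ : ℝ
  v : Vel
  e : ℝ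
  ρ_pos : 0 < ρ
  e_pos : 0 < e

/-- The Maxwellian `M_u(ξ) = ρ (4πe/3)^{-3/2} exp(-|ξ - v|² / (4e/3))`. -/
def maxwellian (u : FluidState) (ξ : Vel) : ℝ :=
  u.ρ / Real.sqrt ((4 * Real.pi * u.e / 3) ^ 3) * Real.exp (-(‖ξ - u.v‖ ^ 2 / (4 * u.e / 3)))

/-- `⟨ξ⟩ = (1 + |ξ|²)^{1/2}`. -/
def japanese (ξ : Vel) : ℝ := Real.sqrt (1 + ‖ξ‖ ^ 2)

/-- The weight `M^{-2s} + lam M^{-1}` of the scalar product of `ℍ̃^s`. -/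
def weight (u : FluidState) (s lam : ℝ) (ξ : Vel) : ℝ :=
  maxwellian u ξ ^ (-(2 * s)) + lam * (maxwellian u ξ)⁻¹

/-- The measure `⟨ξ⟩^k (M^{-2s} + lam M^{-1}) dξ`. -/
def weightMeasure (u : FluidState) (s lam : ℝ) (k : ℤ) : Measure Vel :=
  volume.withDensity fun ξ => ENNReal.ofReal (japanese ξ ^ k * weight u s lam ξ)

/-- The space `⟨ξ⟩^{-k/2} ℍ̃^s`, whose norm is `f ↦ ‖⟨ξ⟩^{k/2} f‖_{ℍ̃^s}`. -/
abbrev WeightedL2 (u : FluidState) (s lam : ℝ) (k : ℤ) : Type :=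
  Lp ℝ 2 (weightMeasure u s lam k)

/-- The scalar product `(f, g)_{ℍ̃^s} = ∫ (M^{-2s} + lam M^{-1}) f g dξ`, also used as the duality
between `⟨ξ⟩^{1/2} ℍ̃^s` and `⟨ξ⟩^{-1/2} ℍ̃^s`. -/
def pairing (u : FluidState) (s lam : ℝ) (f g : Vel → ℝ) : ℝ :=
  ∫ ξ, weight u s lam ξ * (f ξ * g ξ)

theorem maxwellian_pos (u : FluidState) (ξ : Vel) : 0 < maxwellian u ξ := by
  have := u.ρ_pos
  have := u.e_pos
  unfold maxwellian
  positivity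

theorem continuous_maxwellian (u : FluidState) : Continuous (maxwellian u) := by
  unfold maxwellian
  fun_prop

theorem japanese_pos (ξ : Vel) : 0 < japanese ξ := by
  unfold japanese
  positivity

theorem measurable_density (u : FluidState) (s lam : ℝ) (k : ℤ) :
    Measurable fun ξ => ENNReal.ofReal (japanese ξ ^ k * weight u s lam ξ) := by
  have hM := (continuous_maxwellian u).measurable
  have hJ : Measurable japanese := by
    unfold japanese
    fun_prop
  have hJk : Measurable fun ξ => japanese ξ ^ k := hJ.pow_const k
  have hw : Measurable (weight u s lam) := by
    unfold weight
    exact (hM.pow_const _).add (hM.inv.const_mul _)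
  exact (hJk.mul hw).ennreal_ofReal

theorem eLpNorm_transport_le (u : FluidState) (s lam : ℝ) {g : Vel → ℝ} (hg : StronglyMeasurable g) :
    eLpNorm (fun ξ : Vel => ξ 0 * g ξ) 2 (weightMeasure u s lam (-1)) ≤
      eLpNorm g 2 (weightMeasure u s lam 1) := by
  have hm : StronglyMeasurable (fun ξ : Vel => ξ 0 * g ξ) :=
    (by fun_prop : Continuous fun ξ : Vel => ξ 0).stronglyMeasurable.mul hg
  rw [eLpNorm_eq_lintegral_rpow_enorm_toReal (by norm_num) (by norm_num),
    eLpNorm_eq_lintegral_rpow_enorm_toReal (by norm_num) (by norm_num)]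
  gcongr ?_ ^ _
  unfold weightMeasure
  rw [lintegral_withDensity_eq_lintegral_mul₀ (measurable_density u s lam (-1)).aemeasurable
      (hm.enorm.pow_const _).aemeasurable,
    lintegral_withDensity_eq_lintegral_mul₀ (measurable_density u s lam 1).aemeasurable
      (hg.enorm.pow_const _).aemeasurable]
  refine lintegral_mono fun ξ => ?_
  have hJ := japanese_pos ξ
  have hJ2 : japanese ξ ^ 2 = 1 + ‖ξ‖ ^ 2 := Real.sq_sqrt (by positivity)
  have hc : (ξ 0) ^ 2 ≤ japanese ξ ^ 2 := by
    rw [hJ2, EuclideanSpace.real_norm_sq_eq]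
    have := Finset.single_le_sum (f := fun i => (ξ i) ^ 2) (fun i _ => sq_nonneg _)
      (Finset.mem_univ (0 : Fin 3))
    simp only at this
    linarith
  simp only [Pi.mul_apply, ENNReal.toReal_ofNat, ENNReal.rpow_ofNat, Real.enorm_eq_ofReal_abs,
    ← ENNReal.ofReal_pow (abs_nonneg _), sq_abs]
  rw [← ENNReal.ofReal_mul' (sq_nonneg _), ← ENNReal.ofReal_mul' (sq_nonneg _)]
  rcases le_or_gt 0 (weight u s lam ξ) with hw | hw
  · refine ENNReal.ofReal_le_ofReal ?_
    have h1 : (japanese ξ)⁻¹ * (ξ 0) ^ 2 ≤ japanese ξ := by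
      rw [inv_mul_le_iff₀ hJ]
      nlinarith
    have h2 : 0 ≤ weight u s lam ξ * (g ξ) ^ 2 := by positivity
    have := mul_le_mul_of_nonneg_right h1 h2
    rw [zpow_neg_one, zpow_one]
    nlinarith
  · rw [ENNReal.ofReal_of_nonpos]
    · exact zero_le
    · have : 0 ≤ japanese ξ ^ (-1 : ℤ) := by positivity
      exact mul_nonpos_of_nonpos_of_nonneg (mul_nonpos_of_nonneg_of_nonpos this hw.le) (sq_nonneg _)

/-- Multiplication by `ξ₁` maps `⟨ξ⟩^{-1/2} ℍ̃^s` into `⟨ξ⟩^{1/2} ℍ̃^s`. -/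
theorem memLp_transport {u : FluidState} {s lam : ℝ} (f : WeightedL2 u s lam 1) :
    MemLp (fun ξ : Vel => ξ 0 * f ξ) 2 (weightMeasure u s lam (-1)) :=
  ⟨((by fun_prop : Continuous fun ξ : Vel => ξ 0).stronglyMeasurable.mul
      (Lp.stronglyMeasurable f)).aestronglyMeasurable,
    (eLpNorm_transport_le u s lam (Lp.stronglyMeasurable f)).trans_lt (Lp.memLp f).2⟩

/-- The transport operator `A f = ξ₁ f`, from `⟨ξ⟩^{-1/2} ℍ̃^s` to `⟨ξ⟩^{1/2} ℍ̃^s`. -/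
def transport {u : FluidState} {s lam : ℝ} (f : WeightedL2 u s lam 1) :
    WeightedL2 u s lam (-1) :=
  (memLp_transport f).toLp _

/-- For all `f ∈ ⟨ξ⟩^{-1/2} ℍ̃^s`: the integrals that define `L_a f` converge absolutely at almost
every velocity, `L_a f ∈ ⟨ξ⟩^{1/2} ℍ̃^s`, and
`c ‖⟨ξ⟩^{1/2} f‖² ≤ ((K A - L_a) f, f) ≤ C ‖⟨ξ⟩^{1/2} f‖²` for the norm and scalar product
of `ℍ̃^s`. -/
def KawashimaEstimate (u : FluidState) (s lam : ℝ)
    (K : WeightedL2 u s lam (-1) →L[ℝ] WeightedL2 u s lam 1) (c C : ℝ) (a : Vel → ℝ) : Prop :=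
  ∀ f : WeightedL2 u s lam 1,
    (∀ᵐ ξ : Vel, Integrable (collisionIntegrand a f ξ) collisionMeasure ∧
      Integrable (collisionIntegrand f a ξ) collisionMeasure) ∧
    MemLp (linCollision a f) 2 (weightMeasure u s lam (-1)) ∧
    c * ‖f‖ ^ 2 ≤ pairing u s lam (fun ξ => K (transport f) ξ - linCollision a f ξ) f ∧
    pairing u s lam (fun ξ => K (transport f) ξ - linCollision a f ξ) f ≤ C * ‖f‖ ^ 2

end Boltzmann

end

open Boltzmann

open MeasureTheory

noncomputable section

/-! Write M for the Maxwellian, B for the hard-sphere kernel and w = M^{-2s} + lam M^{-1}. Three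
lower bounds are added, and each pays for the error of another.

Large velocities. In the weight M^{-2s}, the form of -L consists of multiplication by the collision
frequency, which is at least of order ⟨ξ⟩ (`exists_frequency_ge`), and of three cross terms.
Conservation of energy spreads the Maxwellian factors symmetrically over the two values of f in a
cross term. What remains is a kernel ∫ M(T)^a M_*^b B, which is at most ε⟨ξ⟩ + C M^{2s-1}, because
the velocity in M(T) is large with ξ except for few directions Ω (`exists_spreadKernel_le`). The
exponents a, b are s and 1 - s, and both are positive. The result is -(Lf, f)_s ≥ c₁‖⟨ξ⟩^{1/2} f‖²_s
- C₂‖f‖²_{1/2} (`exists_coercive`).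

Spectral gap. In ℍ^{1/2}, the form of -L is a multiple of the integral of the squared collision
defect of f/M against M M_* B (`neg_pairing_half`). It controls the distance of f from M times the
collision invariants (`exists_hardSphere_gap`). To see this, replace B by a constant first. The
operator then maps polynomials of degree at most n to themselves and is symmetric in L²(M). The
leading part of an eigenpolynomial of degree at least 3 satisfies an averaged functional equation
(`leading_part_eq`); at a maximum point on the unit sphere it bounds the eigenvalue from below by
one positive number (`sphereGap_le_eigenvalue`). Degree at most 2 contributes finitely many
eigenvalues, and there the kernel consists of the invariants. The gap does not depend on the degree,
so it passes to L²(M) by density of polynomials (`dense_polys`). Finally, B is bounded below away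
from slow encounters, and these have small probability uniformly in ξ (`exists_slow_le`), so they
are absorbed by the gap.

Compensator. K is an antisymmetrized sum of rank-one operators built from polynomials p_j, q_j that
are dual in L²(M) to the invariants and to their products with ξ₁. On M times the invariants, (KAf,
f) is then a sum of squares of coordinates (`exists_compensator`); elsewhere the error is C₄ times
the squared distance to that space. The vectors in the range are p_j/w and q_j/w, so the weight
cancels and (KAf, f) depends on lam in no way.

With κ c₄ = C₂ and lam c₃ = κ C₄ everything cancels except c₁‖⟨ξ⟩^{1/2} f‖²_s
(`exists_lower_bound`). The choice is not circular, since c₃, c₄, C₂, C₄ are fixed before lam. The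
bilinear estimate `bilinear_bound` gives the upper bound, and it shows that L_a - L_M = L_{a-M}
costs at most half of the margin when a is near M. -/

namespace Boltzmann

/-! ### Surface measure on the sphere: rotations, null sets and decay of averages -/

/-- Surface measure on the unit sphere. -/
abbrev surface : Measure Sph := (volume : Measure Vel).toSphere

/-- The linear isometry `R` acting on the unit sphere. -/
def sphereMap (R : Vel ≃ₗᵢ[ℝ] Vel) (Ω : Sph) : Sph :=
  ⟨R Ω, by simp⟩

theorem measurable_sphereMap (R : Vel ≃ₗᵢ[ℝ] Vel) : Measurable (sphereMap R) :=
  (R.continuous.comp continuous_subtype_val).measurable.subtype_mk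

-- Surface measure is the volume of a cone up to a constant; R maps cones to cones and preserves
-- volume.
open scoped Pointwise in
theorem measurePreserving_sphereMap (R : Vel ≃ₗᵢ[ℝ] Vel) :
    MeasurePreserving (sphereMap R) surface surface := by
  refine ⟨measurable_sphereMap R, Measure.ext fun s hs => ?_⟩
  rw [Measure.map_apply (measurable_sphereMap R) hs, Measure.toSphere_apply' _ hs,
    Measure.toSphere_apply' _ (measurable_sphereMap R hs)]
  congr 1
  have hset : (Set.Ioo (0 : ℝ) 1 • ((fun x : Sph => (x : Vel)) '' (sphereMap R ⁻¹' s))) =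
      R ⁻¹' (Set.Ioo (0 : ℝ) 1 • ((fun x : Sph => (x : Vel)) '' s)) := by
    ext x
    simp only [Set.mem_smul, Set.mem_image, Set.mem_preimage]
    constructor
    · rintro ⟨r, hr, _, ⟨Ω, hΩ, rfl⟩, rfl⟩
      exact ⟨r, hr, _, ⟨sphereMap R Ω, hΩ, rfl⟩, by simp [sphereMap]⟩
    · rintro ⟨r, hr, _, ⟨Ω, hΩ, rfl⟩, h⟩
      refine ⟨r, hr, _, ⟨sphereMap R.symm Ω, ?_, rfl⟩, ?_⟩
      · have : sphereMap R (sphereMap R.symm Ω) = Ω := by ext1; simp [sphereMap]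
        rw [this]; exact hΩ
      · apply R.injective; simp [sphereMap, h]
  rw [hset]
  exact R.measurePreserving.measure_preimage_equiv (f := R.toHomeomorph.toMeasurableEquiv) _

/-- The first coordinate vector. -/
def axis : Vel := EuclideanSpace.single 0 1

/-- The second coordinate vector. -/
def axis' : Vel := EuclideanSpace.single 1 1

theorem inner_axis (x : Vel) : inner ℝ x axis = x 0 := by
  simp [axis, EuclideanSpace.inner_single_right]

/-- The reflection that exchanges two vectors of equal length. -/
theorem exists_isometry_axis (u : Vel) : ∃ R : Vel ≃ₗᵢ[ℝ] Vel, R u = ‖u‖ • axis := by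
  have h : ‖u‖ = ‖‖u‖ • axis‖ := by simp [norm_smul, axis]
  exact ⟨_, Submodule.reflection_sub h⟩

theorem exists_sphere_rotation (u : Vel) : ∃ T : Sph → Sph,
    MeasurePreserving T surface surface ∧ ∀ Ω : Sph, inner ℝ (T Ω : Vel) u = ‖u‖ * (Ω : Vel) 0 := by
  obtain ⟨R, hR⟩ := exists_isometry_axis u
  refine ⟨sphereMap R.symm, measurePreserving_sphereMap _, fun Ω => ?_⟩
  have : inner ℝ (R.symm (Ω : Vel)) u = inner ℝ (Ω : Vel) (R u) := by
    rw [← R.inner_map_map]; simp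
  simp only [sphereMap, this, hR, inner_smul_right, inner_axis]

theorem surface_inner_eq (u : Vel) {g : ℝ → ENNReal} (hg : Measurable g) :
    ∫⁻ Ω : Sph, g (inner ℝ (Ω : Vel) u) ∂surface =
      ∫⁻ Ω : Sph, g (‖u‖ * (Ω : Vel) 0) ∂surface := by
  obtain ⟨T, hT, h⟩ := exists_sphere_rotation u
  rw [← hT.lintegral_comp]
  · simp only [h]
  · fun_prop

theorem surface_integral_inner_eq (u : Vel) {g : ℝ → ℝ} (hg : Measurable g) :
    ∫ Ω : Sph, g (inner ℝ (Ω : Vel) u) ∂surface =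
      ∫ Ω : Sph, g (‖u‖ * (Ω : Vel) 0) ∂surface := by
  obtain ⟨T, hT, h⟩ := exists_sphere_rotation u
  have hm : Measurable fun Ω : Sph => g (inner ℝ (Ω : Vel) u) := by fun_prop
  have := integral_map (μ := surface) hT.measurable.aemeasurable
    (f := fun Ω : Sph => g (inner ℝ (Ω : Vel) u)) hm.aestronglyMeasurable
  rw [hT.map_eq] at this
  rw [this]
  simp only [h]

-- The cone over a great circle lies in a hyperplane, which has volume zero.
open scoped Pointwise in
theorem surface_inner_ne_zero {e : Vel} (he : e ≠ 0) :
    ∀ᵐ Ω : Sph ∂surface, inner ℝ e (Ω : Vel) ≠ 0 := by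
  have hm : MeasurableSet {Ω : Sph | inner ℝ e (Ω : Vel) = 0} :=
    measurableSet_eq_fun (by fun_prop) measurable_const
  have : surface {Ω : Sph | inner ℝ e (Ω : Vel) = 0} = 0 := by
    rw [Measure.toSphere_apply' _ hm]
    simp only [mul_eq_zero]
    right
    have hne : (ℝ ∙ e)ᗮ ≠ ⊤ := by
      intro h
      have : e ∈ (ℝ ∙ e)ᗮ := h ▸ Submodule.mem_top
      rw [Submodule.mem_orthogonal_singleton_iff_inner_right] at this
      exact he (inner_self_eq_zero.mp this)
    refine measure_mono_null ?_ (Measure.addHaar_submodule volume _ hne)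
    rintro _ ⟨r, -, _, ⟨Ω, hΩ, rfl⟩, rfl⟩
    simp only [SetLike.mem_coe, Submodule.mem_orthogonal_singleton_iff_inner_right]
    change inner ℝ e (r • (Ω : Vel)) = 0
    rw [inner_smul_right, hΩ, mul_zero]
  rw [ae_iff]
  simpa using this

theorem surface_coord_ne_zero : ∀ᵐ Ω : Sph ∂surface, (Ω : Vel) 0 ≠ 0 := by
  have he : axis ≠ 0 := by
    intro h
    have := congrArg norm h
    simp [axis] at this
  filter_upwards [surface_inner_ne_zero he] with Ω h
  rwa [real_inner_comm, inner_axis] at h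

theorem sphere_sum_sq (Ω : Sph) : (Ω : Vel) 0 ^ 2 + (Ω : Vel) 1 ^ 2 + (Ω : Vel) 2 ^ 2 = 1 := by
  have h : ‖(Ω : Vel)‖ ^ 2 = 1 := by simp
  rwa [EuclideanSpace.real_norm_sq_eq, Fin.sum_univ_three] at h

theorem surface_coord_sq_lt_one : ∀ᵐ Ω : Sph ∂surface, (Ω : Vel) 0 ^ 2 < 1 := by
  have he : axis' ≠ 0 := by
    intro h
    have := congrArg norm h
    simp [axis'] at this
  filter_upwards [surface_inner_ne_zero he] with Ω h
  rw [real_inner_comm] at h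
  simp only [axis', EuclideanSpace.inner_single_right] at h
  have h1 := sphere_sum_sq Ω
  have h2 : 0 < (Ω : Vel) 1 ^ 2 := by
    have : (Ω : Vel) 1 ≠ 0 := by simpa using h
    positivity
  nlinarith [sq_nonneg ((Ω : Vel) 2)]

theorem abs_inner_sphere_le (Ω : Sph) (x : Vel) : |inner ℝ (Ω : Vel) x| ≤ ‖x‖ := by
  have := abs_real_inner_le_norm (Ω : Vel) x
  simpa using this

/-- `∫ |Ω · e| dΩ` for a unit vector `e`. -/
def surfaceMean : ℝ := ∫ Ω : Sph, |(Ω : Vel) 0| ∂surface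

theorem integrable_of_bounded_sphere {f : Sph → ℝ} (hf : Measurable f) (C : ℝ)
    (h : ∀ Ω, |f Ω| ≤ C) : Integrable f surface :=
  Integrable.of_bound hf.aestronglyMeasurable C (Filter.Eventually.of_forall h)

theorem abs_coord_sphere_le (Ω : Sph) : |(Ω : Vel) 0| ≤ 1 := by
  rw [← inner_axis]
  have := abs_inner_sphere_le Ω axis
  simpa [axis] using this

theorem surfaceMean_pos : 0 < surfaceMean := by
  unfold surfaceMean
  rw [integral_pos_iff_support_of_nonneg (fun _ => abs_nonneg _)
    (integrable_of_bounded_sphere (by fun_prop) 1 (by simpa using abs_coord_sphere_le))]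
  have h : surface (Function.support fun Ω : Sph => |(Ω : Vel) 0|)ᶜ = 0 := by
    have := surface_coord_ne_zero
    rw [ae_iff] at this
    convert this using 2
    ext; simp
  by_contra h0
  have h1 : surface (Function.support fun Ω : Sph => |(Ω : Vel) 0|) = 0 := by simpa using h0
  have : surface (Set.univ : Set Sph) = 0 := by
    rw [← Set.union_compl_self (Function.support fun Ω : Sph => |(Ω : Vel) 0|)]
    exact measure_union_null h1 h
  rw [Measure.measure_univ_eq_zero] at this
  exact Measure.toSphere_ne_zero _ this

theorem lintegral_hardSphere_sphere (u : Vel) :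
    ∫⁻ Ω : Sph, ENNReal.ofReal (hardSphere Ω u) ∂surface =
      ENNReal.ofReal (surfaceMean * ‖u‖) := by
  unfold hardSphere
  rw [surface_inner_eq u (g := fun t => ENNReal.ofReal |t|) (by fun_prop), surfaceMean,
    ← ofReal_integral_eq_lintegral_ofReal]
  · congr 1
    rw [← integral_mul_const]
    congr 1; ext Ω
    rw [abs_mul, abs_of_nonneg (norm_nonneg _), mul_comm]
  · refine integrable_of_bounded_sphere (by fun_prop) ‖u‖ fun Ω => ?_
    rw [abs_abs, abs_mul, abs_of_nonneg (norm_nonneg _)]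
    exact mul_le_of_le_one_right (norm_nonneg _) (abs_coord_sphere_le Ω)
  · exact Filter.Eventually.of_forall fun _ => abs_nonneg _

/-- A Gaussian in the components of `t e` along and across `Ω`, averaged over the sphere. -/
def sphereDecay (a t : ℝ) : ENNReal :=
  ∫⁻ Ω : Sph, ENNReal.ofReal (Real.exp (-(a * (t * (Ω : Vel) 0) ^ 2)) +
    Real.exp (-(a * (t ^ 2 - (t * (Ω : Vel) 0) ^ 2)))) ∂surface

theorem sphereDecay_integrand_le {a : ℝ} (ha : 0 < a) (t : ℝ) (Ω : Sph) :
    ENNReal.ofReal (Real.exp (-(a * (t * (Ω : Vel) 0) ^ 2)) +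
      Real.exp (-(a * (t ^ 2 - (t * (Ω : Vel) 0) ^ 2)))) ≤ 2 := by
  refine (ENNReal.ofReal_le_ofReal (q := 2) ?_).trans (by simp)
  have h1 := sphere_sum_sq Ω
  have h3 : (t * (Ω : Vel) 0) ^ 2 ≤ t ^ 2 := by
    rw [mul_pow]
    refine mul_le_of_le_one_right (sq_nonneg _) ?_
    nlinarith [sq_nonneg ((Ω : Vel) 1), sq_nonneg ((Ω : Vel) 2)]
  have e1 : Real.exp (-(a * (t * (Ω : Vel) 0) ^ 2)) ≤ 1 := Real.exp_le_one_iff.2 (by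
    have : 0 ≤ a * (t * (Ω : Vel) 0) ^ 2 := by positivity
    linarith)
  have e2 : Real.exp (-(a * (t ^ 2 - (t * (Ω : Vel) 0) ^ 2))) ≤ 1 := Real.exp_le_one_iff.2 (by
    have : 0 ≤ a * (t ^ 2 - (t * (Ω : Vel) 0) ^ 2) := mul_nonneg ha.le (by linarith)
    linarith)
  linarith

theorem sphereDecay_le {a : ℝ} (ha : 0 < a) (t : ℝ) : sphereDecay a t ≤ 2 * surface Set.univ := by
  unfold sphereDecay
  rw [← lintegral_const]
  exact lintegral_mono fun Ω => sphereDecay_integrand_le ha t Ω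

-- Almost every Ω has a nonzero component both along and across the axis, so both Gaussians tend to
-- zero pointwise; dominated convergence does the rest.
open Filter Topology in
theorem tendsto_sphereDecay {a : ℝ} (ha : 0 < a) : Tendsto (sphereDecay a) atTop (𝓝 0) := by
  have key : Tendsto (sphereDecay a) atTop (𝓝 (∫⁻ _ : Sph, 0 ∂surface)) := by
    refine tendsto_lintegral_filter_of_dominated_convergence (fun _ => 2) ?_ ?_ ?_ ?_
    · exact Eventually.of_forall fun t => by fun_prop
    · exact Eventually.of_forall fun t => Eventually.of_forall fun Ω =>
        sphereDecay_integrand_le ha t Ω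
    · rw [lintegral_const]
      exact ENNReal.mul_ne_top (by simp) (measure_ne_top _ _)
    · filter_upwards [surface_coord_ne_zero, surface_coord_sq_lt_one] with Ω h0 h1
      have hexp : ∀ b : ℝ, 0 < b → Tendsto (fun t : ℝ => Real.exp (-(b * t ^ 2))) atTop (𝓝 0) := by
        intro b hb
        refine Real.tendsto_exp_neg_atTop_nhds_zero.comp ?_
        exact (tendsto_pow_atTop two_ne_zero).const_mul_atTop hb
      have e1 := hexp (a * (Ω : Vel) 0 ^ 2) (by positivity)
      have e2 := hexp (a * (1 - (Ω : Vel) 0 ^ 2)) (mul_pos ha (by linarith))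
      have e3 := ENNReal.tendsto_ofReal (e1.add e2)
      rw [add_zero, ENNReal.ofReal_zero] at e3
      refine e3.congr fun t => ?_
      congr 3 <;> ring_nf
  simpa using key

-- Continuity of the measure from above: the bands shrink to the equator, a null set.
open Filter Topology in
theorem tendsto_surface_band :
    Tendsto (fun η : ℝ => surface {Ω : Sph | |(Ω : Vel) 0| < η}) (𝓝[>] 0) (𝓝 0) := by
  have hm : ∀ η : ℝ, MeasurableSet {Ω : Sph | |(Ω : Vel) 0| < η} := fun η =>
    measurableSet_lt (by fun_prop) measurable_const
  have h := tendsto_measure_biInter_gt (μ := surface) (s := fun η : ℝ => {Ω : Sph | |(Ω : Vel) 0| < η})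
    (a := 0) (fun r _ => (hm r).nullMeasurableSet)
    (fun i j _ hij Ω hΩ => lt_of_lt_of_le (by exact hΩ) hij) ⟨1, one_pos, measure_ne_top _ _⟩
  have h0 : surface (⋂ r > (0 : ℝ), {Ω : Sph | |(Ω : Vel) 0| < r}) = 0 := by
    refine measure_mono_null ?_ (ae_iff.1 surface_coord_ne_zero)
    intro Ω hΩ
    simp only [gt_iff_lt, Set.mem_iInter, Set.mem_ofPred_eq] at hΩ
    simp only [ne_eq, not_not, Set.mem_ofPred_eq]
    by_contra hne
    exact lt_irrefl _ (hΩ _ (abs_pos.2 hne))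
  rw [h0] at h
  exact h

/-! ### Maxwellians and the bracket ⟨ξ⟩ -/

/-- The amplitude of a Maxwellian. -/
def amp (u : FluidState) : ℝ := u.ρ / Real.sqrt ((4 * Real.pi * u.e / 3) ^ 3)

/-- The temperature scale of a Maxwellian. -/
def tmp (u : FluidState) : ℝ := 4 * u.e / 3

theorem amp_pos (u : FluidState) : 0 < amp u := by
  have := u.ρ_pos
  have := u.e_pos
  unfold amp
  positivity

theorem tmp_pos (u : FluidState) : 0 < tmp u := by
  have := u.e_pos
  unfold tmp
  positivity

theorem maxwellian_eq (u : FluidState) (ξ : Vel) :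
    maxwellian u ξ = amp u * Real.exp (-(‖ξ - u.v‖ ^ 2 / tmp u)) := rfl

theorem maxwellian_le_amp (u : FluidState) (ξ : Vel) : maxwellian u ξ ≤ amp u := by
  rw [maxwellian_eq]
  refine mul_le_of_le_one_right (amp_pos u).le (Real.exp_le_one_iff.2 ?_)
  have := tmp_pos u
  have : 0 ≤ ‖ξ - u.v‖ ^ 2 / tmp u := by positivity
  linarith

theorem maxwellian_rpow (u : FluidState) (ξ : Vel) (r : ℝ) :
    maxwellian u ξ ^ r = amp u ^ r * Real.exp (-(r / tmp u * ‖ξ - u.v‖ ^ 2)) := by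
  rw [maxwellian_eq, Real.mul_rpow (amp_pos u).le (Real.exp_pos _).le, ← Real.exp_mul]
  congr 2
  ring

theorem measurable_maxwellian (u : FluidState) : Measurable (maxwellian u) :=
  (continuous_maxwellian u).measurable

theorem continuous_japanese : Continuous japanese := by
  unfold japanese
  fun_prop

theorem japanese_sq (ξ : Vel) : japanese ξ ^ 2 = 1 + ‖ξ‖ ^ 2 := Real.sq_sqrt (by positivity)

theorem one_le_japanese (ξ : Vel) : 1 ≤ japanese ξ := by
  have h := japanese_sq ξ
  have := japanese_pos ξ
  nlinarith [sq_nonneg ‖ξ‖]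

theorem norm_le_japanese (ξ : Vel) : ‖ξ‖ ≤ japanese ξ := by
  have h := japanese_sq ξ
  have := japanese_pos ξ
  exact abs_le_of_sq_le_sq' (by linarith) this.le |>.2

theorem japanese_le (ξ : Vel) : japanese ξ ≤ 1 + ‖ξ‖ := by
  have h := japanese_sq ξ
  have := norm_nonneg ξ
  exact abs_le_of_sq_le_sq' (by nlinarith) (by positivity) |>.2

theorem norm_sub_le_japanese_mul (ξ η : Vel) : ‖ξ - η‖ ≤ 2 * (japanese ξ * japanese η) := by
  have h1 := norm_sub_le ξ η
  have h2 := norm_le_japanese ξ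
  have h3 := norm_le_japanese η
  have h4 := one_le_japanese ξ
  have h5 := one_le_japanese η
  nlinarith

theorem hardSphere_le (Ω : Sph) (ξ η : Vel) :
    hardSphere Ω (ξ - η) ≤ 2 * (japanese ξ * japanese η) :=
  (abs_inner_sphere_le Ω _).trans (norm_sub_le_japanese_mul ξ η)

/-! ### Encounters and their symmetries -/

/-- Velocities of an encounter together with the collision direction. -/
abbrev Encounter : Type := Vel × (Vel × Sph)

/-- The measure `dξ dξ_* dΩ`. -/
def encounterMeasure : Measure Encounter := (volume : Measure Vel).prod collisionMeasure

instance : SigmaFinite collisionMeasure :=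
  Measure.prod.instSigmaFinite (μ := (volume : Measure Vel)) (ν := surface)

/-- Exchange of the two particles. -/
def swapMap (x : Encounter) : Encounter := (x.2.1, x.1, x.2.2)

/-- The collision map `(ξ, ξ_*, Ω) ↦ (ξ', ξ'_*, Ω)`. -/
def colMap (x : Encounter) : Encounter :=
  (postVel x.1 x.2.1 x.2.2, postVelStar x.1 x.2.1 x.2.2, x.2.2)

/-- The hard-sphere kernel as a function of the encounter. -/
def kernelB (x : Encounter) : ℝ := hardSphere x.2.2 (x.1 - x.2.1)

theorem continuous_colMap : Continuous colMap := by
  unfold colMap postVel postVelStar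
  fun_prop

theorem continuous_kernelB : Continuous kernelB := by
  unfold kernelB hardSphere
  fun_prop

theorem kernelB_nonneg (x : Encounter) : 0 ≤ kernelB x := abs_nonneg _

theorem kernelB_le (x : Encounter) : kernelB x ≤ 2 * (japanese x.1 * japanese x.2.1) :=
  hardSphere_le _ _ _

theorem sphere_inner_self (Ω : Sph) : inner ℝ (Ω : Vel) (Ω : Vel) = 1 := by
  rw [real_inner_self_eq_norm_sq]
  simp

theorem inner_postVel_sub (ξ ξs : Vel) (Ω : Sph) :
    inner ℝ (Ω : Vel) (postVelStar ξ ξs Ω - postVel ξ ξs Ω) = -inner ℝ (Ω : Vel) (ξs - ξ) := by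
  simp only [postVel, postVelStar, inner_sub_right, inner_add_right, inner_smul_right,
    sphere_inner_self]
  ring

theorem colMap_colMap (x : Encounter) : colMap (colMap x) = x := by
  obtain ⟨ξ, ξs, Ω⟩ := x
  have h := inner_postVel_sub ξ ξs Ω
  simp only [colMap]
  refine Prod.ext ?_ (Prod.ext ?_ rfl)
  · simp only
    rw [postVel, h]
    simp [postVel]
  · simp only
    rw [postVelStar, h]
    simp [postVelStar]

theorem swapMap_swapMap (x : Encounter) : swapMap (swapMap x) = x := rfl

theorem colMap_swapMap (x : Encounter) : colMap (swapMap x) = swapMap (colMap x) := by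
  obtain ⟨ξ, ξs, Ω⟩ := x
  have h : inner ℝ (Ω : Vel) (ξ - ξs) = -inner ℝ (Ω : Vel) (ξs - ξ) := by
    rw [← inner_neg_right, neg_sub]
  simp only [colMap, swapMap, postVel, postVelStar, h]
  refine Prod.ext ?_ (Prod.ext ?_ rfl) <;> simp [sub_eq_add_neg]

theorem kernelB_swapMap (x : Encounter) : kernelB (swapMap x) = kernelB x := by
  unfold kernelB hardSphere swapMap
  rw [← neg_sub x.1 x.2.1, inner_neg_right, abs_neg]

theorem kernelB_colMap (x : Encounter) : kernelB (colMap x) = kernelB x := by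
  unfold kernelB hardSphere colMap
  rw [← neg_sub, inner_neg_right, inner_postVel_sub, neg_neg, ← neg_sub x.1, inner_neg_right,
    abs_neg]

theorem measurePreserving_swapMap : MeasurePreserving swapMap encounterMeasure encounterMeasure := by
  have h1 := measurePreserving_prodAssoc (volume : Measure Vel) (volume : Measure Vel) surface
  have h2 : MeasurePreserving (Prod.map Prod.swap id)
      (((volume : Measure Vel).prod (volume : Measure Vel)).prod surface)
      (((volume : Measure Vel).prod (volume : Measure Vel)).prod surface) :=
    Measure.measurePreserving_swap.prod (MeasurePreserving.id surface)
  exact (h1.comp h2).comp (h1.symm _)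

/-- The linear map `(ξ, ξ_*) ↦ (ξ', ξ'_*)` for a fixed direction. -/
def colLinear (Ω : Sph) : Vel × Vel →ₗ[ℝ] Vel × Vel :=
  (LinearMap.fst ℝ Vel Vel + ((innerSL ℝ (Ω : Vel)).toLinearMap ∘ₗ
    (LinearMap.snd ℝ Vel Vel - LinearMap.fst ℝ Vel Vel)).smulRight (Ω : Vel)).prod
  (LinearMap.snd ℝ Vel Vel - ((innerSL ℝ (Ω : Vel)).toLinearMap ∘ₗ
    (LinearMap.snd ℝ Vel Vel - LinearMap.fst ℝ Vel Vel)).smulRight (Ω : Vel))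

theorem colLinear_apply (Ω : Sph) (p : Vel × Vel) :
    colLinear Ω p = (postVel p.1 p.2 Ω, postVelStar p.1 p.2 Ω) := by
  simp [colLinear, postVel, postVelStar]

theorem colLinear_comp_self (Ω : Sph) : colLinear Ω ∘ₗ colLinear Ω = LinearMap.id := by
  refine LinearMap.ext fun p => ?_
  have h := colMap_colMap (p.1, p.2, Ω)
  simp only [colMap, Prod.mk.injEq] at h
  simp only [LinearMap.comp_apply, colLinear_apply, LinearMap.id_apply]
  exact Prod.ext h.1 h.2.1

/-- A linear involution has determinant ±1. -/
theorem measurePreserving_colLinear (Ω : Sph) :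
    MeasurePreserving (colLinear Ω) ((volume : Measure Vel).prod volume)
      ((volume : Measure Vel).prod volume) := by
  have hdet : LinearMap.det (colLinear Ω) * LinearMap.det (colLinear Ω) = 1 := by
    rw [← LinearMap.det_comp, colLinear_comp_self, LinearMap.det_id]
  have hne : LinearMap.det (colLinear Ω) ≠ 0 := fun h => by simp [h] at hdet
  refine ⟨(colLinear Ω).continuous_of_finiteDimensional.measurable, ?_⟩
  rw [Measure.map_linearMap_addHaar_eq_smul_addHaar _ hne]
  have : |(LinearMap.det (colLinear Ω))⁻¹| = 1 := by
    rcases mul_self_eq_one_iff.1 hdet with h | h <;> simp [h]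
  rw [this]
  simp

/-- After reordering the factors this is a skew product over Ω whose fibre maps are the linear maps
`colLinear Ω`. -/
theorem measurePreserving_colMap : MeasurePreserving colMap encounterMeasure encounterMeasure := by
  have h1 := measurePreserving_prodAssoc (volume : Measure Vel) (volume : Measure Vel) surface
  have h0 : MeasurePreserving (fun x : Sph × (Vel × Vel) => (x.1, colLinear x.1 x.2))
      (surface.prod ((volume : Measure Vel).prod (volume : Measure Vel)))
      (surface.prod ((volume : Measure Vel).prod (volume : Measure Vel))) := by
    refine (MeasurePreserving.id surface).skew_product (g := fun Ω p => colLinear Ω p) ?_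
      (Filter.Eventually.of_forall fun Ω => (measurePreserving_colLinear Ω).map_eq)
    have : (Function.uncurry fun (Ω : Sph) p => colLinear Ω p) =
        fun x : Sph × (Vel × Vel) => (postVel x.2.1 x.2.2 x.1, postVelStar x.2.1 x.2.2 x.1) := by
      ext1 x
      exact colLinear_apply _ _
    rw [this]
    unfold postVel postVelStar
    exact Continuous.measurable (by fun_prop)
  have h2 : MeasurePreserving (Prod.swap ∘
      (fun x : Sph × (Vel × Vel) => (x.1, colLinear x.1 x.2)) ∘ Prod.swap)
      (((volume : Measure Vel).prod (volume : Measure Vel)).prod surface)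
      (((volume : Measure Vel).prod (volume : Measure Vel)).prod surface) :=
    Measure.measurePreserving_swap.comp (h0.comp Measure.measurePreserving_swap)
  have h3 := (h1.comp h2).comp (h1.symm _)
  have h4 : colMap = (MeasurableEquiv.prodAssoc ∘ Prod.swap ∘
      (fun x : Sph × (Vel × Vel) => (x.1, colLinear x.1 x.2)) ∘ Prod.swap) ∘
      MeasurableEquiv.prodAssoc.symm := by
    ext1 x
    simp [colMap, colLinear_apply, MeasurableEquiv.prodAssoc]
  rw [h4]
  exact h3

/-- Conservation of energy in the frame moving with v. The arbitrary v serves Maxwellians with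
nonzero mean velocity. -/
theorem norm_sq_colMap (v : Vel) (x : Encounter) :
    ‖(colMap x).1 - v‖ ^ 2 + ‖(colMap x).2.1 - v‖ ^ 2 = ‖x.1 - v‖ ^ 2 + ‖x.2.1 - v‖ ^ 2 := by
  obtain ⟨ξ, ξs, Ω⟩ := x
  simp only [colMap, postVel, postVelStar]
  set k := inner ℝ (Ω : Vel) (ξs - ξ) with hk
  have e1 : ξ + k • (Ω : Vel) - v = (ξ - v) + k • (Ω : Vel) := by abel
  have e2 : ξs - k • (Ω : Vel) - v = (ξs - v) - k • (Ω : Vel) := by abel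
  have hk' : k = inner ℝ (ξs - v) (Ω : Vel) - inner ℝ (ξ - v) (Ω : Vel) := by
    rw [hk, ← inner_sub_left, real_inner_comm]
    congr 1
    abel
  rw [e1, e2, norm_add_sq_real, norm_sub_sq_real (ξs - v), inner_smul_right, inner_smul_right,
    norm_smul]
  have : ‖(Ω : Vel)‖ = 1 := by simp
  rw [this, mul_one, Real.norm_eq_abs, sq_abs]
  linear_combination (2 * k) * hk'

theorem maxwellian_colMap (u : FluidState) (x : Encounter) :
    maxwellian u (colMap x).1 * maxwellian u (colMap x).2.1 =
      maxwellian u x.1 * maxwellian u x.2.1 := by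
  simp only [maxwellian_eq]
  rw [mul_mul_mul_comm, mul_mul_mul_comm (amp u) _ (amp u), ← Real.exp_add, ← Real.exp_add]
  congr 2
  have := norm_sq_colMap u.v x
  rw [← neg_add, ← neg_add, ← add_div, ← add_div, this]

/-! ### Gaussian moments -/

theorem integrable_gaussian {b : ℝ} (hb : 0 < b) (v : Vel) :
    Integrable fun ξ : Vel => Real.exp (-(b * ‖ξ - v‖ ^ 2)) := by
  have h := (GaussianFourier.integrable_cexp_neg_mul_sq_norm_add (V := Vel) (b := (b : ℂ))
    (by simpa using hb) 0 0).norm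
  have h2 : Integrable fun ξ : Vel => Real.exp (-(b * ‖ξ‖ ^ 2)) := by
    refine h.congr (Filter.Eventually.of_forall fun ξ => ?_)
    simp only [Complex.norm_exp]
    congr 1
    norm_cast
    simp
  exact h2.comp_sub_right v

theorem integrable_gaussian_mul_exp {b : ℝ} (hb : 0 < b) (v : Vel) (t : ℝ) :
    Integrable fun ξ : Vel => Real.exp (-(b * ‖ξ - v‖ ^ 2)) * Real.exp (t * ‖ξ‖) := by
  -- Half of the Gaussian exponent absorbs the linear exponent, by completing the square.
  have h := (integrable_gaussian (half_pos hb) v).const_mul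
    (Real.exp (t ^ 2 / (2 * b) + |t| * ‖v‖))
  refine h.mono' (by fun_prop) (Filter.Eventually.of_forall fun ξ => ?_)
  rw [Real.norm_of_nonneg (by positivity), ← Real.exp_add, ← Real.exp_add]
  refine Real.exp_le_exp.2 ?_
  have h1 : ‖ξ‖ ≤ ‖ξ - v‖ + ‖v‖ := by
    have := norm_add_le (ξ - v) v
    simpa using this
  have h2 : t * ‖ξ‖ ≤ |t| * (‖ξ - v‖ + ‖v‖) :=
    mul_le_mul (le_abs_self t) h1 (norm_nonneg _) (abs_nonneg _)
  have h3 : |t| * ‖ξ - v‖ ≤ b / 2 * ‖ξ - v‖ ^ 2 + t ^ 2 / (2 * b) := by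
    have : b / 2 * ‖ξ - v‖ ^ 2 + t ^ 2 / (2 * b) - |t| * ‖ξ - v‖ =
        (b * ‖ξ - v‖ - |t|) ^ 2 / (2 * b) := by
      rw [← sq_abs t]
      field_simp
      ring
    have h4 : 0 ≤ (b * ‖ξ - v‖ - |t|) ^ 2 / (2 * b) := by positivity
    linarith
  linarith

theorem integrable_maxwellian_rpow_mul_exp (u : FluidState) {r : ℝ} (hr : 0 < r) (t : ℝ) :
    Integrable fun ξ : Vel => maxwellian u ξ ^ r * Real.exp (t * ‖ξ‖) := by
  have h := (integrable_gaussian_mul_exp (div_pos hr (tmp_pos u)) u.v t).const_mul (amp u ^ r)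
  refine h.congr (Filter.Eventually.of_forall fun ξ => ?_)
  simp only [maxwellian_rpow]
  ring

theorem japanese_pow_le_exp (n : ℕ) (ξ : Vel) : japanese ξ ^ n ≤ Real.exp (n * ‖ξ‖) := by
  rw [Real.exp_nat_mul]
  have h := japanese_le ξ
  have h2 := Real.add_one_le_exp ‖ξ‖
  exact pow_le_pow_left₀ (japanese_pos ξ).le (by linarith) n

theorem integrable_maxwellian_rpow_mul_japanese (u : FluidState) {r : ℝ} (hr : 0 < r) (n : ℕ) :
    Integrable fun ξ : Vel => maxwellian u ξ ^ r * japanese ξ ^ n := by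
  refine (integrable_maxwellian_rpow_mul_exp u hr n).mono' ?_ (Filter.Eventually.of_forall fun ξ => ?_)
  · exact (((measurable_maxwellian u).pow_const r).mul
      (continuous_japanese.measurable.pow_const n)).aestronglyMeasurable
  · have h1 := Real.rpow_pos_of_pos (maxwellian_pos u ξ) r
    have h2 := japanese_pos ξ
    rw [Real.norm_of_nonneg (by positivity)]
    exact mul_le_mul_of_nonneg_left (japanese_pow_le_exp n ξ) h1.le

/-! ### The weight of the spaces and their squared norms -/

theorem weight_pos (u : FluidState) (s : ℝ) {lam : ℝ} (hl : 0 ≤ lam) (ξ : Vel) :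
    0 < weight u s lam ξ := by
  have h1 := maxwellian_pos u ξ
  have h2 := Real.rpow_pos_of_pos h1 (-(2 * s))
  unfold weight
  positivity

theorem measurable_weight (u : FluidState) (s lam : ℝ) : Measurable (weight u s lam) := by
  unfold weight
  exact ((measurable_maxwellian u).pow_const _).add ((measurable_maxwellian u).inv.const_mul _)

theorem inv_maxwellian_le (u : FluidState) {s : ℝ} (hs : 1 / 2 ≤ s) (ξ : Vel) :
    (maxwellian u ξ)⁻¹ ≤ amp u ^ (2 * s - 1) * maxwellian u ξ ^ (-(2 * s)) := by
  have h1 := maxwellian_pos u ξ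
  have h2 : (maxwellian u ξ)⁻¹ = maxwellian u ξ ^ (2 * s - 1) * maxwellian u ξ ^ (-(2 * s)) := by
    rw [← Real.rpow_add h1, ← Real.rpow_neg_one]
    congr 1; ring
  rw [h2]
  exact mul_le_mul_of_nonneg_right
    (Real.rpow_le_rpow h1.le (maxwellian_le_amp u ξ) (by linarith)) (Real.rpow_pos_of_pos h1 _).le

/-- The constant in `weight_le`. -/
def weightConst (u : FluidState) (s lam : ℝ) : ℝ :=
  amp u ^ (2 * s - 1) + lam * (amp u ^ (2 * s - 1)) ^ 2

theorem weightConst_pos (u : FluidState) (s : ℝ) {lam : ℝ} (hl : 0 ≤ lam) :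
    0 < weightConst u s lam := by
  have := Real.rpow_pos_of_pos (amp_pos u) (2 * s - 1)
  unfold weightConst
  positivity

/-- Along a collision M(a)^{-2s} = M(c)^{-2s} M(d)^{-2s} M(b)^{2s}, and M(b)^{2s} is at most a
constant times M(b) since 2s ≥ 1. The surviving factor M(b) cancels the 1/M_* that Cauchy–Schwarz
produces in `bilinear_bound`. -/
theorem weight_le (u : FluidState) {s lam : ℝ} (hs : 1 / 2 ≤ s) (hl : 0 ≤ lam) {a b c d : Vel}
    (h : maxwellian u c * maxwellian u d = maxwellian u a * maxwellian u b) :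
    weight u s lam a ≤
      weightConst u s lam * (weight u s lam c * weight u s lam d) * maxwellian u b := by
  have ha := maxwellian_pos u a
  have hb := maxwellian_pos u b
  have hc := maxwellian_pos u c
  have hd := maxwellian_pos u d
  set q := amp u ^ (2 * s - 1) with hq
  have hq0 : 0 < q := Real.rpow_pos_of_pos (amp_pos u) _
  set C := maxwellian u c ^ (-(2 * s)) with hC
  set D := maxwellian u d ^ (-(2 * s)) with hD
  have hC0 : 0 < C := Real.rpow_pos_of_pos hc _
  have hD0 : 0 < D := Real.rpow_pos_of_pos hd _
  have hcd : C * D ≤ weight u s lam c * weight u s lam d := by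
    refine mul_le_mul ?_ ?_ hD0.le (weight_pos u s hl c).le <;>
    · unfold weight
      have := inv_pos.2 hc
      have := inv_pos.2 hd
      linarith [mul_nonneg hl (inv_pos.2 hc).le, mul_nonneg hl (inv_pos.2 hd).le]
  have h1 : maxwellian u a ^ (-(2 * s)) ≤ C * D * (q * maxwellian u b) := by
    have e : maxwellian u a ^ (-(2 * s)) = C * D * maxwellian u b ^ (2 * s) := by
      rw [hC, hD, ← Real.mul_rpow hc.le hd.le, h, Real.mul_rpow ha.le hb.le, mul_assoc,
        ← Real.rpow_add hb]
      simp
    have e2 : maxwellian u b ^ (2 * s) = maxwellian u b ^ (2 * s - 1) * maxwellian u b := by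
      rw [← Real.rpow_add_one hb.ne']
      congr 1; ring
    rw [e, e2]
    gcongr
    · exact Real.rpow_le_rpow hb.le (maxwellian_le_amp u b) (by linarith)
  have h2 : (maxwellian u a)⁻¹ ≤ q ^ 2 * (C * D) * maxwellian u b := by
    have e : (maxwellian u a)⁻¹ = (maxwellian u c)⁻¹ * (maxwellian u d)⁻¹ * maxwellian u b := by
      rw [← mul_inv, h, mul_inv]
      field_simp
    rw [e]
    refine mul_le_mul_of_nonneg_right ?_ hb.le
    have := mul_le_mul (inv_maxwellian_le u hs c) (inv_maxwellian_le u hs d)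
      (inv_pos.2 hd).le (by positivity)
    refine this.trans (le_of_eq ?_)
    rw [hC, hD, hq]; ring
  calc weight u s lam a ≤ C * D * (q * maxwellian u b) + lam * (q ^ 2 * (C * D) * maxwellian u b) :=
        add_le_add h1 (mul_le_mul_of_nonneg_left h2 hl)
    _ = weightConst u s lam * (C * D) * maxwellian u b := by
        rw [weightConst, ← hq]; ring
    _ ≤ _ := by
        have := (weightConst_pos u s hl).le
        gcongr

/-- The square of the norm of `⟨ξ⟩^{-k/2} ℍ̃^s`, with values in `[0, ∞]`. -/
def nsq (u : FluidState) (s lam : ℝ) (k : ℤ) (f : Vel → ℝ) : ENNReal :=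
  ∫⁻ ξ, ENNReal.ofReal (japanese ξ ^ k * weight u s lam ξ) * ENNReal.ofReal (f ξ ^ 2)

theorem eLpNorm_sq_eq_nsq (u : FluidState) (s lam : ℝ) (k : ℤ) (f : Vel → ℝ) :
    eLpNorm f 2 (weightMeasure u s lam k) ^ 2 = nsq u s lam k f := by
  rw [eLpNorm_eq_lintegral_rpow_enorm_toReal (by norm_num) (by norm_num), ← ENNReal.rpow_natCast,
    ← ENNReal.rpow_mul]
  simp only [ENNReal.toReal_ofNat, Nat.cast_ofNat, one_div, inv_mul_cancel₀ (two_ne_zero (α := ℝ)),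
    ENNReal.rpow_one, ENNReal.rpow_ofNat]
  unfold weightMeasure nsq
  rw [lintegral_withDensity_eq_lintegral_mul_non_measurable _ (measurable_density u s lam k)
    (Filter.Eventually.of_forall fun _ => ENNReal.ofReal_lt_top)]
  refine lintegral_congr fun ξ => ?_
  simp only [Pi.mul_apply, Real.enorm_eq_ofReal_abs, ← ENNReal.ofReal_pow (abs_nonneg _), sq_abs]

theorem weightMeasure_absolutelyContinuous (u : FluidState) (s lam : ℝ) (k : ℤ) :
    weightMeasure u s lam k ≪ volume := withDensity_absolutelyContinuous _ _

theorem absolutelyContinuous_weightMeasure (u : FluidState) (s : ℝ) {lam : ℝ} (hl : 0 ≤ lam)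
    (k : ℤ) : (volume : Measure Vel) ≪ weightMeasure u s lam k := by
  refine withDensity_absolutelyContinuous' (measurable_density u s lam k).aemeasurable ?_
  refine Filter.Eventually.of_forall fun ξ => ?_
  have h1 := weight_pos u s hl ξ
  have h2 := zpow_pos (japanese_pos ξ) k
  simpa using mul_pos h2 h1

/-! ### Bilinear and trilinear estimates of the collision terms -/

theorem cauchySchwarz_lintegral {α : Type*} [MeasurableSpace α] (μ : Measure α) {f g : α → ENNReal}
    (hf : AEMeasurable f μ) (hg : AEMeasurable g μ) :
    (∫⁻ a, f a * g a ∂μ) ^ 2 ≤ (∫⁻ a, f a ^ 2 ∂μ) * ∫⁻ a, g a ^ 2 ∂μ := by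
  have h := ENNReal.lintegral_mul_le_Lp_mul_Lq μ Real.HolderConjugate.two_two hf hg
  have h2 := pow_le_pow_left₀ (zero_le) h 2
  refine h2.trans (le_of_eq ?_)
  rw [mul_pow, ← ENNReal.rpow_natCast, ← ENNReal.rpow_natCast, ← ENNReal.rpow_mul,
    ← ENNReal.rpow_mul]
  simp

theorem lintegral_collisionMeasure_mul {g : Vel → ENNReal} {h : Sph → ENNReal}
    (hg : Measurable g) (hh : Measurable h) :
    ∫⁻ p, g p.1 * h p.2 ∂collisionMeasure = (∫⁻ ξ, g ξ) * ∫⁻ Ω, h Ω ∂surface :=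
  lintegral_prod_mul hg.aemeasurable hh.aemeasurable

theorem lintegral_collisionMeasure_fst {g : Vel → ENNReal} (hg : Measurable g) :
    ∫⁻ p, g p.1 ∂collisionMeasure = (∫⁻ ξ, g ξ) * surface Set.univ := by
  have := lintegral_collisionMeasure_mul (h := fun _ => 1) hg measurable_const
  simpa using this

/-- `∫ ⟨ξ⟩ M^r dξ`. -/
def momentConst (u : FluidState) (r : ℝ) : ℝ := ∫ ξ, maxwellian u ξ ^ r * japanese ξ

theorem momentConst_nonneg (u : FluidState) (r : ℝ) : 0 ≤ momentConst u r :=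
  integral_nonneg fun ξ =>
    mul_nonneg (Real.rpow_nonneg (maxwellian_pos u ξ).le _) (japanese_pos ξ).le

theorem lintegral_maxwellian_rpow_mul_japanese (u : FluidState) {r : ℝ} (hr : 0 < r) :
    ∫⁻ ξ, ENNReal.ofReal (maxwellian u ξ ^ r * japanese ξ) = ENNReal.ofReal (momentConst u r) := by
  rw [momentConst, ofReal_integral_eq_lintegral_ofReal]
  · simpa using integrable_maxwellian_rpow_mul_japanese u hr 1
  · exact Filter.Eventually.of_forall fun ξ =>
      mul_nonneg (Real.rpow_nonneg (maxwellian_pos u ξ).le _) (japanese_pos ξ).le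

/-- The area of the unit sphere. -/
def area : ℝ := surface.real Set.univ

theorem ofReal_area : ENNReal.ofReal area = surface Set.univ := by
  simp only [area, measureReal_def]
  exact ENNReal.ofReal_toReal (measure_ne_top _ _)

theorem area_pos : 0 < area := by
  unfold area
  rw [measureReal_def]
  refine ENNReal.toReal_pos ?_ (measure_ne_top _ _)
  rw [Ne, Measure.measure_univ_eq_zero]
  exact Measure.toSphere_ne_zero _

/-- Upper bound of the collision frequency. -/
theorem lintegral_frequency_le (u : FluidState) (ξ : Vel) :
    ∫⁻ p, ENNReal.ofReal (maxwellian u p.1 * kernelB (ξ, p)) ∂collisionMeasure ≤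
      ENNReal.ofReal (2 * (momentConst u 1 * area) * japanese ξ) := by
  have hJ := continuous_japanese.measurable
  have hM := measurable_maxwellian u
  calc ∫⁻ p, ENNReal.ofReal (maxwellian u p.1 * kernelB (ξ, p)) ∂collisionMeasure
      ≤ ∫⁻ p, ENNReal.ofReal (2 * japanese ξ) *
          ENNReal.ofReal (maxwellian u p.1 ^ (1 : ℝ) * japanese p.1) ∂collisionMeasure := by
        refine lintegral_mono fun p => ?_
        have h1 := maxwellian_pos u p.1
        have h2 := japanese_pos ξ
        rw [← ENNReal.ofReal_mul (by positivity)]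
        refine ENNReal.ofReal_le_ofReal ?_
        have := mul_le_mul_of_nonneg_left (kernelB_le (ξ, p)) h1.le
        simp only [Real.rpow_one] at this ⊢
        linarith
    _ = _ := by
        rw [lintegral_const_mul _ (by fun_prop),
          lintegral_collisionMeasure_fst (g := fun η =>
            ENNReal.ofReal (maxwellian u η ^ (1 : ℝ) * japanese η)) (by fun_prop),
          lintegral_maxwellian_rpow_mul_japanese u one_pos, ← ofReal_area,
          ← ENNReal.ofReal_mul (momentConst_nonneg _ _), ← ENNReal.ofReal_mul
            (by have := japanese_pos ξ; positivity)]
        congr 1; ring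

/-- The constant in `bilinear_bound`. -/
def bilinearConst (u : FluidState) (s lam : ℝ) : ℝ :=
  2 * (momentConst u 1 * area) * (weightConst u s lam * (2 * area))

theorem bilinearConst_nonneg (u : FluidState) (s : ℝ) {lam : ℝ} (hl : 0 ≤ lam) :
    0 ≤ bilinearConst u s lam := by
  have := momentConst_nonneg u 1
  have := area_pos
  have := weightConst_pos u s hl
  unfold bilinearConst
  positivity

/-- The bound B ≤ 2⟨ξ⟩⟨ξ_*⟩ separates the variables. -/
theorem lintegral_weight_product_le (u : FluidState) (s : ℝ) {lam : ℝ} (hl : 0 ≤ lam)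
    {a f : Vel → ℝ} (ha : Measurable a) (hf : Measurable f) :
    ∫⁻ x, ENNReal.ofReal (weight u s lam x.1 * weight u s lam x.2.1 * (a x.1 ^ 2 * f x.2.1 ^ 2) *
      kernelB x) ∂encounterMeasure ≤
      ENNReal.ofReal (2 * area) * nsq u s lam 1 a * nsq u s lam 1 f := by
  have hJ := continuous_japanese.measurable
  have hw := measurable_weight u s lam
  set G : (Vel → ℝ) → Vel → ENNReal := fun a ξ =>
    ENNReal.ofReal (japanese ξ ^ (1 : ℤ) * weight u s lam ξ) * ENNReal.ofReal (a ξ ^ 2) with hG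
  have hGm : ∀ {a : Vel → ℝ}, Measurable a → Measurable (G a) := by
    intro a ha
    simp only [hG, zpow_one]
    fun_prop
  have hle : ∀ x : Encounter, ENNReal.ofReal (weight u s lam x.1 * weight u s lam x.2.1 *
      (a x.1 ^ 2 * f x.2.1 ^ 2) * kernelB x) ≤ ENNReal.ofReal 2 * (G a x.1 * G f x.2.1) := by
    intro x
    have h1 := weight_pos u s hl x.1
    have h2 := weight_pos u s hl x.2.1
    have h3 := japanese_pos x.1
    have h4 := japanese_pos x.2.1
    simp only [hG, zpow_one]
    rw [← ENNReal.ofReal_mul (by positivity), ← ENNReal.ofReal_mul (by positivity),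
      ← ENNReal.ofReal_mul (by positivity), ← ENNReal.ofReal_mul (by positivity)]
    refine ENNReal.ofReal_le_ofReal ?_
    have h5 := mul_le_mul_of_nonneg_left (kernelB_le x)
      (by positivity : 0 ≤ weight u s lam x.1 * weight u s lam x.2.1 * (a x.1 ^ 2 * f x.2.1 ^ 2))
    linarith
  calc _ ≤ ∫⁻ x, ENNReal.ofReal 2 * (G a x.1 * G f x.2.1) ∂encounterMeasure := lintegral_mono hle
    _ = ENNReal.ofReal 2 * ((∫⁻ ξ, G a ξ) * ∫⁻ p, G f p.1 ∂collisionMeasure) := by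
        have hm : Measurable fun x : Encounter => G a x.1 * G f x.2.1 :=
          ((hGm ha).comp measurable_fst).mul ((hGm hf).comp (measurable_fst.comp measurable_snd))
        rw [lintegral_const_mul _ hm]
        congr 1
        exact lintegral_prod_mul (hGm ha).aemeasurable ((hGm hf).comp measurable_fst).aemeasurable
    _ = _ := by
        rw [lintegral_collisionMeasure_fst (hGm hf), ← ofReal_area, ENNReal.ofReal_mul (by norm_num)]
        simp only [nsq, hG]
        ring

/-- The basic bilinear estimate, for the gain term (`T = colMap`) and the loss term (`T = id`). -/
theorem bilinear_bound (u : FluidState) {s lam : ℝ} (hs : 1 / 2 ≤ s) (hl : 0 ≤ lam)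
    {T : Encounter → Encounter} (hT : MeasurePreserving T encounterMeasure encounterMeasure)
    (hTB : ∀ x, kernelB (T x) = kernelB x)
    (hTM : ∀ x, maxwellian u (T x).1 * maxwellian u (T x).2.1 = maxwellian u x.1 * maxwellian u x.2.1)
    {a f : Vel → ℝ} (ha : Measurable a) (hf : Measurable f) :
    ∫⁻ ξ, ENNReal.ofReal (japanese ξ ^ (-1 : ℤ) * weight u s lam ξ) *
        (∫⁻ p, ENNReal.ofReal (|a (T (ξ, p)).1 * f (T (ξ, p)).2.1| * kernelB (ξ, p))
          ∂collisionMeasure) ^ 2 ≤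
      ENNReal.ofReal (bilinearConst u s lam) * nsq u s lam 1 a * nsq u s lam 1 f := by
  have hB := continuous_kernelB.measurable
  have hTm := hT.measurable
  have hM := measurable_maxwellian u
  have hw := measurable_weight u s lam
  have hC : 0 ≤ 2 * (momentConst u 1 * area) := by
    have := momentConst_nonneg u 1
    have := area_pos
    positivity
  set D := 2 * (momentConst u 1 * area) with hD
  set H : Encounter → ENNReal := fun x => ENNReal.ofReal (weight u s lam x.1 * weight u s lam x.2.1 *
    (a x.1 ^ 2 * f x.2.1 ^ 2) * kernelB x) with hH
  have hHm : Measurable H := by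
    simp only [hH]
    fun_prop
  have key : ∀ ξ : Vel, ENNReal.ofReal (japanese ξ ^ (-1 : ℤ) * weight u s lam ξ) *
        (∫⁻ p, ENNReal.ofReal (|a (T (ξ, p)).1 * f (T (ξ, p)).2.1| * kernelB (ξ, p))
          ∂collisionMeasure) ^ 2 ≤
      ENNReal.ofReal D * (ENNReal.ofReal (weightConst u s lam) *
        ∫⁻ p, H (T (ξ, p)) ∂collisionMeasure) := by
    intro ξ
    have hJξ := japanese_pos ξ
    have hwξ := weight_pos u s hl ξ
    have hm : Measurable fun p : Vel × Sph => T (ξ, p) := hTm.comp measurable_prodMk_left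
    have hBm : Measurable fun p : Vel × Sph => kernelB (ξ, p) := hB.comp measurable_prodMk_left
    have hF1 : Measurable fun p : Vel × Sph =>
        ENNReal.ofReal (√(maxwellian u p.1 * kernelB (ξ, p))) := by fun_prop
    have hF2 : Measurable fun p : Vel × Sph =>
        ENNReal.ofReal (|a (T (ξ, p)).1 * f (T (ξ, p)).2.1| *
          √(kernelB (ξ, p) / maxwellian u p.1)) := by fun_prop
    -- The first factor squares to M_* B, whose integral is O(⟨ξ⟩) and cancels the weight ⟨ξ⟩⁻¹; the
    -- second carries 1/M_*, which `weight_le` compensates.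
    have cs := cauchySchwarz_lintegral collisionMeasure hF1.aemeasurable hF2.aemeasurable
    have e0 : ∀ p : Vel × Sph, ENNReal.ofReal (√(maxwellian u p.1 * kernelB (ξ, p))) *
        ENNReal.ofReal (|a (T (ξ, p)).1 * f (T (ξ, p)).2.1| *
          √(kernelB (ξ, p) / maxwellian u p.1)) =
        ENNReal.ofReal (|a (T (ξ, p)).1 * f (T (ξ, p)).2.1| * kernelB (ξ, p)) := by
      intro p
      have h1 := maxwellian_pos u p.1
      have h2 := kernelB_nonneg (ξ, p)
      rw [← ENNReal.ofReal_mul (Real.sqrt_nonneg _)]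
      congr 1
      have : √(maxwellian u p.1 * kernelB (ξ, p)) * √(kernelB (ξ, p) / maxwellian u p.1) =
          kernelB (ξ, p) := by
        rw [← Real.sqrt_mul (by positivity)]
        have : maxwellian u p.1 * kernelB (ξ, p) * (kernelB (ξ, p) / maxwellian u p.1) =
          kernelB (ξ, p) ^ 2 := by field_simp
        rw [this, Real.sqrt_sq h2]
      linear_combination (|a (T (ξ, p)).1 * f (T (ξ, p)).2.1|) * this
    have e1 : ∀ p : Vel × Sph, ENNReal.ofReal (√(maxwellian u p.1 * kernelB (ξ, p))) ^ 2 =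
        ENNReal.ofReal (maxwellian u p.1 * kernelB (ξ, p)) := by
      intro p
      have h1 := maxwellian_pos u p.1
      have h2 := kernelB_nonneg (ξ, p)
      rw [← ENNReal.ofReal_pow (Real.sqrt_nonneg _), Real.sq_sqrt (by positivity)]
    simp only [e0, e1] at cs
    calc _ ≤ ENNReal.ofReal (japanese ξ ^ (-1 : ℤ) * weight u s lam ξ) *
          (ENNReal.ofReal (D * japanese ξ) *
          ∫⁻ p, ENNReal.ofReal (|a (T (ξ, p)).1 * f (T (ξ, p)).2.1| *
          √(kernelB (ξ, p) / maxwellian u p.1)) ^ 2 ∂collisionMeasure) := by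
          gcongr
          exact cs.trans (mul_le_mul_left (lintegral_frequency_le u ξ) _)
      _ = ENNReal.ofReal D * ∫⁻ p, ENNReal.ofReal (weight u s lam ξ) *
          ENNReal.ofReal (|a (T (ξ, p)).1 * f (T (ξ, p)).2.1| *
          √(kernelB (ξ, p) / maxwellian u p.1)) ^ 2 ∂collisionMeasure := by
          rw [lintegral_const_mul _ (hF2.pow_const 2), ← mul_assoc, ← mul_assoc,
            ← ENNReal.ofReal_mul (by positivity), ← ENNReal.ofReal_mul hC]
          congr 2
          rw [zpow_neg_one]
          field_simp
      _ ≤ _ := by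
          gcongr
          have hHTm : Measurable fun p : Vel × Sph => H (T (ξ, p)) := hHm.comp hm
          rw [← lintegral_const_mul _ hHTm]
          refine lintegral_mono fun p => ?_
          have h1 := maxwellian_pos u p.1
          have h2 := kernelB_nonneg (ξ, p)
          simp only [hH, hTB]
          rw [← ENNReal.ofReal_pow (by positivity), ← ENNReal.ofReal_mul hwξ.le,
            ← ENNReal.ofReal_mul (weightConst_pos u s hl).le]
          refine ENNReal.ofReal_le_ofReal ?_
          rw [mul_pow, sq_abs, Real.sq_sqrt (by positivity)]
          have h3 := weight_le u hs hl (hTM (ξ, p))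
          calc weight u s lam ξ * ((a (T (ξ, p)).1 * f (T (ξ, p)).2.1) ^ 2 *
                (kernelB (ξ, p) / maxwellian u p.1))
              ≤ (weightConst u s lam * (weight u s lam (T (ξ, p)).1 * weight u s lam (T (ξ, p)).2.1)
                * maxwellian u p.1) * ((a (T (ξ, p)).1 * f (T (ξ, p)).2.1) ^ 2 *
                (kernelB (ξ, p) / maxwellian u p.1)) := by gcongr
            _ = _ := by field_simp
  have hHT : Measurable fun x => H (T x) := hHm.comp hTm
  calc _ ≤ ∫⁻ ξ, ENNReal.ofReal D * (ENNReal.ofReal (weightConst u s lam) *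
        ∫⁻ p, H (T (ξ, p)) ∂collisionMeasure) := lintegral_mono key
    _ = ENNReal.ofReal D * (ENNReal.ofReal (weightConst u s lam) *
        ∫⁻ x, H x ∂encounterMeasure) := by
        have hI : Measurable fun ξ => ∫⁻ p, H (T (ξ, p)) ∂collisionMeasure :=
          hHT.lintegral_prod_right'
        -- T drops out because it preserves the measure on encounters, so gain and loss obey the
        -- same bound.
        rw [lintegral_const_mul _ (hI.const_mul _), lintegral_const_mul _ hI,
          ← hT.lintegral_comp hHm]
        congr 2
        exact (lintegral_prod _ hHT.aemeasurable).symm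
    _ ≤ ENNReal.ofReal D * (ENNReal.ofReal (weightConst u s lam) *
        (ENNReal.ofReal (2 * area) * nsq u s lam 1 a * nsq u s lam 1 f)) := by
        gcongr
        exact lintegral_weight_product_le u s hl ha hf
    _ = _ := by
        rw [bilinearConst, ← hD, ENNReal.ofReal_mul hC, ENNReal.ofReal_mul (weightConst_pos u s hl).le]
        ring

/-- The collision map and the identity, which enter in the gain and in the loss term. -/
structure IsEncounterSymmetry (u : FluidState) (T : Encounter → Encounter) : Prop where
  preserving : MeasurePreserving T encounterMeasure encounterMeasure
  kernel : ∀ x, kernelB (T x) = kernelB x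
  energy : ∀ x, maxwellian u (T x).1 * maxwellian u (T x).2.1 =
    maxwellian u x.1 * maxwellian u x.2.1

theorem isEncounterSymmetry_id (u : FluidState) : IsEncounterSymmetry u id :=
  ⟨MeasurePreserving.id _, fun _ => rfl, fun _ => rfl⟩

theorem isEncounterSymmetry_colMap (u : FluidState) : IsEncounterSymmetry u colMap :=
  ⟨measurePreserving_colMap, kernelB_colMap, maxwellian_colMap u⟩

theorem isEncounterSymmetry_swapMap (u : FluidState) : IsEncounterSymmetry u swapMap :=
  ⟨measurePreserving_swapMap, kernelB_swapMap, fun _ => mul_comm _ _⟩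

theorem IsEncounterSymmetry.comp {u : FluidState} {S T : Encounter → Encounter}
    (hS : IsEncounterSymmetry u S) (hT : IsEncounterSymmetry u T) :
    IsEncounterSymmetry u (S ∘ T) :=
  ⟨hS.preserving.comp hT.preserving, fun x => by simp [hS.kernel, hT.kernel],
    fun x => by simp [hS.energy, hT.energy]⟩

/-- `∫ |a f_*| B` evaluated along `T`. -/
def absTerm (T : Encounter → Encounter) (a f : Vel → ℝ) (ξ : Vel) : ENNReal :=
  ∫⁻ p, ENNReal.ofReal (|a (T (ξ, p)).1 * f (T (ξ, p)).2.1| * kernelB (ξ, p)) ∂collisionMeasure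

theorem measurable_absTerm_integrand {T : Encounter → Encounter} (hT : Measurable T)
    {a f : Vel → ℝ} (ha : Measurable a) (hf : Measurable f) :
    Measurable fun x : Encounter => ENNReal.ofReal (|a (T x).1 * f (T x).2.1| * kernelB x) := by
  have hB := continuous_kernelB.measurable
  fun_prop

theorem measurable_absTerm {T : Encounter → Encounter} (hT : Measurable T)
    {a f : Vel → ℝ} (ha : Measurable a) (hf : Measurable f) : Measurable (absTerm T a f) :=
  (measurable_absTerm_integrand hT ha hf).lintegral_prod_right'

/-- The dual form of `bilinear_bound`: write w = √(⟨ξ⟩w) √(⟨ξ⟩⁻¹w), give the first root to g and the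
second to the collision term, and apply Cauchy–Schwarz. -/
theorem trilinear_bound (u : FluidState) {s lam : ℝ} (hs : 1 / 2 ≤ s) (hl : 0 ≤ lam)
    {T : Encounter → Encounter} (hT : IsEncounterSymmetry u T)
    {a f g : Vel → ℝ} (ha : Measurable a) (hf : Measurable f) (hg : Measurable g) :
    (∫⁻ x, ENNReal.ofReal (weight u s lam x.1 * |g x.1| *
      (|a (T x).1 * f (T x).2.1| * kernelB x)) ∂encounterMeasure) ^ 2 ≤
      nsq u s lam 1 g *
        (ENNReal.ofReal (bilinearConst u s lam) * nsq u s lam 1 a * nsq u s lam 1 f) := by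
  have hw := measurable_weight u s lam
  have hJ := continuous_japanese.measurable
  have hGm := measurable_absTerm hT.preserving.measurable ha hf
  have hIm := measurable_absTerm_integrand hT.preserving.measurable ha hf
  have e1 : ∫⁻ x, ENNReal.ofReal (weight u s lam x.1 * |g x.1| *
      (|a (T x).1 * f (T x).2.1| * kernelB x)) ∂encounterMeasure =
      ∫⁻ ξ, ENNReal.ofReal (weight u s lam ξ * |g ξ|) * absTerm T a f ξ := by
    have e2 : ∀ x : Encounter, ENNReal.ofReal (weight u s lam x.1 * |g x.1| *
      (|a (T x).1 * f (T x).2.1| * kernelB x)) = ENNReal.ofReal (weight u s lam x.1 * |g x.1|) *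
        ENNReal.ofReal (|a (T x).1 * f (T x).2.1| * kernelB x) := fun x =>
      ENNReal.ofReal_mul (mul_nonneg (weight_pos u s hl _).le (abs_nonneg _))
    simp only [e2]
    have hm : Measurable fun x : Encounter => ENNReal.ofReal (weight u s lam x.1 * |g x.1|) *
        ENNReal.ofReal (|a (T x).1 * f (T x).2.1| * kernelB x) :=
      Measurable.mul (by fun_prop) hIm
    rw [encounterMeasure, lintegral_prod _ hm.aemeasurable]
    refine lintegral_congr fun ξ => ?_
    have hm' : Measurable fun p => ENNReal.ofReal (|a (T (ξ, p)).1 * f (T (ξ, p)).2.1| *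
        kernelB (ξ, p)) := hIm.comp measurable_prodMk_left
    exact lintegral_const_mul (ENNReal.ofReal (weight u s lam ξ * |g ξ|)) hm'
  rw [e1]
  have e3 : ∀ ξ, ENNReal.ofReal (weight u s lam ξ * |g ξ|) * absTerm T a f ξ =
      ENNReal.ofReal (√(japanese ξ * weight u s lam ξ) * |g ξ|) *
      (ENNReal.ofReal (√((japanese ξ)⁻¹ * weight u s lam ξ)) * absTerm T a f ξ) := by
    intro ξ
    have h1 := weight_pos u s hl ξ
    have h2 := japanese_pos ξ
    rw [← mul_assoc, ← ENNReal.ofReal_mul (by positivity)]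
    congr 2
    have : √(japanese ξ * weight u s lam ξ) * √((japanese ξ)⁻¹ * weight u s lam ξ) =
        weight u s lam ξ := by
      rw [← Real.sqrt_mul (by positivity)]
      have : japanese ξ * weight u s lam ξ * ((japanese ξ)⁻¹ * weight u s lam ξ) =
        weight u s lam ξ ^ 2 := by field_simp
      rw [this, Real.sqrt_sq h1.le]
    linear_combination (-|g ξ|) * this
  simp only [e3]
  refine (cauchySchwarz_lintegral _ (by fun_prop) (by fun_prop)).trans ?_
  refine mul_le_mul' (le_of_eq ?_) ?_
  · refine lintegral_congr fun ξ => ?_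
    have h1 := weight_pos u s hl ξ
    have h2 := japanese_pos ξ
    rw [← ENNReal.ofReal_pow (by positivity), mul_pow, Real.sq_sqrt (by positivity), sq_abs,
      zpow_one, ENNReal.ofReal_mul (by positivity)]
  · refine le_trans (le_of_eq ?_)
      (bilinear_bound u hs hl hT.preserving hT.kernel hT.energy ha hf)
    refine lintegral_congr fun ξ => ?_
    have h1 := weight_pos u s hl ξ
    have h2 := japanese_pos ξ
    rw [mul_pow, ← ENNReal.ofReal_pow (by positivity), Real.sq_sqrt (by positivity), zpow_neg_one,
      absTerm]

theorem trilinear_integrable (u : FluidState) {s lam : ℝ} (hs : 1 / 2 ≤ s) (hl : 0 ≤ lam)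
    {T : Encounter → Encounter} (hT : IsEncounterSymmetry u T)
    {a f g : Vel → ℝ} (ha : Measurable a) (hf : Measurable f) (hg : Measurable g)
    (hna : nsq u s lam 1 a ≠ ⊤) (hnf : nsq u s lam 1 f ≠ ⊤) (hng : nsq u s lam 1 g ≠ ⊤) :
    Integrable (fun x => weight u s lam x.1 * g x.1 * (a (T x).1 * f (T x).2.1 * kernelB x))
      encounterMeasure := by
  have hw := measurable_weight u s lam
  have hB := continuous_kernelB.measurable
  have hTm := hT.preserving.measurable
  refine ⟨Measurable.aestronglyMeasurable (by fun_prop), ?_⟩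
  have h := trilinear_bound u hs hl hT ha hf hg
  have h2 : (∫⁻ x, ENNReal.ofReal (weight u s lam x.1 * |g x.1| *
      (|a (T x).1 * f (T x).2.1| * kernelB x)) ∂encounterMeasure) ^ 2 ≠ ⊤ :=
    ne_top_of_le_ne_top (by finiteness) h
  have h3 : ∫⁻ x, ENNReal.ofReal (weight u s lam x.1 * |g x.1| *
      (|a (T x).1 * f (T x).2.1| * kernelB x)) ∂encounterMeasure < ⊤ :=
    lt_top_iff_ne_top.2 fun h => h2 (by rw [h]; simp)
  refine lt_of_le_of_lt (le_of_eq ?_) h3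
  refine lintegral_congr fun x => ?_
  rw [Real.enorm_eq_ofReal_abs]
  congr 1
  rw [abs_mul, abs_mul, abs_mul _ (kernelB x), abs_of_pos (weight_pos u s hl _),
    abs_of_nonneg (kernelB_nonneg x)]

/-! ### The collision operator: convergence, bounds and independence of representatives -/

theorem collisionIntegrand_eq (a f : Vel → ℝ) (ξ : Vel) (p : Vel × Sph) :
    collisionIntegrand a f ξ p =
      a (colMap (ξ, p)).1 * f (colMap (ξ, p)).2.1 * kernelB (ξ, p) - a ξ * f p.1 * kernelB (ξ, p) := by
  simp only [collisionIntegrand, colMap, kernelB]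
  ring

theorem measurable_term {T : Encounter → Encounter} (hT : Measurable T) {a f : Vel → ℝ}
    (ha : Measurable a) (hf : Measurable f) :
    Measurable fun x : Encounter => a (T x).1 * f (T x).2.1 * kernelB x := by
  have hB := continuous_kernelB.measurable
  fun_prop

theorem measurable_collisionIntegrand {a f : Vel → ℝ} (ha : Measurable a) (hf : Measurable f) :
    Measurable fun x : Encounter => collisionIntegrand a f x.1 x.2 := by
  simp only [collisionIntegrand_eq, Prod.mk.eta]
  exact (measurable_term continuous_colMap.measurable ha hf).sub (measurable_term measurable_id ha hf)

theorem stronglyMeasurable_collision {a f : Vel → ℝ} (ha : Measurable a) (hf : Measurable f) :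
    StronglyMeasurable (collision a f) :=
  (measurable_collisionIntegrand ha hf).stronglyMeasurable.integral_prod_right'

/-- A finite integral against a positive weight forces finiteness almost everywhere. -/
theorem absTerm_ae_lt_top (u : FluidState) {s lam : ℝ} (hs : 1 / 2 ≤ s) (hl : 0 ≤ lam)
    {T : Encounter → Encounter} (hT : IsEncounterSymmetry u T)
    {a f : Vel → ℝ} (ha : Measurable a) (hf : Measurable f)
    (hna : nsq u s lam 1 a ≠ ⊤) (hnf : nsq u s lam 1 f ≠ ⊤) :
    ∀ᵐ ξ, absTerm T a f ξ < ⊤ := by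
  have hw := measurable_weight u s lam
  have hGm := measurable_absTerm hT.preserving.measurable ha hf
  have h := bilinear_bound u hs hl hT.preserving hT.kernel hT.energy ha hf
  have hm := measurable_density u s lam (-1)
  have h2 := ae_lt_top (hm.mul (hGm.pow_const 2)) (ne_top_of_le_ne_top (by finiteness) h)
  filter_upwards [h2] with ξ hξ
  by_contra hc
  rw [not_lt, top_le_iff] at hc
  have h1 := mul_pos (zpow_pos (japanese_pos ξ) (-1)) (weight_pos u s hl ξ)
  simp only [Pi.mul_apply, hc] at hξ
  rw [ENNReal.top_pow two_ne_zero, ENNReal.mul_top (by simpa using h1)] at hξ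
  exact lt_irrefl _ hξ

theorem integrable_term (u : FluidState) {s lam : ℝ} (hs : 1 / 2 ≤ s) (hl : 0 ≤ lam)
    {T : Encounter → Encounter} (hT : IsEncounterSymmetry u T)
    {a f : Vel → ℝ} (ha : Measurable a) (hf : Measurable f)
    (hna : nsq u s lam 1 a ≠ ⊤) (hnf : nsq u s lam 1 f ≠ ⊤) :
    ∀ᵐ ξ, Integrable (fun p => a (T (ξ, p)).1 * f (T (ξ, p)).2.1 * kernelB (ξ, p))
      collisionMeasure := by
  have hB := continuous_kernelB.measurable
  have hTm := hT.preserving.measurable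
  filter_upwards [absTerm_ae_lt_top u hs hl hT ha hf hna hnf] with ξ hξ
  have hm : Measurable fun x : Encounter => a (T x).1 * f (T x).2.1 * kernelB x := by fun_prop
  refine ⟨(hm.comp measurable_prodMk_left).aestronglyMeasurable, ?_⟩
  refine lt_of_le_of_lt (le_of_eq ?_) hξ
  refine lintegral_congr fun x => ?_
  rw [Real.enorm_eq_ofReal_abs, abs_mul, abs_of_nonneg (kernelB_nonneg _)]

theorem integrable_collisionIntegrand (u : FluidState) {s lam : ℝ} (hs : 1 / 2 ≤ s) (hl : 0 ≤ lam)
    {a f : Vel → ℝ} (ha : Measurable a) (hf : Measurable f)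
    (hna : nsq u s lam 1 a ≠ ⊤) (hnf : nsq u s lam 1 f ≠ ⊤) :
    ∀ᵐ ξ, Integrable (collisionIntegrand a f ξ) collisionMeasure := by
  filter_upwards [integrable_term u hs hl (isEncounterSymmetry_colMap u) ha hf hna hnf,
    integrable_term u hs hl (isEncounterSymmetry_id u) ha hf hna hnf] with ξ h1 h2
  refine (h1.sub h2).congr (Filter.Eventually.of_forall fun p => ?_)
  rw [collisionIntegrand_eq]
  rfl

theorem ofReal_collision_sq_le (a f : Vel → ℝ) (ha : Measurable a) (hf : Measurable f) (ξ : Vel) :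
    ENNReal.ofReal (collision a f ξ ^ 2) ≤
      2 * (absTerm colMap a f ξ ^ 2 + absTerm id a f ξ ^ 2) := by
  have h1 : ENNReal.ofReal |collision a f ξ| ≤ absTerm colMap a f ξ + absTerm id a f ξ := by
    rw [← Real.enorm_eq_ofReal_abs]
    refine (enorm_integral_le_lintegral_enorm _).trans ?_
    have hm : Measurable fun p => ENNReal.ofReal (|a (colMap (ξ, p)).1 * f (colMap (ξ, p)).2.1| *
        kernelB (ξ, p)) :=
      (measurable_absTerm_integrand continuous_colMap.measurable ha hf).comp measurable_prodMk_left
    rw [absTerm, absTerm, ← lintegral_add_left hm]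
    refine lintegral_mono fun p => ?_
    rw [Real.enorm_eq_ofReal_abs]
    rw [← ENNReal.ofReal_add (mul_nonneg (abs_nonneg _) (kernelB_nonneg _))
      (mul_nonneg (abs_nonneg _) (kernelB_nonneg _))]
    refine ENNReal.ofReal_le_ofReal ?_
    rw [collisionIntegrand_eq]
    refine (abs_sub _ _).trans (le_of_eq ?_)
    rw [abs_mul, abs_mul _ (kernelB (ξ, p)), abs_of_nonneg (kernelB_nonneg _)]
    rfl
  rw [← sq_abs, ENNReal.ofReal_pow (abs_nonneg _)]
  refine (pow_le_pow_left₀ zero_le h1 2).trans ?_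
  have := ENNReal.rpow_add_le_mul_rpow_add_rpow (absTerm colMap a f ξ) (absTerm id a f ξ)
    (p := 2) (by norm_num)
  norm_num at this
  exact this

theorem nsq_collision_le (u : FluidState) {s lam : ℝ} (hs : 1 / 2 ≤ s) (hl : 0 ≤ lam)
    {a f : Vel → ℝ} (ha : Measurable a) (hf : Measurable f) :
    nsq u s lam (-1) (collision a f) ≤
      ENNReal.ofReal (4 * bilinearConst u s lam) * nsq u s lam 1 a * nsq u s lam 1 f := by
  have hm := measurable_density u s lam (-1)
  have hG1 := measurable_absTerm continuous_colMap.measurable ha hf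
  have hG2 := measurable_absTerm measurable_id ha hf
  have hc := isEncounterSymmetry_colMap u
  have hi := isEncounterSymmetry_id u
  have h1 := bilinear_bound u hs hl hc.preserving hc.kernel hc.energy ha hf
  have h2 := bilinear_bound u hs hl hi.preserving hi.kernel hi.energy ha hf
  calc nsq u s lam (-1) (collision a f)
      ≤ ∫⁻ ξ, (2 * (ENNReal.ofReal (japanese ξ ^ (-1 : ℤ) * weight u s lam ξ) * absTerm colMap a f ξ ^ 2) +
          2 * (ENNReal.ofReal (japanese ξ ^ (-1 : ℤ) * weight u s lam ξ) * absTerm id a f ξ ^ 2)) := by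
        refine lintegral_mono fun ξ => ?_
        refine (mul_le_mul_right (ofReal_collision_sq_le a f ha hf ξ) _).trans (le_of_eq ?_)
        ring
    _ ≤ 2 * (ENNReal.ofReal (bilinearConst u s lam) * nsq u s lam 1 a * nsq u s lam 1 f) +
        2 * (ENNReal.ofReal (bilinearConst u s lam) * nsq u s lam 1 a * nsq u s lam 1 f) := by
        have m1 : Measurable fun ξ => ENNReal.ofReal (japanese ξ ^ (-1 : ℤ) * weight u s lam ξ) *
          absTerm colMap a f ξ ^ 2 := hm.mul (hG1.pow_const 2)
        have m2 : Measurable fun ξ => ENNReal.ofReal (japanese ξ ^ (-1 : ℤ) * weight u s lam ξ) *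
          absTerm id a f ξ ^ 2 := hm.mul (hG2.pow_const 2)
        rw [lintegral_add_left (m1.const_mul 2), lintegral_const_mul _ m1, lintegral_const_mul _ m2]
        exact add_le_add (mul_le_mul_right h1 2) (mul_le_mul_right h2 2)
    _ = _ := by
        rw [ENNReal.ofReal_mul (by norm_num)]
        norm_num
        ring

/-- Fubini, justified by `trilinear_integrable` for the gain and the loss term separately. On
encounters the collision symmetries become available. -/
theorem pairing_collision (u : FluidState) {s lam : ℝ} (hs : 1 / 2 ≤ s) (hl : 0 ≤ lam)
    {a f g : Vel → ℝ} (ha : Measurable a) (hf : Measurable f) (hg : Measurable g)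
    (hna : nsq u s lam 1 a ≠ ⊤) (hnf : nsq u s lam 1 f ≠ ⊤) (hng : nsq u s lam 1 g ≠ ⊤) :
    Integrable (fun ξ => weight u s lam ξ * (collision a f ξ * g ξ)) ∧
    pairing u s lam (collision a f) g =
      ∫ x, weight u s lam x.1 * g x.1 * (a (colMap x).1 * f (colMap x).2.1 * kernelB x -
        a x.1 * f x.2.1 * kernelB x) ∂encounterMeasure := by
  have i1 := trilinear_integrable u hs hl (isEncounterSymmetry_colMap u) ha hf hg hna hnf hng
  have i2 := trilinear_integrable u hs hl (isEncounterSymmetry_id u) ha hf hg hna hnf hng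
  have i3 : Integrable (fun x : Encounter => weight u s lam x.1 * g x.1 *
      (a (colMap x).1 * f (colMap x).2.1 * kernelB x - a x.1 * f x.2.1 * kernelB x))
      (volume.prod collisionMeasure) := by
    refine (i1.sub i2).congr (Filter.Eventually.of_forall fun x => ?_)
    simp only [Pi.sub_apply, id]
    ring
  have e : ∀ ξ : Vel, ∫ p, weight u s lam ξ * g ξ * (a (colMap (ξ, p)).1 * f (colMap (ξ, p)).2.1 *
      kernelB (ξ, p) - a ξ * f p.1 * kernelB (ξ, p)) ∂collisionMeasure =
      weight u s lam ξ * (collision a f ξ * g ξ) := by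
    intro ξ
    rw [integral_const_mul, collision]
    simp only [collisionIntegrand_eq]
    ring
  constructor
  · have := i3.integral_prod_left
    simpa only [e] using this
  · rw [encounterMeasure, integral_prod _ i3]
    simp only [e]
    rfl

/-- All four velocities of an encounter pull null sets back to null sets, because `colMap` preserves
the measure. -/
theorem collisionIntegrand_congr {a a' f f' : Vel → ℝ} (ha : a =ᵐ[volume] a')
    (hf : f =ᵐ[volume] f') :
    ∀ᵐ ξ, collisionIntegrand a f ξ =ᵐ[collisionMeasure] collisionIntegrand a' f' ξ := by
  have q1 : Measure.QuasiMeasurePreserving (fun x : Encounter => x.1) encounterMeasure volume :=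
    Measure.quasiMeasurePreserving_fst
  have q2' : Measure.QuasiMeasurePreserving (fun x : Vel × Sph => x.1) collisionMeasure volume :=
    Measure.quasiMeasurePreserving_fst
  have q2 : Measure.QuasiMeasurePreserving (fun x : Encounter => x.2.1) encounterMeasure volume :=
    q2'.comp Measure.quasiMeasurePreserving_snd
  have qc := measurePreserving_colMap.quasiMeasurePreserving
  have key : ∀ᵐ x ∂encounterMeasure, collisionIntegrand a f x.1 x.2 =
      collisionIntegrand a' f' x.1 x.2 := by
    filter_upwards [q1.ae_eq_comp ha, q2.ae_eq_comp hf, (q1.comp qc).ae_eq_comp ha,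
      (q2.comp qc).ae_eq_comp hf] with x h1 h2 h3 h4
    simp only [Function.comp] at h1 h2 h3 h4
    simp only [collisionIntegrand_eq, Prod.mk.eta, h1, h2, h3, h4]
  exact Measure.ae_ae_of_ae_prod key

theorem collision_congr {a a' f f' : Vel → ℝ} (ha : a =ᵐ[volume] a') (hf : f =ᵐ[volume] f') :
    collision a f =ᵐ[volume] collision a' f' := by
  filter_upwards [collisionIntegrand_congr ha hf] with ξ h
  exact integral_congr_ae h

/-! ### Lower bound of the collision frequency -/

/-- The right side is at least 2‖c‖ and at least 2‖η‖, hence at least the mean of the two. -/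
theorem one_add_norm_mul_min_le (c η : Vel) :
    (1 + ‖c‖) * min ‖η‖ 1 ≤ ‖c - η‖ + ‖c + η‖ := by
  have h1 : 2 * ‖c‖ ≤ ‖c - η‖ + ‖c + η‖ := by
    have := norm_add_le (c - η) (c + η)
    have e : c - η + (c + η) = (2 : ℝ) • c := by rw [two_smul]; abel
    rw [e, norm_smul] at this
    simpa using this
  have h2 : 2 * ‖η‖ ≤ ‖c - η‖ + ‖c + η‖ := by
    have := norm_sub_le (c + η) (c - η)
    have e : c + η - (c - η) = (2 : ℝ) • η := by rw [two_smul]; abel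
    rw [e, norm_smul] at this
    simp only [Real.norm_ofNat] at this
    linarith
  have h3 : ‖c‖ * min ‖η‖ 1 ≤ ‖c‖ := mul_le_of_le_one_right (norm_nonneg _) (min_le_right _ _)
  have h4 := min_le_left ‖η‖ 1
  nlinarith

/-- Centre the Maxwellian at its mean velocity and average over η ↦ -η; `one_add_norm_mul_min_le`
then produces growth in ‖ξ - v‖ together with positivity at ξ = v. -/
theorem lintegral_maxwellian_norm_sub_ge (u : FluidState) (ξ : Vel) :
    ENNReal.ofReal (1 + ‖ξ - u.v‖) *
      (∫⁻ η : Vel, ENNReal.ofReal (amp u * Real.exp (-(‖η‖ ^ 2 / tmp u)) * min ‖η‖ 1)) ≤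
    2 * ∫⁻ ξs, ENNReal.ofReal (maxwellian u ξs * ‖ξ - ξs‖) := by
  set g : Vel → ℝ := fun η => amp u * Real.exp (-(‖η‖ ^ 2 / tmp u)) with hg
  have hg0 : ∀ η, 0 ≤ g η := fun η => mul_nonneg (amp_pos u).le (Real.exp_pos _).le
  have hgm : Measurable g := by
    simp only [hg]
    fun_prop
  set c := ξ - u.v
  have e1 : ∫⁻ ξs, ENNReal.ofReal (maxwellian u ξs * ‖ξ - ξs‖) =
      ∫⁻ η, ENNReal.ofReal (g η * ‖c - η‖) := by
    rw [← lintegral_add_right_eq_self _ u.v]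
    refine lintegral_congr fun η => ?_
    rw [maxwellian_eq]
    congr 2
    · simp [hg]
    · congr 1
      simp only [c]
      abel
  have e2 : ∫⁻ η, ENNReal.ofReal (g η * ‖c - η‖) = ∫⁻ η, ENNReal.ofReal (g η * ‖c + η‖) := by
    rw [← lintegral_neg_eq_self]
    refine lintegral_congr fun η => ?_
    simp [hg, sub_neg_eq_add]
  calc _ = ∫⁻ η, ENNReal.ofReal (1 + ‖c‖) * ENNReal.ofReal (g η * min ‖η‖ 1) :=
        (lintegral_const_mul _ (by fun_prop)).symm
    _ ≤ ∫⁻ η, (ENNReal.ofReal (g η * ‖c - η‖) + ENNReal.ofReal (g η * ‖c + η‖)) := by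
        refine lintegral_mono fun η => ?_
        rw [← ENNReal.ofReal_mul (by positivity), ← ENNReal.ofReal_add
          (mul_nonneg (hg0 η) (norm_nonneg _)) (mul_nonneg (hg0 η) (norm_nonneg _))]
        refine ENNReal.ofReal_le_ofReal ?_
        have := mul_le_mul_of_nonneg_left (one_add_norm_mul_min_le c η) (hg0 η)
        linarith
    _ = _ := by
        rw [lintegral_add_left (by fun_prop), ← e2, ← e1, two_mul]

/-- Lower bound of the collision frequency. -/
theorem exists_frequency_ge (u : FluidState) : ∃ ν₀ : ℝ, 0 < ν₀ ∧ ∀ ξ : Vel,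
    ENNReal.ofReal (ν₀ * japanese ξ) ≤
      ∫⁻ p, ENNReal.ofReal (maxwellian u p.1 * kernelB (ξ, p)) ∂collisionMeasure := by
  have hM := measurable_maxwellian u
  set Y := ∫⁻ η : Vel, ENNReal.ofReal (amp u * Real.exp (-(‖η‖ ^ 2 / tmp u)) * min ‖η‖ 1) with hY
  have hY0 : 0 < Y := by
    rw [pos_iff_ne_zero, hY, Ne, lintegral_eq_zero_iff (by fun_prop)]
    intro h
    have h2 : ∀ᵐ η : Vel, η = 0 := by
      filter_upwards [h] with η hη
      simp only [Pi.zero_apply, ENNReal.ofReal_eq_zero] at hη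
      by_contra hne
      have : 0 < amp u * Real.exp (-(‖η‖ ^ 2 / tmp u)) * min ‖η‖ 1 :=
        mul_pos (mul_pos (amp_pos u) (Real.exp_pos _)) (lt_min (norm_pos_iff.2 hne) one_pos)
      linarith
    have h3 : volume {η : Vel | η ≠ 0} = 0 := h2
    have h4 : (volume : Measure Vel) Set.univ = 0 := by
      have : (Set.univ : Set Vel) = {η : Vel | η ≠ 0} ∪ {0} := by
        ext x
        simp only [Set.mem_univ, Set.mem_union, Set.mem_ofPred_eq, Set.mem_singleton_iff, true_iff]
        exact ne_or_eq x 0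
      rw [this]
      exact measure_union_null h3 (measure_singleton _)
    rw [Measure.measure_univ_eq_zero] at h4
    exact (NeZero.ne (volume : Measure Vel)) h4
  -- Any positive real below Y serves, so finiteness of Y is not needed.
  obtain ⟨y, hy0, hyY, hyY'⟩ := ENNReal.lt_iff_exists_real_btwn.1 hY0
  rw [ENNReal.ofReal_pos] at hyY
  have hv : 0 < 1 + ‖u.v‖ := by positivity
  refine ⟨surfaceMean * (y / 2 / (1 + ‖u.v‖)), by have := surfaceMean_pos; positivity, fun ξ => ?_⟩
  have e : ∫⁻ p, ENNReal.ofReal (maxwellian u p.1 * kernelB (ξ, p)) ∂collisionMeasure =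
      ENNReal.ofReal surfaceMean * ∫⁻ ξs, ENNReal.ofReal (maxwellian u ξs * ‖ξ - ξs‖) := by
    have hB := continuous_kernelB.measurable
    have hm : Measurable fun p : Vel × Sph => ENNReal.ofReal (maxwellian u p.1 * kernelB (ξ, p)) := by
      have : Measurable fun p : Vel × Sph => kernelB (ξ, p) := hB.comp measurable_prodMk_left
      fun_prop
    rw [collisionMeasure, lintegral_prod _ hm.aemeasurable, ← lintegral_const_mul _ (by fun_prop)]
    refine lintegral_congr fun ξs => ?_
    have h1 := maxwellian_pos u ξs
    simp only [kernelB, ENNReal.ofReal_mul h1.le]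
    rw [lintegral_const_mul, lintegral_hardSphere_sphere, ENNReal.ofReal_mul surfaceMean_pos.le]
    · ring
    · unfold hardSphere
      fun_prop
  rw [e, mul_assoc, ENNReal.ofReal_mul surfaceMean_pos.le]
  gcongr
  have h2 := lintegral_maxwellian_norm_sub_ge u ξ
  have h3 : ENNReal.ofReal (1 + ‖ξ - u.v‖) * ENNReal.ofReal y ≤
      2 * ∫⁻ ξs, ENNReal.ofReal (maxwellian u ξs * ‖ξ - ξs‖) :=
    le_trans (mul_le_mul_right hyY'.le _) h2
  have h4 : 2 * ENNReal.ofReal (y / 2 / (1 + ‖u.v‖) * japanese ξ) ≤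
      2 * ∫⁻ ξs, ENNReal.ofReal (maxwellian u ξs * ‖ξ - ξs‖) := by
    refine le_trans ?_ h3
    have two : ∀ t : ℝ, 2 * ENNReal.ofReal t = ENNReal.ofReal (2 * t) := fun t => by
      rw [ENNReal.ofReal_mul (by norm_num)]; simp
    rw [← ENNReal.ofReal_mul (by positivity), two]
    refine ENNReal.ofReal_le_ofReal ?_
    have h5 : japanese ξ ≤ (1 + ‖u.v‖) * (1 + ‖ξ - u.v‖) := by
      have h6 := japanese_le ξ
      have h7 : ‖ξ‖ ≤ ‖ξ - u.v‖ + ‖u.v‖ := by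
        have := norm_add_le (ξ - u.v) u.v
        simpa using this
      nlinarith [norm_nonneg (ξ - u.v), norm_nonneg u.v]
    have h8 : y / 2 / (1 + ‖u.v‖) * japanese ξ ≤
        y / 2 / (1 + ‖u.v‖) * ((1 + ‖u.v‖) * (1 + ‖ξ - u.v‖)) := by gcongr
    have h9 : y / 2 / (1 + ‖u.v‖) * ((1 + ‖u.v‖) * (1 + ‖ξ - u.v‖)) =
        y / 2 * (1 + ‖ξ - u.v‖) := by field_simp
    linarith
  exact (ENNReal.mul_le_mul_iff_right (by norm_num) (by norm_num)).1 h4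

/-! ### Decay of the kernels in the cross terms -/

/-- An encounter symmetry which sends the second particle to large velocities, in the sense that
is needed for the decay of the collision kernels. -/
def IsSpreading (T : Encounter → Encounter) : Prop :=
  ∀ (v : Vel) (x : Encounter),
    inner ℝ (x.2.2 : Vel) (x.1 - v) ^ 2 ≤ ‖(T x).2.1 - v‖ ^ 2 ∨
    ‖x.1 - v‖ ^ 2 - inner ℝ (x.2.2 : Vel) (x.1 - v) ^ 2 ≤ ‖(T x).2.1 - v‖ ^ 2

theorem inner_sphere_sq_le (Ω : Sph) (x : Vel) : inner ℝ (Ω : Vel) x ^ 2 ≤ ‖x‖ ^ 2 := by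
  rw [← sq_abs]
  exact pow_le_pow_left₀ (abs_nonneg _) (abs_inner_sphere_le Ω x) 2

theorem isSpreading_swapMap : IsSpreading swapMap := fun _ _ => Or.inl (inner_sphere_sq_le _ _)

/-- The component of ξ'_* along Ω is that of ξ. -/
theorem isSpreading_colMap : IsSpreading colMap := by
  intro v x
  left
  have h : inner ℝ (x.2.2 : Vel) (x.1 - v) = inner ℝ (x.2.2 : Vel) ((colMap x).2.1 - v) := by
    simp only [colMap, postVelStar, inner_sub_right, inner_smul_right, sphere_inner_self]
    ring
  rw [h]
  exact inner_sphere_sq_le _ _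

/-- ξ' differs from ξ by a multiple of Ω, so it keeps the component of ξ across Ω. -/
theorem isSpreading_swapMap_colMap : IsSpreading (swapMap ∘ colMap) := by
  intro v x
  right
  obtain ⟨ξ, ξs, Ω⟩ := x
  simp only [Function.comp, swapMap, colMap, postVel]
  set k := inner ℝ (Ω : Vel) (ξs - ξ)
  have e1 : ξ + k • (Ω : Vel) - v = (ξ - v) + k • (Ω : Vel) := by abel
  rw [e1, norm_add_sq_real, inner_smul_right, norm_smul]
  have : ‖(Ω : Vel)‖ = 1 := by simp
  rw [this, mul_one, Real.norm_eq_abs, sq_abs, real_inner_comm]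
  nlinarith [sq_nonneg (k + inner ℝ (ξ - v) (Ω : Vel)), real_inner_comm (ξ - v) (Ω : Vel)]

theorem IsSpreading.maxwellian_rpow_le {T : Encounter → Encounter} (hT : IsSpreading T)
    (u : FluidState) {a : ℝ} (ha : 0 < a) (x : Encounter) :
    maxwellian u (T x).2.1 ^ a ≤ amp u ^ a *
      (Real.exp (-(a / tmp u * inner ℝ (x.2.2 : Vel) (x.1 - u.v) ^ 2)) +
       Real.exp (-(a / tmp u * (‖x.1 - u.v‖ ^ 2 - inner ℝ (x.2.2 : Vel) (x.1 - u.v) ^ 2)))) := by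
  rw [maxwellian_rpow]
  have h0 := Real.rpow_pos_of_pos (amp_pos u) a
  have h1 : 0 < a / tmp u := div_pos ha (tmp_pos u)
  refine mul_le_mul_of_nonneg_left ?_ h0.le
  rcases hT u.v x with h | h
  · refine le_add_of_le_of_nonneg (Real.exp_le_exp.2 ?_) (Real.exp_pos _).le
    exact neg_le_neg (mul_le_mul_of_nonneg_left h h1.le)
  · refine le_add_of_nonneg_of_le (Real.exp_pos _).le (Real.exp_le_exp.2 ?_)
    exact neg_le_neg (mul_le_mul_of_nonneg_left h h1.le)

/-- The kernel `∫ M(T)^a M_*^b B`. -/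
def spreadKernel (u : FluidState) (T : Encounter → Encounter) (a b : ℝ) (ξ : Vel) : ENNReal :=
  ∫⁻ p, ENNReal.ofReal (maxwellian u (T (ξ, p)).2.1 ^ a * maxwellian u p.1 ^ b * kernelB (ξ, p))
    ∂collisionMeasure

/-- Spreading bounds M(T)^a by a function of Ω alone, and B ≤ 2⟨ξ⟩⟨ξ_*⟩; the integral then factors
into a moment in ξ_* and an average over the sphere. -/
theorem spreadKernel_le {T : Encounter → Encounter} (hT : IsSpreading T) (u : FluidState)
    {a b : ℝ} (ha : 0 < a) (hb : 0 < b) (ξ : Vel) :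
    spreadKernel u T a b ξ ≤ ENNReal.ofReal (2 * japanese ξ * amp u ^ a * momentConst u b) *
      sphereDecay (a / tmp u) ‖ξ - u.v‖ := by
  have hM := measurable_maxwellian u
  have hJ := continuous_japanese.measurable
  have h0 := Real.rpow_pos_of_pos (amp_pos u) a
  have hJξ := japanese_pos ξ
  set φ : ℝ → ENNReal := fun t => ENNReal.ofReal (Real.exp (-(a / tmp u * t ^ 2)) +
       Real.exp (-(a / tmp u * (‖ξ - u.v‖ ^ 2 - t ^ 2)))) with hφ
  have hφm : Measurable φ := by simp only [hφ]; fun_prop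
  have hd : sphereDecay (a / tmp u) ‖ξ - u.v‖ = ∫⁻ Ω : Sph, φ (inner ℝ (Ω : Vel) (ξ - u.v)) ∂surface :=
    (surface_inner_eq (ξ - u.v) hφm).symm
  have hle : ∀ p : Vel × Sph, ENNReal.ofReal (maxwellian u (T (ξ, p)).2.1 ^ a *
      maxwellian u p.1 ^ b * kernelB (ξ, p)) ≤ ENNReal.ofReal (2 * japanese ξ * amp u ^ a) *
      (ENNReal.ofReal (maxwellian u p.1 ^ b * japanese p.1) *
        φ (inner ℝ (p.2 : Vel) (ξ - u.v))) := by
    intro p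
    have h1 := Real.rpow_pos_of_pos (maxwellian_pos u p.1) b
    have h2 := japanese_pos p.1
    simp only [hφ]
    rw [← ENNReal.ofReal_mul (by positivity), ← ENNReal.ofReal_mul (by positivity)]
    refine ENNReal.ofReal_le_ofReal ?_
    have h3 := hT.maxwellian_rpow_le u ha (ξ, p)
    have h4 := kernelB_le (ξ, p)
    have h5 := kernelB_nonneg (ξ, p)
    simp only at h3 h4
    set E := Real.exp (-(a / tmp u * inner ℝ (p.2 : Vel) (ξ - u.v) ^ 2)) +
       Real.exp (-(a / tmp u * (‖ξ - u.v‖ ^ 2 - inner ℝ (p.2 : Vel) (ξ - u.v) ^ 2)))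
    have hE : 0 < E := by positivity
    calc _ ≤ amp u ^ a * E * maxwellian u p.1 ^ b * (2 * (japanese ξ * japanese p.1)) := by gcongr
      _ = _ := by ring
  have hφm' : Measurable fun Ω : Sph => φ (inner ℝ (Ω : Vel) (ξ - u.v)) := by fun_prop
  have hg : Measurable fun η => ENNReal.ofReal (maxwellian u η ^ b * japanese η) := by fun_prop
  have hprod : Measurable fun p : Vel × Sph => ENNReal.ofReal (maxwellian u p.1 ^ b * japanese p.1) *
        φ (inner ℝ (p.2 : Vel) (ξ - u.v)) :=
    (hg.comp measurable_fst).mul (hφm'.comp measurable_snd)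
  refine (lintegral_mono hle).trans (le_of_eq ?_)
  rw [lintegral_const_mul _ hprod, lintegral_collisionMeasure_mul hg hφm',
    lintegral_maxwellian_rpow_mul_japanese u hb, ← hd, ← mul_assoc,
    ← ENNReal.ofReal_mul (by positivity)]

/-- Far from the mean velocity the spherical average is small by `tendsto_sphereDecay`; near it, M^r
is bounded below and dominates any bounded quantity. -/
theorem exists_spreadKernel_le {T : Encounter → Encounter} (hT : IsSpreading T) (u : FluidState)
    {a b : ℝ} (ha : 0 < a) (hb : 0 < b) {r : ℝ} (hr : 0 ≤ r) {ε : ℝ} (hε : 0 < ε) :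
    ∃ C : ℝ, 0 ≤ C ∧ ∀ ξ, spreadKernel u T a b ξ ≤
      ENNReal.ofReal (ε * japanese ξ + C * maxwellian u ξ ^ r) := by
  have h0 := Real.rpow_pos_of_pos (amp_pos u) a
  have hm := momentConst_nonneg u b
  set D := 2 * amp u ^ a * momentConst u b with hD
  have hD0 : 0 ≤ D := by positivity
  have hat : 0 < a / tmp u := div_pos ha (tmp_pos u)
  have ht := tendsto_sphereDecay hat
  -- D + 1 and not D, since only D ≥ 0 is at hand.
  have hpos : 0 < ENNReal.ofReal (ε / (D + 1)) := by simp; positivity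
  obtain ⟨R, hR⟩ := Filter.eventually_atTop.1 (ht.eventually (gt_mem_nhds hpos))
  set R' := max R 0 with hR'
  set J0 := 1 + ‖u.v‖ + R' with hJ0
  have hJ0p : 0 < J0 := by positivity
  set m := amp u ^ r * Real.exp (-(r / tmp u * R' ^ 2)) with hmm
  have hm0 : 0 < m := mul_pos (Real.rpow_pos_of_pos (amp_pos u) r) (Real.exp_pos _)
  have harea := area_pos
  refine ⟨D * J0 * (2 * area) / m, by positivity, fun ξ => ?_⟩
  have hJξ := japanese_pos ξ
  have hMr := Real.rpow_pos_of_pos (maxwellian_pos u ξ) r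
  have e1 : 2 * japanese ξ * amp u ^ a * momentConst u b = D * japanese ξ := by rw [hD]; ring
  have key := spreadKernel_le hT u ha hb ξ
  rw [e1] at key
  by_cases hc : R ≤ ‖ξ - u.v‖
  · have h1 := (hR _ hc).le
    refine key.trans ?_
    refine (mul_le_mul_right h1 _).trans ?_
    rw [← ENNReal.ofReal_mul (by positivity)]
    refine ENNReal.ofReal_le_ofReal ?_
    have h2 : D * japanese ξ * (ε / (D + 1)) ≤ ε * japanese ξ := by
      have : D * japanese ξ * (ε / (D + 1)) = ε * japanese ξ * (D / (D + 1)) := by field_simp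
      rw [this]
      refine mul_le_of_le_one_right (by positivity) ?_
      rw [div_le_one (by positivity)]
      linarith
    have : 0 ≤ D * J0 * (2 * area) / m * maxwellian u ξ ^ r := by positivity
    linarith
  · have hc' : ‖ξ - u.v‖ ≤ R' := (le_of_not_ge hc).trans (le_max_left _ _)
    have h1 := sphereDecay_le hat ‖ξ - u.v‖
    refine key.trans ?_
    refine (mul_le_mul_right h1 _).trans ?_
    rw [← ofReal_area, show (2 : ENNReal) = ENNReal.ofReal 2 by simp,
      ← ENNReal.ofReal_mul (by norm_num), ← ENNReal.ofReal_mul (by positivity)]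
    refine ENNReal.ofReal_le_ofReal ?_
    have h2 : japanese ξ ≤ J0 := by
      have h6 := japanese_le ξ
      have h7 : ‖ξ‖ ≤ ‖ξ - u.v‖ + ‖u.v‖ := by
        have := norm_add_le (ξ - u.v) u.v
        simpa using this
      rw [hJ0]; linarith
    have h3 : m ≤ maxwellian u ξ ^ r := by
      rw [maxwellian_rpow, hmm]
      have := tmp_pos u
      have := Real.rpow_pos_of_pos (amp_pos u) r
      gcongr
    have h4 : D * japanese ξ * (2 * area) ≤ D * J0 * (2 * area) / m * maxwellian u ξ ^ r := by
      calc D * japanese ξ * (2 * area) ≤ D * J0 * (2 * area) := by gcongr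
        _ = D * J0 * (2 * area) / m * m := by field_simp
        _ ≤ _ := by gcongr
    have : 0 ≤ ε * japanese ξ := by positivity
    linarith

/-! ### Coercivity in ℍ^s up to a term in ℍ^{1/2} -/

theorem weight_zero (u : FluidState) (s : ℝ) (ξ : Vel) :
    weight u s 0 ξ = maxwellian u ξ ^ (-(2 * s)) := by
  simp [weight]

theorem weight_half (u : FluidState) (ξ : Vel) : weight u (1 / 2) 0 ξ = (maxwellian u ξ)⁻¹ := by
  rw [weight_zero]
  norm_num [Real.rpow_neg_one]

/-- With a, b, c, d the Maxwellians at x.1, x.2.1, (T x).1, (T x).2.1, conservation cd = ab gives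
a^{-s} d = c^{-s} d^{1-s} b^s. The cross term becomes (a^{-s}|f|)(c^{-s}|f(T)|) d^{1-s} b^s B, to
which the inequality of means applies. -/
theorem cross_term_pointwise (u : FluidState) (s : ℝ) {T : Encounter → Encounter}
    (hT : IsEncounterSymmetry u T) (f : Vel → ℝ) (x : Encounter) :
    weight u s 0 x.1 * |f x.1| * (|f (T x).1 * maxwellian u (T x).2.1| * kernelB x) ≤
      weight u s 0 x.1 * f x.1 ^ 2 *
        (maxwellian u (T x).2.1 ^ (1 - s) * maxwellian u x.2.1 ^ s * kernelB x) +
      weight u s 0 (T x).1 * f (T x).1 ^ 2 *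
        (maxwellian u x.2.1 ^ s * maxwellian u (T x).2.1 ^ (1 - s) * kernelB x) := by
  have ha := maxwellian_pos u x.1
  have hb := maxwellian_pos u x.2.1
  have hc := maxwellian_pos u (T x).1
  have hd := maxwellian_pos u (T x).2.1
  have hB := kernelB_nonneg x
  have hE := hT.energy x
  simp only [weight_zero]
  set a := maxwellian u x.1
  set b := maxwellian u x.2.1
  set c := maxwellian u (T x).1
  set d := maxwellian u (T x).2.1
  have e1 : a ^ (-(2 * s)) = a ^ (-s) * a ^ (-s) := by
    rw [← Real.rpow_add ha]; congr 1; ring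
  have e2 : c ^ (-(2 * s)) = c ^ (-s) * c ^ (-s) := by
    rw [← Real.rpow_add hc]; congr 1; ring
  have e3 : a ^ (-s) * d = c ^ (-s) * (d ^ (1 - s) * b ^ s) := by
    have h1 : c ^ s * d ^ s = a ^ s * b ^ s := by
      rw [← Real.mul_rpow hc.le hd.le, hE, Real.mul_rpow ha.le hb.le]
    have h2 : d ^ (1 - s) * d ^ s = d := by
      rw [← Real.rpow_add hd]; simp
    have h3 : a ^ (-s) * a ^ s = 1 := by rw [← Real.rpow_add ha]; simp
    have h4 : c ^ (-s) * c ^ s = 1 := by rw [← Real.rpow_add hc]; simp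
    calc a ^ (-s) * d = a ^ (-s) * (d ^ (1 - s) * d ^ s) * (c ^ (-s) * c ^ s) := by rw [h2, h4]; ring
      _ = a ^ (-s) * d ^ (1 - s) * c ^ (-s) * (c ^ s * d ^ s) := by ring
      _ = (a ^ (-s) * a ^ s) * (c ^ (-s) * (d ^ (1 - s) * b ^ s)) := by rw [h1]; ring
      _ = _ := by rw [h3, one_mul]
  set G := d ^ (1 - s) * b ^ s with hG
  have hG0 : 0 ≤ G := mul_nonneg (Real.rpow_nonneg hd.le _) (Real.rpow_nonneg hb.le _)
  rw [e1, e2, abs_mul, abs_of_pos hd, mul_comm (b ^ s), ← hG]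
  have e4 : a ^ (-s) * a ^ (-s) * |f x.1| * (|f (T x).1| * d * kernelB x) =
      (a ^ (-s) * |f x.1|) * (c ^ (-s) * |f (T x).1|) * (G * kernelB x) := by
    linear_combination (a ^ (-s) * |f x.1| * |f (T x).1| * kernelB x) * e3
  have e5 : a ^ (-s) * a ^ (-s) * f x.1 ^ 2 = (a ^ (-s) * |f x.1|) ^ 2 := by
    rw [mul_pow, sq_abs]; ring
  have e6 : c ^ (-s) * c ^ (-s) * f (T x).1 ^ 2 = (c ^ (-s) * |f (T x).1|) ^ 2 := by
    rw [mul_pow, sq_abs]; ring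
  rw [e4, e5, e6, ← add_mul]
  refine mul_le_mul_of_nonneg_right ?_ (mul_nonneg hG0 hB)
  nlinarith [sq_nonneg (a ^ (-s) * |f x.1| - c ^ (-s) * |f (T x).1|),
    sq_nonneg (a ^ (-s) * |f x.1|), sq_nonneg (c ^ (-s) * |f (T x).1|)]

theorem lintegral_spreadKernel (u : FluidState) (s : ℝ) {T : Encounter → Encounter}
    (hT : Measurable T) {f : Vel → ℝ} (hf : Measurable f) (a b : ℝ) :
    ∫⁻ x, ENNReal.ofReal (weight u s 0 x.1 * f x.1 ^ 2 *
        (maxwellian u (T x).2.1 ^ a * maxwellian u x.2.1 ^ b * kernelB x)) ∂encounterMeasure =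
      ∫⁻ ξ, ENNReal.ofReal (weight u s 0 ξ * f ξ ^ 2) * spreadKernel u T a b ξ := by
  have hM := measurable_maxwellian u
  have hw := measurable_weight u s 0
  have hB := continuous_kernelB.measurable
  have hm : Measurable fun x : Encounter => ENNReal.ofReal
    (maxwellian u (T x).2.1 ^ a * maxwellian u x.2.1 ^ b * kernelB x) := by fun_prop
  have e : ∀ x : Encounter, ENNReal.ofReal (weight u s 0 x.1 * f x.1 ^ 2 *
        (maxwellian u (T x).2.1 ^ a * maxwellian u x.2.1 ^ b * kernelB x)) =
      ENNReal.ofReal (weight u s 0 x.1 * f x.1 ^ 2) * ENNReal.ofReal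
        (maxwellian u (T x).2.1 ^ a * maxwellian u x.2.1 ^ b * kernelB x) := fun x =>
    ENNReal.ofReal_mul (mul_nonneg (weight_pos u s le_rfl _).le (sq_nonneg _))
  simp only [e]
  have hm2 : Measurable fun x : Encounter => ENNReal.ofReal (weight u s 0 x.1 * f x.1 ^ 2) *
      ENNReal.ofReal (maxwellian u (T x).2.1 ^ a * maxwellian u x.2.1 ^ b * kernelB x) :=
    Measurable.mul (by fun_prop) hm
  rw [encounterMeasure, lintegral_prod _ hm2.aemeasurable]
  refine lintegral_congr fun ξ => ?_
  have hm3 : Measurable fun p : Vel × Sph => ENNReal.ofReal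
    (maxwellian u (T (ξ, p)).2.1 ^ a * maxwellian u p.1 ^ b * kernelB (ξ, p)) :=
    hm.comp measurable_prodMk_left
  exact lintegral_const_mul (ENNReal.ofReal (weight u s 0 ξ * f ξ ^ 2)) hm3

/-- The second term of `cross_term_pointwise` is carried back by the involution T, which exchanges
the exponents s and 1 - s. -/
theorem cross_term_le (u : FluidState) (s : ℝ) {T : Encounter → Encounter}
    (hT : IsEncounterSymmetry u T) (hinv : ∀ x, T (T x) = x) {f : Vel → ℝ} (hf : Measurable f) :
    ∫⁻ x, ENNReal.ofReal (weight u s 0 x.1 * |f x.1| *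
        (|f (T x).1 * maxwellian u (T x).2.1| * kernelB x)) ∂encounterMeasure ≤
      ∫⁻ ξ, ENNReal.ofReal (weight u s 0 ξ * f ξ ^ 2) *
        (spreadKernel u T (1 - s) s ξ + spreadKernel u T s (1 - s) ξ) := by
  have hM := measurable_maxwellian u
  have hw := measurable_weight u s 0
  have hB := continuous_kernelB.measurable
  have hTm := hT.preserving.measurable
  set K : Encounter → ENNReal := fun y => ENNReal.ofReal (weight u s 0 y.1 * f y.1 ^ 2 *
    (maxwellian u (T y).2.1 ^ s * maxwellian u y.2.1 ^ (1 - s) * kernelB y)) with hK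
  have hKm : Measurable K := by simp only [hK]; fun_prop
  have hm1 : Measurable fun x : Encounter => ENNReal.ofReal (weight u s 0 x.1 * f x.1 ^ 2 *
        (maxwellian u (T x).2.1 ^ (1 - s) * maxwellian u x.2.1 ^ s * kernelB x)) := by fun_prop
  calc _ ≤ ∫⁻ x, (ENNReal.ofReal (weight u s 0 x.1 * f x.1 ^ 2 *
        (maxwellian u (T x).2.1 ^ (1 - s) * maxwellian u x.2.1 ^ s * kernelB x)) + K (T x))
          ∂encounterMeasure := by
        refine lintegral_mono fun x => ?_
        simp only [hK, hinv, hT.kernel]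
        have p1 := fun (y : Vel) (r : ℝ) => Real.rpow_nonneg (maxwellian_pos u y).le r
        have p2 := fun y => (weight_pos u s le_rfl y).le
        rw [← ENNReal.ofReal_add]
        · exact ENNReal.ofReal_le_ofReal (cross_term_pointwise u s hT f x)
        · exact mul_nonneg (mul_nonneg (p2 _) (sq_nonneg _))
            (mul_nonneg (mul_nonneg (p1 _ _) (p1 _ _)) (kernelB_nonneg x))
        · exact mul_nonneg (mul_nonneg (p2 _) (sq_nonneg _))
            (mul_nonneg (mul_nonneg (p1 _ _) (p1 _ _)) (kernelB_nonneg x))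
    _ = _ := by
        rw [lintegral_add_left hm1, hT.preserving.lintegral_comp hKm,
          lintegral_spreadKernel u s hTm hf, hK, lintegral_spreadKernel u s hTm hf]
        have hsk : ∀ a b, Measurable (spreadKernel u T a b) := fun a b => by
          have : Measurable fun x : Encounter => ENNReal.ofReal
            (maxwellian u (T x).2.1 ^ a * maxwellian u x.2.1 ^ b * kernelB x) := by fun_prop
          exact this.lintegral_prod_right'
        have h1 := hsk (1 - s) s
        rw [← lintegral_add_left (by fun_prop)]
        simp only [mul_add]

/-- The integrand contains ⟨ξ⟩M^{2-2s}, whose exponent is positive because s < 1. -/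
theorem nsq_maxwellian_ne_top (u : FluidState) {s lam : ℝ} (hs' : s < 1)
    (hl : 0 ≤ lam) : nsq u s lam 1 (maxwellian u) ≠ ⊤ := by
  have h1 := integrable_maxwellian_rpow_mul_japanese u (show 0 < 2 - 2 * s by linarith) 1
  have h2 := (integrable_maxwellian_rpow_mul_japanese u one_pos 1).const_mul lam
  have h3 := (h1.add h2).lintegral_lt_top
  refine ne_of_lt (lt_of_le_of_lt (le_of_eq ?_) h3)
  refine lintegral_congr fun ξ => ?_
  have hM := maxwellian_pos u ξ
  have hw := weight_pos u s hl ξ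
  have hJ := japanese_pos ξ
  rw [← ENNReal.ofReal_mul (by positivity)]
  congr 1
  simp only [weight, Pi.add_apply, zpow_one, pow_one, Real.rpow_one]
  have e : maxwellian u ξ ^ (2 - 2 * s) = maxwellian u ξ ^ (-(2 * s)) * maxwellian u ξ ^ 2 := by
    rw [← Real.rpow_natCast, ← Real.rpow_add hM]
    congr 1
    push_cast
    ring
  rw [e]
  field_simp

theorem nsq_mono (u : FluidState) {s lam s' lam' : ℝ} {k k' : ℤ} {C : ℝ} (hC : 0 ≤ C)
    (h : ∀ ξ, japanese ξ ^ k * weight u s lam ξ ≤ C * (japanese ξ ^ k' * weight u s' lam' ξ))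
    (f : Vel → ℝ) : nsq u s lam k f ≤ ENNReal.ofReal C * nsq u s' lam' k' f := by
  unfold nsq
  rw [← lintegral_const_mul' _ _ ENNReal.ofReal_ne_top]
  refine lintegral_mono fun ξ => ?_
  rw [← mul_assoc, ← ENNReal.ofReal_mul hC]
  exact mul_le_mul_left (ENNReal.ofReal_le_ofReal (h ξ)) _

theorem nsq_half_le (u : FluidState) {s lam : ℝ} (hs : 1 / 2 ≤ s) (hl : 0 ≤ lam) {k : ℤ}
    (f : Vel → ℝ) :
    nsq u (1 / 2) 0 k f ≤ ENNReal.ofReal (amp u ^ (2 * s - 1)) * nsq u s lam k f := by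
  have hq := Real.rpow_pos_of_pos (amp_pos u) (2 * s - 1)
  refine nsq_mono u hq.le (fun ξ => ?_) f
  have hJ := zpow_pos (japanese_pos ξ) k
  have hM := maxwellian_pos u ξ
  rw [weight_half, weight]
  have h := inv_maxwellian_le u hs ξ
  have h2 : (maxwellian u ξ)⁻¹ ≤ amp u ^ (2 * s - 1) *
      (maxwellian u ξ ^ (-(2 * s)) + lam * (maxwellian u ξ)⁻¹) := by
    have : 0 ≤ amp u ^ (2 * s - 1) * (lam * (maxwellian u ξ)⁻¹) := by positivity
    linarith
  calc japanese ξ ^ k * (maxwellian u ξ)⁻¹ ≤ japanese ξ ^ k * (amp u ^ (2 * s - 1) *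
      (maxwellian u ξ ^ (-(2 * s)) + lam * (maxwellian u ξ)⁻¹)) := by gcongr
    _ = _ := by ring

theorem nsq_zero_le_one (u : FluidState) (s : ℝ) {lam : ℝ} (hl : 0 ≤ lam) (f : Vel → ℝ) :
    nsq u s lam 0 f ≤ nsq u s lam 1 f := by
  have := nsq_mono u (s := s) (lam := lam) (s' := s) (lam' := lam) (k := 0) (k' := 1) zero_le_one
    (fun ξ => ?_) f
  · simpa using this
  · have hw := weight_pos u s hl ξ
    have hJ := one_le_japanese ξ
    rw [zpow_zero, zpow_one, one_mul, one_mul]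
    nlinarith

/-- All four terms take the shape f((T x).1) a((T x).2.1) with T one of the encounter symmetries. T
= id gives the collision frequency, the other three are cross terms. -/
theorem pairing_linCollision (u : FluidState) {s lam : ℝ} (hs : 1 / 2 ≤ s) (hl : 0 ≤ lam)
    {a f : Vel → ℝ} (ha : Measurable a) (hf : Measurable f)
    (hna : nsq u s lam 1 a ≠ ⊤) (hnf : nsq u s lam 1 f ≠ ⊤) :
    pairing u s lam (linCollision a f) f =
      (∫ x, weight u s lam x.1 * f x.1 *
        (f ((swapMap ∘ colMap) x).1 * a ((swapMap ∘ colMap) x).2.1 * kernelB x) ∂encounterMeasure) -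
      (∫ x, weight u s lam x.1 * f x.1 * (f (swapMap x).1 * a (swapMap x).2.1 * kernelB x)
        ∂encounterMeasure) +
      (∫ x, weight u s lam x.1 * f x.1 * (f (colMap x).1 * a (colMap x).2.1 * kernelB x)
        ∂encounterMeasure) -
      ∫ x, weight u s lam x.1 * f x.1 * (f (id x).1 * a (id x).2.1 * kernelB x)
        ∂encounterMeasure := by
  have hcol := isEncounterSymmetry_colMap u
  have hswap := isEncounterSymmetry_swapMap u
  obtain ⟨i1, e1⟩ := pairing_collision u hs hl ha hf hf hna hnf hnf
  obtain ⟨i2, e2⟩ := pairing_collision u hs hl hf ha hf hnf hna hnf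
  have j1 := trilinear_integrable u hs hl (hswap.comp hcol) hf ha hf hnf hna hnf
  have j2 := trilinear_integrable u hs hl hswap hf ha hf hnf hna hnf
  have j3 := trilinear_integrable u hs hl hcol hf ha hf hnf hna hnf
  have j4 := trilinear_integrable u hs hl (isEncounterSymmetry_id u) hf ha hf hnf hna hnf
  have e0 : pairing u s lam (linCollision a f) f =
      pairing u s lam (collision a f) f + pairing u s lam (collision f a) f := by
    unfold pairing
    rw [← integral_add i1 i2]
    refine integral_congr_ae (Filter.Eventually.of_forall fun ξ => ?_)
    simp only [linCollision]
    ring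
  rw [e0, e1, e2, ← integral_sub j1 j2, add_sub_assoc, ← integral_sub j3 j4]
  congr 1
  · refine integral_congr_ae (Filter.Eventually.of_forall fun x => ?_)
    simp only [Function.comp, swapMap]
    ring
  · refine integral_congr_ae (Filter.Eventually.of_forall fun x => ?_)
    simp only [id]
    ring

theorem abs_integral_cross_le (u : FluidState) {s : ℝ} {T : Encounter → Encounter}
    {a f : Vel → ℝ} {C : ENNReal} (hC : C ≠ ⊤)
    (h : ∫⁻ x, ENNReal.ofReal (weight u s 0 x.1 * |f x.1| * (|f (T x).1 * a (T x).2.1| * kernelB x))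
      ∂encounterMeasure ≤ C) :
    |∫ x, weight u s 0 x.1 * f x.1 * (f (T x).1 * a (T x).2.1 * kernelB x) ∂encounterMeasure| ≤
      C.toReal := by
  rw [← Real.norm_eq_abs, ← ENNReal.ofReal_le_iff_le_toReal hC, ofReal_norm]
  refine (enorm_integral_le_lintegral_enorm _).trans (le_trans (le_of_eq ?_) h)
  refine lintegral_congr fun x => ?_
  rw [Real.enorm_eq_ofReal_abs]
  congr 1
  rw [abs_mul, abs_mul, abs_mul _ (kernelB x), abs_of_pos (weight_pos u s le_rfl _),
    abs_of_nonneg (kernelB_nonneg x)]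

theorem exists_cross_term_le (u : FluidState) {s : ℝ} (hs : 1 / 2 ≤ s) (hs' : s < 1) {ε : ℝ}
    (hε0 : 0 < ε) {T : Encounter → Encounter} (hT : IsEncounterSymmetry u T)
    (hinv : ∀ x, T (T x) = x) (hsp : IsSpreading T) :
    ∃ C : ℝ, 0 ≤ C ∧ ∀ f : Vel → ℝ, Measurable f →
      ∫⁻ x, ENNReal.ofReal (weight u s 0 x.1 * |f x.1| *
        (|f (T x).1 * maxwellian u (T x).2.1| * kernelB x)) ∂encounterMeasure ≤
      ENNReal.ofReal (2 * ε) * nsq u s 0 1 f + ENNReal.ofReal C * nsq u (1 / 2) 0 0 f := by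
  have hr : 0 ≤ 2 * s - 1 := by linarith
  have hs0 : 0 < s := by linarith
  have hs1 : 0 < 1 - s := by linarith
  -- The exponent 2s - 1 in the remainder turns the weight M^{-2s} into M^{-1}, so the remainder is
  -- measured in ℍ^{1/2}.
  obtain ⟨C₁, hC₁, h₁⟩ := exists_spreadKernel_le hsp u hs1 hs0 hr hε0
  obtain ⟨C₂, hC₂, h₂⟩ := exists_spreadKernel_le hsp u hs0 hs1 hr hε0
  refine ⟨C₁ + C₂, by positivity, fun f hf => (cross_term_le u s hT hinv hf).trans ?_⟩
  have hd1 := measurable_density u s 0 1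
  have hd2 := measurable_density u (1 / 2) 0 0
  unfold nsq
  rw [← lintegral_const_mul _ (by fun_prop), ← lintegral_const_mul _ (by fun_prop),
    ← lintegral_add_left (by fun_prop)]
  refine lintegral_mono fun ξ => ?_
  have hw := weight_pos u s le_rfl ξ
  have hJ := japanese_pos ξ
  have hMp := maxwellian_pos u ξ
  have hMr := Real.rpow_pos_of_pos hMp (2 * s - 1)
  have hw2 := weight_pos u (1 / 2) le_rfl ξ
  refine (mul_le_mul_right (add_le_add (h₁ ξ) (h₂ ξ)) _).trans (le_of_eq ?_)
  rw [← ENNReal.ofReal_add (by positivity) (by positivity), ← ENNReal.ofReal_mul (by positivity),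
    ← ENNReal.ofReal_mul (by positivity), ← ENNReal.ofReal_mul (by positivity),
    ← ENNReal.ofReal_mul (by positivity), ← ENNReal.ofReal_mul (by positivity),
    ← ENNReal.ofReal_add (by positivity) (by positivity)]
  congr 1
  have e : weight u s 0 ξ * maxwellian u ξ ^ (2 * s - 1) = weight u (1 / 2) 0 ξ := by
    rw [weight_zero, weight_half, ← Real.rpow_add hMp, ← Real.rpow_neg_one]
    congr 1; ring
  rw [← e, zpow_one, zpow_zero]
  ring

theorem frequency_term_ge (u : FluidState) {s : ℝ} (hs : 1 / 2 ≤ s) (hs' : s < 1) {ν₀ : ℝ}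
    (hν : 0 < ν₀) (hfreq : ∀ ξ : Vel, ENNReal.ofReal (ν₀ * japanese ξ) ≤
      ∫⁻ p, ENNReal.ofReal (maxwellian u p.1 * kernelB (ξ, p)) ∂collisionMeasure)
    {f : Vel → ℝ} (hf : Measurable f) (hnf : nsq u s 0 1 f ≠ ⊤) :
    ν₀ * (nsq u s 0 1 f).toReal ≤
      ∫ x, weight u s 0 x.1 * f x.1 * (f (id x).1 * maxwellian u (id x).2.1 * kernelB x)
        ∂encounterMeasure := by
  have hM := measurable_maxwellian u
  have hnM := nsq_maxwellian_ne_top u hs' (le_refl (0 : ℝ))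
  have j4 := trilinear_integrable u hs le_rfl (isEncounterSymmetry_id u) hf hM hf hnf hnM hnf
  have hpos : ∀ x : Encounter, 0 ≤ weight u s 0 x.1 * f x.1 *
      (f (id x).1 * maxwellian u (id x).2.1 * kernelB x) := by
    intro x
    have h1 := weight_pos u s le_rfl x.1
    have h2 := maxwellian_pos u x.2.1
    have h3 := kernelB_nonneg x
    have : weight u s 0 x.1 * f x.1 * (f (id x).1 * maxwellian u (id x).2.1 * kernelB x) =
      weight u s 0 x.1 * f x.1 ^ 2 * (maxwellian u x.2.1 * kernelB x) := by
      simp only [id]; ring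
    rw [this]
    positivity
  have hge : ENNReal.ofReal ν₀ * nsq u s 0 1 f ≤ ∫⁻ x, ENNReal.ofReal (weight u s 0 x.1 * f x.1 *
      (f (id x).1 * maxwellian u (id x).2.1 * kernelB x)) ∂encounterMeasure := by
    have e := lintegral_spreadKernel u s measurable_id hf 0 1
    simp only [Real.rpow_zero, Real.rpow_one, one_mul] at e
    have e2 : ∀ x : Encounter, weight u s 0 x.1 * f x.1 *
      (f (id x).1 * maxwellian u (id x).2.1 * kernelB x) =
      weight u s 0 x.1 * f x.1 ^ 2 * (maxwellian u x.2.1 * kernelB x) := fun x => by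
      simp only [id]; ring
    simp only [e2]
    rw [e]
    unfold nsq
    rw [← lintegral_const_mul' _ _ ENNReal.ofReal_ne_top]
    refine lintegral_mono fun ξ => ?_
    have hw := weight_pos u s le_rfl ξ
    have hJ := japanese_pos ξ
    have h4 : ENNReal.ofReal (ν₀ * japanese ξ) ≤ spreadKernel u id 0 1 ξ := by
      refine (hfreq ξ).trans (le_of_eq ?_)
      simp only [spreadKernel, Real.rpow_zero, Real.rpow_one, one_mul]
    refine le_trans (le_of_eq ?_) (mul_le_mul_right h4 _)
    rw [← ENNReal.ofReal_mul (by positivity), ← ENNReal.ofReal_mul (by positivity),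
      ← ENNReal.ofReal_mul (by positivity)]
    congr 1
    rw [zpow_one]
    ring
  rw [← ofReal_integral_eq_lintegral_ofReal j4 (Filter.Eventually.of_forall hpos)] at hge
  have := ENNReal.toReal_mono ENNReal.ofReal_ne_top hge
  rwa [ENNReal.toReal_mul, ENNReal.toReal_ofReal hν.le,
    ENNReal.toReal_ofReal (integral_nonneg hpos)] at this

/-- Coercivity in `ℍ^s` up to a term that is controlled in `ℍ^{1/2}`. -/
theorem exists_coercive (u : FluidState) {s : ℝ} (hs : 1 / 2 ≤ s) (hs' : s < 1) :
    ∃ c C : ℝ, 0 < c ∧ 0 ≤ C ∧ ∀ f : Vel → ℝ, Measurable f → nsq u s 0 1 f ≠ ⊤ →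
      c * (nsq u s 0 1 f).toReal - C * (nsq u (1 / 2) 0 0 f).toReal ≤
        -pairing u s 0 (linCollision (maxwellian u) f) f := by
  obtain ⟨ν₀, hν, hfreq⟩ := exists_frequency_ge u
  have hcol := isEncounterSymmetry_colMap u
  have hswap := isEncounterSymmetry_swapMap u
  have hM := measurable_maxwellian u
  -- Three cross terms at 2ε each use up ν₀/2 and leave ν₀/2.
  have hε0 : 0 < ν₀ / 12 := by positivity
  have hinv : ∀ x, (swapMap ∘ colMap) ((swapMap ∘ colMap) x) = x := fun x => by
    simp only [Function.comp]
    rw [colMap_swapMap, colMap_colMap, swapMap_swapMap]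
  obtain ⟨C₁, hC₁, h₁⟩ := exists_cross_term_le u hs hs' hε0 (hswap.comp hcol) hinv
    isSpreading_swapMap_colMap
  obtain ⟨C₂, hC₂, h₂⟩ := exists_cross_term_le u hs hs' hε0 hcol colMap_colMap isSpreading_colMap
  obtain ⟨C₃, hC₃, h₃⟩ := exists_cross_term_le u hs hs' hε0 hswap swapMap_swapMap
    isSpreading_swapMap
  refine ⟨ν₀ / 2, C₁ + C₂ + C₃, by positivity, by positivity, fun f hf hnf => ?_⟩
  have hn0 : nsq u (1 / 2) 0 0 f ≠ ⊤ := by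
    refine ne_top_of_le_ne_top ?_ ((nsq_zero_le_one u (1 / 2) le_rfl f).trans
      (nsq_half_le u hs le_rfl f))
    finiteness
  have hnM := nsq_maxwellian_ne_top u hs' (le_refl (0 : ℝ))
  have tor : ∀ C : ℝ, 0 ≤ C → (ENNReal.ofReal (2 * (ν₀ / 12)) * nsq u s 0 1 f +
      ENNReal.ofReal C * nsq u (1 / 2) 0 0 f).toReal =
      2 * (ν₀ / 12) * (nsq u s 0 1 f).toReal + C * (nsq u (1 / 2) 0 0 f).toReal := by
    intro C hC
    rw [ENNReal.toReal_add (by finiteness) (by finiteness), ENNReal.toReal_mul, ENNReal.toReal_mul,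
      ENNReal.toReal_ofReal (by positivity), ENNReal.toReal_ofReal hC]
  have hfin : ∀ C : ℝ, ENNReal.ofReal (2 * (ν₀ / 12)) * nsq u s 0 1 f +
      ENNReal.ofReal C * nsq u (1 / 2) 0 0 f ≠ ⊤ := fun C => by finiteness
  have b₁ := (abs_le.1 (abs_integral_cross_le u (hfin C₁) (h₁ f hf))).2
  have b₂ := (abs_le.1 (abs_integral_cross_le u (hfin C₂) (h₂ f hf))).2
  have b₃ := (abs_le.1 (abs_integral_cross_le u (hfin C₃) (h₃ f hf))).1
  have b₄ := frequency_term_ge u hs hs' hν hfreq hf hnf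
  rw [tor _ hC₁] at b₁
  rw [tor _ hC₂] at b₂
  rw [tor _ hC₃] at b₃
  rw [pairing_linCollision u hs le_rfl hM hf hnM hnf]
  linarith

/-! ### Probability laws of velocities and encounters -/

/-- The total mass of the Maxwellian. -/
def mass (u : FluidState) : ℝ := ∫ ξ, maxwellian u ξ

theorem integrable_maxwellian (u : FluidState) : Integrable (maxwellian u) := by
  have := integrable_maxwellian_rpow_mul_japanese u one_pos 0
  simpa using this

theorem mass_pos (u : FluidState) : 0 < mass u :=
  integral_pos_of_integrable_nonneg_nonzero (x := 0) (continuous_maxwellian u)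
    (integrable_maxwellian u) (fun ξ => (maxwellian_pos u ξ).le) (ne_of_gt (maxwellian_pos u 0))

/-- The density of the normalized Maxwellian. -/
def gaussDensity (u : FluidState) (ξ : Vel) : ENNReal := ENNReal.ofReal (maxwellian u ξ / mass u)

theorem measurable_gaussDensity (u : FluidState) : Measurable (gaussDensity u) :=
  ((measurable_maxwellian u).div_const _).ennreal_ofReal

/-- The normalized Maxwellian as a probability measure. -/
def gauss (u : FluidState) : Measure Vel := volume.withDensity (gaussDensity u)

/-- The normalized surface measure. -/
def unifSph : Measure Sph := surface.withDensity fun _ => (surface Set.univ)⁻¹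

theorem surface_univ_ne_zero : surface Set.univ ≠ 0 := by
  rw [Ne, Measure.measure_univ_eq_zero]
  exact Measure.toSphere_ne_zero _

instance : IsProbabilityMeasure unifSph := ⟨by
  rw [unifSph, withDensity_const, Measure.smul_apply, smul_eq_mul]
  exact ENNReal.inv_mul_cancel surface_univ_ne_zero (measure_ne_top _ _)⟩

instance (u : FluidState) : IsProbabilityMeasure (gauss u) := ⟨by
  rw [gauss, withDensity_apply _ MeasurableSet.univ, Measure.restrict_univ]
  unfold gaussDensity
  rw [← ofReal_integral_eq_lintegral_ofReal ((integrable_maxwellian u).div_const _)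
    (Filter.Eventually.of_forall fun ξ => div_nonneg (maxwellian_pos u ξ).le (mass_pos u).le),
    integral_div, ← mass, div_self (mass_pos u).ne', ENNReal.ofReal_one]⟩

/-- The law of `(ξ_*, Ω)`. -/
def partnerLaw (u : FluidState) : Measure (Vel × Sph) := (gauss u).prod unifSph

instance (u : FluidState) : IsProbabilityMeasure (partnerLaw u) := by
  unfold partnerLaw
  infer_instance

/-- The law of `(ξ, ξ_*, Ω)`. -/
def encounterLaw (u : FluidState) : Measure Encounter := (gauss u).prod (partnerLaw u)

/-- The density of `encounterLaw`. -/
def encounterDensity (u : FluidState) (x : Encounter) : ENNReal :=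
  gaussDensity u x.1 * (gaussDensity u x.2.1 * (surface Set.univ)⁻¹)

theorem measurable_encounterDensity (u : FluidState) : Measurable (encounterDensity u) := by
  have := measurable_gaussDensity u
  unfold encounterDensity
  fun_prop

theorem encounterLaw_eq (u : FluidState) :
    encounterLaw u = encounterMeasure.withDensity (encounterDensity u) := by
  have := measurable_gaussDensity u
  have : SFinite ((volume : Measure Vel).prod surface) :=
    inferInstanceAs (SFinite collisionMeasure)
  rw [encounterLaw, partnerLaw, gauss, unifSph, prod_withDensity (by fun_prop) (by fun_prop),
    prod_withDensity (by fun_prop) (by fun_prop)]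
  rfl

theorem encounterDensity_swapMap (u : FluidState) (x : Encounter) :
    encounterDensity u (swapMap x) = encounterDensity u x := by
  simp only [encounterDensity, swapMap]
  ring

theorem gaussDensity_mul (u : FluidState) (ξ η : Vel) :
    gaussDensity u ξ * gaussDensity u η =
      ENNReal.ofReal (maxwellian u ξ * maxwellian u η / mass u ^ 2) := by
  have := maxwellian_pos u ξ
  have := maxwellian_pos u η
  have := mass_pos u
  rw [gaussDensity, gaussDensity, ← ENNReal.ofReal_mul (by positivity)]
  congr 1
  field_simp

theorem encounterDensity_eq (u : FluidState) (x : Encounter) :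
    encounterDensity u x = ENNReal.ofReal (maxwellian u x.1 * maxwellian u x.2.1 / mass u ^ 2) *
      (surface Set.univ)⁻¹ := by
  rw [encounterDensity, ← mul_assoc, gaussDensity_mul]

theorem encounterDensity_colMap (u : FluidState) (x : Encounter) :
    encounterDensity u (colMap x) = encounterDensity u x := by
  rw [encounterDensity_eq, encounterDensity_eq, maxwellian_colMap]

theorem _root_.MeasureTheory.MeasurePreserving.withDensity_of_invariant {α : Type*}
    [MeasurableSpace α] {μ : Measure α} {T : α → α} (hT : MeasurePreserving T μ μ)
    {D : α → ENNReal} (hD : Measurable D) (h : ∀ x, D (T x) = D x) :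
    MeasurePreserving T (μ.withDensity D) (μ.withDensity D) := by
  refine ⟨hT.measurable, Measure.ext fun s hs => ?_⟩
  rw [Measure.map_apply hT.measurable hs, withDensity_apply _ (hT.measurable hs),
    withDensity_apply _ hs, ← hT.setLIntegral_comp_preimage hs hD]
  simp only [h]

theorem swapMap_law (u : FluidState) :
    MeasurePreserving swapMap (encounterLaw u) (encounterLaw u) := by
  rw [encounterLaw_eq]
  exact measurePreserving_swapMap.withDensity_of_invariant (measurable_encounterDensity u)
    (encounterDensity_swapMap u)

theorem colMap_law (u : FluidState) :
    MeasurePreserving colMap (encounterLaw u) (encounterLaw u) := by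
  rw [encounterLaw_eq]
  exact measurePreserving_colMap.withDensity_of_invariant (measurable_encounterDensity u)
    (encounterDensity_colMap u)

theorem fst_law (u : FluidState) :
    MeasurePreserving (fun x : Encounter => x.1) (encounterLaw u) (gauss u) :=
  measurePreserving_fst

theorem fst_comp_law (u : FluidState) {T : Encounter → Encounter}
    (hT : MeasurePreserving T (encounterLaw u) (encounterLaw u)) :
    MeasurePreserving (fun x : Encounter => (T x).1) (encounterLaw u) (gauss u) :=
  (fst_law u).comp hT

theorem gaussDensity_ne_zero (u : FluidState) (ξ : Vel) : gaussDensity u ξ ≠ 0 := by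
  have := maxwellian_pos u ξ
  have := mass_pos u
  simp only [gaussDensity, ne_eq, ENNReal.ofReal_eq_zero, not_le]
  positivity

theorem volume_absolutelyContinuous_gauss (u : FluidState) :
    (volume : Measure Vel) ≪ gauss u :=
  withDensity_absolutelyContinuous' (measurable_gaussDensity u).aemeasurable
    (Filter.Eventually.of_forall (gaussDensity_ne_zero u))

theorem encounterMeasure_absolutelyContinuous (u : FluidState) :
    encounterMeasure ≪ encounterLaw u := by
  rw [encounterLaw_eq]
  refine withDensity_absolutelyContinuous' (measurable_encounterDensity u).aemeasurable
    (Filter.Eventually.of_forall fun x => ?_)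
  refine mul_ne_zero (gaussDensity_ne_zero u _) (mul_ne_zero (gaussDensity_ne_zero u _) ?_)
  exact ENNReal.inv_ne_zero.2 (measure_ne_top _ _)

instance : Measure.IsOpenPosMeasure encounterMeasure := by
  have : Measure.IsOpenPosMeasure collisionMeasure :=
    inferInstanceAs (Measure.IsOpenPosMeasure ((volume : Measure Vel).prod surface))
  unfold encounterMeasure
  infer_instance

instance (u : FluidState) : Measure.IsOpenPosMeasure (encounterLaw u) :=
  (encounterMeasure_absolutelyContinuous u).isOpenPosMeasure

instance (u : FluidState) : Measure.IsOpenPosMeasure (gauss u) :=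
  (volume_absolutelyContinuous_gauss u).isOpenPosMeasure

/-! ### The collision defect as an operator on L²(M) -/

/-- Velocity functions that are square integrable for the Maxwellian. -/
abbrev GaussL2 (u : FluidState) : Type := Lp ℝ 2 (gauss u)

/-- `φ ↦ φ(T(x).1)` as an isometry. -/
def pull (u : FluidState) {T : Encounter → Encounter}
    (hT : MeasurePreserving T (encounterLaw u) (encounterLaw u)) :
    GaussL2 u →L[ℝ] Lp ℝ 2 (encounterLaw u) :=
  (Lp.compMeasurePreservingₗᵢ ℝ _ (fst_comp_law u hT)).toContinuousLinearMap

theorem coeFn_pull (u : FluidState) {T : Encounter → Encounter}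
    (hT : MeasurePreserving T (encounterLaw u) (encounterLaw u)) (φ : GaussL2 u) :
    pull u hT φ =ᵐ[encounterLaw u] fun x => φ (T x).1 :=
  Lp.coeFn_compMeasurePreserving φ (fst_comp_law u hT)

/-- `φ' + φ'_* - φ - φ_*` for a function `φ` of velocity. -/
def defect (φ : Vel → ℝ) (x : Encounter) : ℝ :=
  φ (colMap x).1 + φ (colMap x).2.1 - φ x.1 - φ x.2.1

theorem defect_swapMap (φ : Vel → ℝ) (x : Encounter) : defect φ (swapMap x) = defect φ x := by
  simp only [defect, colMap_swapMap]
  simp only [swapMap]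
  ring

theorem defect_colMap (φ : Vel → ℝ) (x : Encounter) : defect φ (colMap x) = -defect φ x := by
  simp only [defect, colMap_colMap]
  ring

/-- The collision defect as a bounded operator. -/
def defectOp (u : FluidState) : GaussL2 u →L[ℝ] Lp ℝ 2 (encounterLaw u) :=
  pull u (colMap_law u) + pull u ((swapMap_law u).comp (colMap_law u)) -
    pull u (MeasurePreserving.id _) - pull u (swapMap_law u)

theorem coeFn_defectOp (u : FluidState) (φ : GaussL2 u) :
    defectOp u φ =ᵐ[encounterLaw u] defect φ := by
  have h1 := coeFn_pull u (colMap_law u) φ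
  have h2 := coeFn_pull u ((swapMap_law u).comp (colMap_law u)) φ
  have h3 := coeFn_pull u (MeasurePreserving.id _) φ
  have h4 := coeFn_pull u (swapMap_law u) φ
  simp only [defectOp, sub_apply, add_apply]
  filter_upwards [Lp.coeFn_sub (pull u (colMap_law u) φ + pull u ((swapMap_law u).comp (colMap_law u)) φ -
    pull u (MeasurePreserving.id _) φ) (pull u (swapMap_law u) φ),
    Lp.coeFn_sub (pull u (colMap_law u) φ + pull u ((swapMap_law u).comp (colMap_law u)) φ)
    (pull u (MeasurePreserving.id _) φ),
    Lp.coeFn_add (pull u (colMap_law u) φ) (pull u ((swapMap_law u).comp (colMap_law u)) φ),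
    h1, h2, h3, h4] with x e1 e2 e3 e4 e5 e6 e7
  rw [e1, Pi.sub_apply, e2, Pi.sub_apply, e3, Pi.add_apply, e4, e5, e6, e7]
  rfl

/-- The positive operator `D†D` of the collision defect `D`. -/
def defectSq (u : FluidState) : GaussL2 u →L[ℝ] GaussL2 u :=
  ContinuousLinearMap.adjoint (defectOp u) ∘L defectOp u

theorem inner_defectSq (u : FluidState) (φ ψ : GaussL2 u) :
    inner ℝ (defectSq u φ) ψ = inner ℝ (defectOp u φ) (defectOp u ψ) := by
  rw [defectSq, ContinuousLinearMap.comp_apply, ContinuousLinearMap.adjoint_inner_left]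

theorem defectSq_isSymmetric (u : FluidState) :
    (defectSq u : GaussL2 u →ₗ[ℝ] GaussL2 u).IsSymmetric := by
  intro φ ψ
  change inner ℝ (defectSq u φ) ψ = inner ℝ φ (defectSq u ψ)
  rw [inner_defectSq, real_inner_comm, ← inner_defectSq, real_inner_comm]

theorem inner_eq_integral {α : Type*} [MeasurableSpace α] {μ : Measure α} (f g : Lp ℝ 2 μ) :
    inner ℝ f g = ∫ x, f x * g x ∂μ := by
  rw [L2.inner_def]
  refine integral_congr_ae (Filter.Eventually.of_forall fun x => ?_)
  simp [mul_comm]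

/-- The defect of φ is invariant under `swapMap` and odd under `colMap`, and the law is invariant
under both, so the four terms in the defect of ψ contribute equally. -/
theorem inner_defectSq_eq (u : FluidState) (φ ψ : GaussL2 u) :
    inner ℝ (defectSq u φ) ψ = -4 * ∫ x, defect φ x * ψ x.1 ∂encounterLaw u := by
  have hD : MemLp (defect φ) 2 (encounterLaw u) :=
    (memLp_congr_ae (coeFn_defectOp u φ)).1 (Lp.memLp _)
  have hψ : ∀ {T : Encounter → Encounter}, MeasurePreserving T (encounterLaw u) (encounterLaw u) →
      Integrable (fun x => defect φ x * ψ (T x).1) (encounterLaw u) := by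
    intro T hT
    have : MemLp (fun x => ψ (T x).1) 2 (encounterLaw u) :=
      (Lp.memLp ψ).comp_measurePreserving (fst_comp_law u hT)
    exact hD.integrable_mul this
  have hcomp : ∀ {T : Encounter → Encounter}, MeasurePreserving T (encounterLaw u) (encounterLaw u) →
      ∫ x, defect φ (T x) * ψ (T x).1 ∂encounterLaw u = ∫ x, defect φ x * ψ x.1 ∂encounterLaw u := by
    intro T hT
    have h := integral_map (μ := encounterLaw u) hT.measurable.aemeasurable
      (f := fun x => defect φ x * ψ x.1)
      (by rw [hT.map_eq]; exact (hψ (MeasurePreserving.id _)).aestronglyMeasurable)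
    rw [hT.map_eq] at h
    exact h.symm
  have i1 := hψ (colMap_law u)
  have i2 := hψ ((swapMap_law u).comp (colMap_law u))
  have i3 := hψ (MeasurePreserving.id _)
  have i4 := hψ (swapMap_law u)
  have c1 := hcomp (colMap_law u)
  have c2 := hcomp ((swapMap_law u).comp (colMap_law u))
  have c4 := hcomp (swapMap_law u)
  simp only [Function.comp, defect_swapMap, defect_colMap, neg_mul, integral_neg] at c1 c2 c4
  rw [inner_defectSq, inner_eq_integral]
  have e : ∫ x, defectOp u φ x * defectOp u ψ x ∂encounterLaw u =
      ∫ x, ((fun x => defect φ x * ψ (colMap x).1) +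
        (fun x => defect φ x * ψ ((swapMap ∘ colMap) x).1) -
        (fun x => defect φ x * ψ (id x).1) - fun x => defect φ x * ψ (swapMap x).1) x
        ∂encounterLaw u := by
    refine integral_congr_ae ?_
    filter_upwards [coeFn_defectOp u φ, coeFn_defectOp u ψ] with x h1 h2
    rw [h1, h2, defect.eq_1 ψ]
    simp only [Pi.add_apply, Pi.sub_apply, Function.comp, swapMap, id]
    ring
  rw [e, integral_sub' ((i1.add i2).sub i3) i4, integral_sub' (i1.add i2) i3, integral_add' i1 i2]
  simp only [Function.comp, id]
  linarith

/-! ### Polynomials on velocity space -/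

/-- Linear functionals, as functions on velocity space. -/
def linFun : Vel →ₗ[ℝ] (Vel → ℝ) where
  toFun b ξ := inner ℝ b ξ
  map_add' b c := by ext ξ; simp [inner_add_left]
  map_smul' r b := by ext ξ; simp [inner_smul_left]

/-- The space of linear functions. -/
def homLin : Submodule ℝ (Vel → ℝ) := LinearMap.range linFun

/-- The space of affine functions. -/
def affLin : Submodule ℝ (Vel → ℝ) := 1 ⊔ homLin

/-- The space of polynomial functions of degree at most `n`. -/
def polys (n : ℕ) : Submodule ℝ (Vel → ℝ) := affLin ^ n

theorem inner_mem_homLin (b : Vel) : (fun ξ : Vel => inner ℝ b ξ) ∈ homLin := ⟨b, rfl⟩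

theorem const_mem_one (c : ℝ) : (fun _ : Vel => c) ∈ (1 : Submodule ℝ (Vel → ℝ)) :=
  Submodule.mem_one.2 ⟨c, rfl⟩

theorem one_le_affLin : (1 : Submodule ℝ (Vel → ℝ)) ≤ affLin := le_sup_left

theorem homLin_le_affLin : homLin ≤ affLin := le_sup_right

theorem mem_affLin {p : Vel → ℝ} :
    p ∈ affLin ↔ ∃ (c : ℝ) (b : Vel), p = fun ξ => c + inner ℝ b ξ := by
  constructor
  · intro h
    obtain ⟨y, hy, z, ⟨b, hb⟩, rfl⟩ := Submodule.mem_sup.1 h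
    obtain ⟨c, rfl⟩ := Submodule.mem_one.1 hy
    exact ⟨c, b, by rw [← hb]; rfl⟩
  · rintro ⟨c, b, rfl⟩
    exact Submodule.mem_sup.2 ⟨_, const_mem_one c, _, inner_mem_homLin b, rfl⟩

theorem polys_mono {m n : ℕ} (h : m ≤ n) : polys m ≤ polys n := pow_le_pow_right' one_le_affLin h

instance finiteDimensional_polys (n : ℕ) : FiniteDimensional ℝ (polys n) := by
  have h1 : (1 : Submodule ℝ (Vel → ℝ)).FG := by
    rw [Submodule.one_eq_span]
    exact Submodule.fg_span (Set.finite_singleton _)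
  have h2 : homLin.FG := Module.Finite.iff_fg.1 (inferInstanceAs (Module.Finite ℝ (LinearMap.range linFun)))
  exact Module.Finite.iff_fg.2 ((h1.sup h2).pow n)

/-- Splits off a homogeneous leading part, from which the eigenvalues of `avgOp` are read. -/
theorem polys_succ (n : ℕ) : polys (n + 1) = homLin ^ (n + 1) ⊔ polys n := by
  induction n with
  | zero => simp [polys, affLin, sup_comm]
  | succ n ih =>
    refine le_antisymm ?_ (sup_le (pow_le_pow_left' homLin_le_affLin _) (polys_mono (Nat.le_succ _)))
    have e : polys (n + 1 + 1) = polys (n + 1) * affLin := pow_succ _ _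
    have ea : affLin = 1 ⊔ homLin := rfl
    rw [e, ea, Submodule.mul_sup, mul_one]
    refine sup_le le_sup_right ?_
    nth_rewrite 1 [ih]
    rw [Submodule.sup_mul, ← pow_succ]
    refine sup_le le_sup_left (le_trans ?_ le_sup_right)
    have e2 : polys (n + 1) = polys n * affLin := pow_succ _ _
    rw [e2]
    exact mul_le_mul' le_rfl homLin_le_affLin

/-- Continuous functions with growth of order `n`. -/
def growth (n : ℕ) : Submodule ℝ (Vel → ℝ) where
  carrier := {p | Continuous p ∧ ∃ C : ℝ, ∀ ξ, |p ξ| ≤ C * (1 + ‖ξ‖) ^ n}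
  add_mem' := by
    rintro p q ⟨hp, C, hC⟩ ⟨hq, D, hD⟩
    refine ⟨hp.add hq, C + D, fun ξ => ?_⟩
    have := abs_add_le (p ξ) (q ξ)
    have h1 := hC ξ
    have h2 := hD ξ
    simp only [Pi.add_apply]
    linarith
  zero_mem' := ⟨continuous_const, 0, fun ξ => by simp⟩
  smul_mem' := by
    rintro c p ⟨hp, C, hC⟩
    refine ⟨hp.const_smul c, |c| * C, fun ξ => ?_⟩
    simp only [Pi.smul_apply, smul_eq_mul, abs_mul]
    have := mul_le_mul_of_nonneg_left (hC ξ) (abs_nonneg c)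
    linarith

theorem affLin_le_growth : affLin ≤ growth 1 := by
  intro p hp
  obtain ⟨c, b, rfl⟩ := mem_affLin.1 hp
  refine ⟨by fun_prop, |c| + ‖b‖, fun ξ => ?_⟩
  have h1 := abs_add_le c (inner ℝ b ξ)
  have h2 := abs_real_inner_le_norm b ξ
  have := abs_nonneg c
  have := norm_nonneg b
  have := norm_nonneg ξ
  nlinarith [mul_nonneg (abs_nonneg c) (norm_nonneg ξ)]

theorem growth_mul_le (m n : ℕ) : growth m * growth n ≤ growth (m + n) := by
  rw [Submodule.mul_le]
  rintro p ⟨hp, C, hC⟩ q ⟨hq, D, hD⟩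
  refine ⟨hp.mul hq, C * D, fun ξ => ?_⟩
  have := mul_le_mul (hC ξ) (hD ξ) (abs_nonneg _) ((abs_nonneg _).trans (hC ξ))
  rw [Pi.mul_apply, abs_mul, pow_add]
  linarith

theorem polys_le_growth (n : ℕ) : polys n ≤ growth n := by
  induction n with
  | zero =>
    intro p hp
    rw [polys, pow_zero] at hp
    obtain ⟨c, rfl⟩ := Submodule.mem_one.1 hp
    exact ⟨continuous_const, |c|, fun ξ => by simp⟩
  | succ n ih =>
    have e : polys (n + 1) = polys n * affLin := pow_succ _ _
    rw [e]
    exact (mul_le_mul' ih affLin_le_growth).trans (growth_mul_le n 1)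

theorem continuous_of_mem_polys {n : ℕ} {p : Vel → ℝ} (hp : p ∈ polys n) : Continuous p :=
  (polys_le_growth n hp).1

theorem exists_bound_of_mem_polys {n : ℕ} {p : Vel → ℝ} (hp : p ∈ polys n) :
    ∃ C : ℝ, 0 ≤ C ∧ ∀ ξ, |p ξ| ≤ C * (1 + ‖ξ‖) ^ n := by
  obtain ⟨C, hC⟩ := (polys_le_growth n hp).2
  refine ⟨|C|, abs_nonneg _, fun ξ => (hC ξ).trans ?_⟩
  exact mul_le_mul_of_nonneg_right (le_abs_self C) (by positivity)

/-- Composition with a map of velocity space. -/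
def compHom (A : Vel → Vel) : (Vel → ℝ) →ₐ[ℝ] (Vel → ℝ) where
  toFun p := p ∘ A
  map_one' := rfl
  map_mul' _ _ := rfl
  map_zero' := rfl
  map_add' _ _ := rfl
  commutes' _ := rfl

/-- Composition is an algebra homomorphism and thus commutes with powers of subspaces; only degree
one needs a check. -/
theorem comp_mem_polys {n : ℕ} {p : Vel → ℝ} (hp : p ∈ polys n) (T : Vel →L[ℝ] Vel) (x : Vel) :
    (fun ξ => p (T ξ + x)) ∈ polys n := by
  have h1 : affLin.map (compHom fun ξ => T ξ + x).toLinearMap ≤ affLin := by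
    rintro _ ⟨q, hq, rfl⟩
    obtain ⟨c, b, rfl⟩ := mem_affLin.1 hq
    refine mem_affLin.2 ⟨c + inner ℝ b x, ContinuousLinearMap.adjoint T b, ?_⟩
    ext ξ
    change c + inner ℝ b (T ξ + x) = _
    rw [inner_add_right, ContinuousLinearMap.adjoint_inner_left]
    ring
  have h2 : (polys n).map (compHom fun ξ => T ξ + x).toLinearMap ≤ polys n := by
    rw [polys, Submodule.map_pow]
    exact pow_le_pow_left' h1 n
  exact h2 ⟨p, hp, rfl⟩

theorem homLin_pow_homogeneous {n : ℕ} {h : Vel → ℝ} (hh : h ∈ homLin ^ n) (t : ℝ) (x : Vel) :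
    h (t • x) = t ^ n * h x := by
  let S : ℕ → Submodule ℝ (Vel → ℝ) := fun n =>
    { carrier := {h | ∀ (t : ℝ) (x : Vel), h (t • x) = t ^ n * h x}
      add_mem' := fun {p q} hp hq t x => by simp [hp t x, hq t x, mul_add]
      zero_mem' := fun t x => by simp
      smul_mem' := fun c p hp t x => by simp [hp t x, mul_left_comm] }
  have key : ∀ n, homLin ^ n ≤ S n := by
    intro n
    induction n with
    | zero =>
      intro p hp
      rw [pow_zero] at hp
      obtain ⟨c, rfl⟩ := Submodule.mem_one.1 hp
      intro t x
      simp
    | succ n ih =>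
      rw [pow_succ, Submodule.mul_le]
      rintro p hp _ ⟨b, rfl⟩ t x
      have := ih hp t x
      simp only [Pi.mul_apply, this, linFun, LinearMap.coe_mk, AddHom.coe_mk, inner_smul_right,
        pow_succ]
      ring
  exact key n hh t x

theorem homLin_pow_le_polys (n : ℕ) : homLin ^ n ≤ polys n := pow_le_pow_left' homLin_le_affLin n

/-- Parameter integrals of functions in a finite-dimensional space stay in that space. -/
theorem integral_mem_of_finiteDimensional {X α : Type*} [MeasurableSpace α] {μ : Measure α}
    (V : Submodule ℝ (X → ℝ)) [FiniteDimensional ℝ V] (q : α → X → ℝ) (hq : ∀ ω, q ω ∈ V)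
    (hint : ∀ x, Integrable (fun ω => q ω x) μ) :
    (fun x => ∫ ω, q ω x ∂μ) ∈ V := by
  let ev : X → Module.Dual ℝ V := fun x => (LinearMap.proj x).comp V.subtype
  -- A function killed by all point evaluations is zero, so evaluations span the finite-dimensional
  -- dual. Each coordinate of q ω is then a finite combination of values q ω x, hence integrable.
  have htop : Submodule.span ℝ (Set.range ev) = ⊤ := by
    rw [← Subspace.dualCoannihilator_dualAnnihilator_eq (W := Submodule.span ℝ (Set.range ev)),
      ← Submodule.dualAnnihilator_bot]
    congr 1
    rw [eq_bot_iff]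
    intro p hp
    rw [Submodule.mem_dualCoannihilator] at hp
    rw [Submodule.mem_bot]
    ext x
    exact hp (ev x) (Submodule.subset_span ⟨x, rfl⟩)
  have hI : ∀ ℓ : Module.Dual ℝ V, Integrable (fun ω => ℓ ⟨q ω, hq ω⟩) μ := by
    intro ℓ
    have hℓ : ℓ ∈ Submodule.span ℝ (Set.range ev) := htop ▸ Submodule.mem_top
    induction hℓ using Submodule.span_induction with
    | mem ℓ h =>
      obtain ⟨x, rfl⟩ := h
      exact hint x
    | zero => simp
    | add ℓ m _ _ h1 h2 => exact h1.add h2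
    | smul c ℓ _ h => exact h.const_mul c
  let b := Module.finBasis ℝ V
  have e : (fun x => ∫ ω, q ω x ∂μ) =
      ∑ i, (∫ ω, b.coord i ⟨q ω, hq ω⟩ ∂μ) • (b i : X → ℝ) := by
    ext x
    have h1 : ∀ ω, q ω x = ∑ i, b.coord i ⟨q ω, hq ω⟩ * (b i : X → ℝ) x := by
      intro ω
      have := congrArg (fun p : V => (p : X → ℝ) x) (b.sum_repr ⟨q ω, hq ω⟩)
      simp only [Submodule.coe_sum, Submodule.coe_smul, Finset.sum_apply, Pi.smul_apply,
        smul_eq_mul] at this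
      exact this.symm
    simp only [h1]
    rw [integral_finsetSum _ fun i _ => (hI (b.coord i)).mul_const _]
    simp [integral_mul_const]
  rw [e]
  exact Submodule.sum_mem _ fun i _ => V.smul_mem _ (b i).2

/-! ### Polynomials in L²(M) and the averaged collision operator -/

theorem integrable_gauss_iff (u : FluidState) (g : Vel → ℝ) :
    Integrable g (gauss u) ↔ Integrable fun ξ => maxwellian u ξ * g ξ := by
  have hM := mass_pos u
  rw [gauss, integrable_withDensity_iff_integrable_smul' (measurable_gaussDensity u)
    (Filter.Eventually.of_forall fun _ => ENNReal.ofReal_lt_top)]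
  have e : ∀ ξ, (gaussDensity u ξ).toReal • g ξ = (mass u)⁻¹ * (maxwellian u ξ * g ξ) := by
    intro ξ
    rw [gaussDensity, ENNReal.toReal_ofReal (div_nonneg (maxwellian_pos u ξ).le hM.le), smul_eq_mul]
    field_simp
  simp only [e]
  exact integrable_const_mul_iff (isUnit_iff_ne_zero.2 (inv_ne_zero hM.ne')) _

theorem integral_gauss (u : FluidState) (g : Vel → ℝ) :
    ∫ ξ, g ξ ∂gauss u = (mass u)⁻¹ * ∫ ξ, maxwellian u ξ * g ξ := by
  have hM := mass_pos u
  rw [gauss, integral_withDensity_eq_integral_toReal_smul (measurable_gaussDensity u)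
    (Filter.Eventually.of_forall fun _ => ENNReal.ofReal_lt_top), ← integral_const_mul]
  refine integral_congr_ae (Filter.Eventually.of_forall fun ξ => ?_)
  simp only [gaussDensity]
  rw [ENNReal.toReal_ofReal (div_nonneg (maxwellian_pos u ξ).le hM.le), smul_eq_mul]
  field_simp

theorem integrable_exp_gauss (u : FluidState) (t : ℝ) :
    Integrable (fun ξ => Real.exp (t * ‖ξ‖)) (gauss u) := by
  rw [integrable_gauss_iff]
  have := integrable_maxwellian_rpow_mul_exp u one_pos t
  simpa using this

theorem integrable_pow_gauss (u : FluidState) (c : ℝ) (hc : 1 ≤ c) (n : ℕ) :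
    Integrable (fun ξ => (c + ‖ξ‖) ^ n) (gauss u) := by
  refine ((integrable_exp_gauss u n).const_mul (c ^ n)).mono' (by fun_prop)
    (Filter.Eventually.of_forall fun ξ => ?_)
  have h := norm_nonneg ξ
  rw [Real.norm_of_nonneg (by positivity), Real.exp_nat_mul, ← mul_pow]
  refine pow_le_pow_left₀ (by positivity) ?_ n
  have h2 := Real.add_one_le_exp ‖ξ‖
  nlinarith

theorem memLp_polys (u : FluidState) {n : ℕ} {p : Vel → ℝ} (hp : p ∈ polys n) :
    MemLp p 2 (gauss u) := by
  have hc := continuous_of_mem_polys hp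
  obtain ⟨C, hC0, hC⟩ := exists_bound_of_mem_polys hp
  rw [memLp_two_iff_integrable_sq hc.aestronglyMeasurable]
  refine ((integrable_pow_gauss u 1 le_rfl (2 * n)).const_mul (C ^ 2)).mono' (by fun_prop)
    (Filter.Eventually.of_forall fun ξ => ?_)
  rw [Real.norm_of_nonneg (sq_nonneg _), ← sq_abs, pow_mul', ← mul_pow]
  exact pow_le_pow_left₀ (abs_nonneg _) (hC ξ) 2

/-- Polynomials as elements of `L²(M)`. -/
def polyLp (u : FluidState) (n : ℕ) : polys n →ₗ[ℝ] GaussL2 u where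
  toFun p := (memLp_polys u p.2).toLp p
  map_add' p q := (MemLp.toLp_add (memLp_polys u p.2) (memLp_polys u q.2))
  map_smul' c p := (MemLp.toLp_const_smul c (memLp_polys u p.2))

theorem coeFn_polyLp (u : FluidState) (n : ℕ) (p : polys n) :
    polyLp u n p =ᵐ[gauss u] (p : Vel → ℝ) := MemLp.coeFn_toLp (memLp_polys u p.2)

/-- Continuous functions that agree almost everywhere for a measure of full support are equal. -/
theorem polyLp_injective (u : FluidState) (n : ℕ) : Function.Injective (polyLp u n) := by
  intro p q h
  have h0 := coeFn_polyLp u n p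
  rw [h] at h0
  have h1 := h0.symm.trans (coeFn_polyLp u n q)
  have := Continuous.ae_eq_iff_eq (gauss u) (continuous_of_mem_polys p.2)
    (continuous_of_mem_polys q.2)
  exact Subtype.ext (this.1 h1)

theorem integrable_partner (u : FluidState) {n : ℕ} {p : Vel → ℝ} (hp : p ∈ polys n)
    {A : Vel × Sph → Vel} (hA : Continuous A) {c : ℝ} (hc : 0 ≤ c)
    (h : ∀ q, ‖A q‖ ≤ c + ‖q.1‖) : Integrable (fun q => p (A q)) (partnerLaw u) := by
  obtain ⟨C, hC0, hC⟩ := exists_bound_of_mem_polys hp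
  have hi : Integrable (fun q : Vel × Sph => C * ((1 + c) + ‖q.1‖) ^ n) (partnerLaw u) :=
    ((integrable_pow_gauss u (1 + c) (by linarith) n).comp_fst unifSph).const_mul C
  refine hi.mono' ((continuous_of_mem_polys hp).comp hA).aestronglyMeasurable
    (Filter.Eventually.of_forall fun q => (hC _).trans ?_)
  have := h q
  have := norm_nonneg (A q)
  refine mul_le_mul_of_nonneg_left (pow_le_pow_left₀ (by positivity) (by linarith) n) hC0

theorem norm_colMap_fst_le (x : Encounter) : ‖(colMap x).1‖ ≤ ‖x.1‖ + ‖x.2.1‖ := by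
  have h := norm_sq_colMap 0 x
  simp only [sub_zero] at h
  refine abs_le_of_sq_le_sq' ?_ (by positivity) |>.2
  nlinarith [sq_nonneg ‖(colMap x).2.1‖, mul_nonneg (norm_nonneg x.1) (norm_nonneg x.2.1)]

theorem norm_colMap_snd_le (x : Encounter) : ‖(colMap x).2.1‖ ≤ ‖x.1‖ + ‖x.2.1‖ := by
  have h := norm_sq_colMap 0 x
  simp only [sub_zero] at h
  refine abs_le_of_sq_le_sq' ?_ (by positivity) |>.2
  nlinarith [sq_nonneg ‖(colMap x).1‖, mul_nonneg (norm_nonneg x.1) (norm_nonneg x.2.1)]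

theorem continuous_colMap_mk (ξ : Vel) : Continuous fun q : Vel × Sph => colMap (ξ, q) :=
  continuous_colMap.comp (by fun_prop)

theorem integrable_defect_partner (u : FluidState) {n : ℕ} {p : Vel → ℝ} (hp : p ∈ polys n)
    (ξ : Vel) : Integrable (fun q => -defect p (ξ, q)) (partnerLaw u) := by
  have h1 := integrable_partner u hp (A := fun q => (colMap (ξ, q)).1)
    (continuous_fst.comp (continuous_colMap_mk ξ)) (norm_nonneg ξ) fun q => norm_colMap_fst_le (ξ, q)
  have h2 := integrable_partner u hp (A := fun q => (colMap (ξ, q)).2.1)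
    (continuous_fst.comp (continuous_snd.comp (continuous_colMap_mk ξ))) (norm_nonneg ξ)
    fun q => norm_colMap_snd_le (ξ, q)
  have h3 : Integrable (fun _ : Vel × Sph => p ξ) (partnerLaw u) := integrable_const _
  have h4 := integrable_partner u hp (A := fun q => q.1) continuous_fst le_rfl fun q => by simp
  refine (((h1.add h2).sub h3).sub h4).neg

/-- `∫ (p + p_* - p' - p'_*)` over the law of the collision partner. -/
def avgOp (u : FluidState) (p : Vel → ℝ) (ξ : Vel) : ℝ := ∫ q, -defect p (ξ, q) ∂partnerLaw u

/-- Orthogonal projection onto the line of `Ω`. -/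
def lineProj (Ω : Sph) : Vel →L[ℝ] Vel := (innerSL ℝ (Ω : Vel)).smulRight (Ω : Vel)

theorem lineProj_apply (Ω : Sph) (x : Vel) :
    lineProj Ω x = (inner ℝ (Ω : Vel) x) • (Ω : Vel) := by
  simp [lineProj]

theorem norm_lineProj (Ω : Sph) (x : Vel) : ‖lineProj Ω x‖ = |inner ℝ (Ω : Vel) x| := by
  rw [lineProj_apply, norm_smul]
  simp

theorem norm_lineProj_le (Ω : Sph) (x : Vel) : ‖lineProj Ω x‖ ≤ ‖x‖ := by
  rw [norm_lineProj]
  exact abs_inner_sphere_le Ω x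

theorem norm_sub_lineProj_sq (Ω : Sph) (x : Vel) :
    ‖x - lineProj Ω x‖ ^ 2 = ‖x‖ ^ 2 - inner ℝ (Ω : Vel) x ^ 2 := by
  rw [norm_sub_sq_real, norm_lineProj, sq_abs, lineProj_apply, inner_smul_right, real_inner_comm]
  ring

theorem norm_sub_lineProj_le (Ω : Sph) (x : Vel) : ‖x - lineProj Ω x‖ ≤ ‖x‖ := by
  refine abs_le_of_sq_le_sq' ?_ (norm_nonneg _) |>.2
  rw [norm_sub_lineProj_sq]
  nlinarith [sq_nonneg (inner ℝ (Ω : Vel) x)]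

theorem colMap_fst_eq (ξ : Vel) (q : Vel × Sph) :
    (colMap (ξ, q)).1 = (ξ - lineProj q.2 ξ) + lineProj q.2 q.1 := by
  simp only [colMap, postVel, lineProj_apply, inner_sub_right, sub_smul]
  abel

theorem colMap_snd_eq (ξ : Vel) (q : Vel × Sph) :
    (colMap (ξ, q)).2.1 = lineProj q.2 ξ + (q.1 - lineProj q.2 q.1) := by
  simp only [colMap, postVelStar, lineProj_apply, inner_sub_right, sub_smul]
  abel

theorem const_mem_polys (n : ℕ) (c : ℝ) : (fun _ : Vel => c) ∈ polys n := by
  refine polys_mono (Nat.zero_le n) ?_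
  rw [polys, pow_zero]
  exact const_mem_one c

/-- For fixed partner and direction, ξ' and ξ'_* are affine in ξ, so the degree does not grow;
averaging stays in the finite-dimensional space. This uses that the kernel B is absent. -/
theorem avgOp_mem_polys (u : FluidState) {n : ℕ} {p : Vel → ℝ} (hp : p ∈ polys n) :
    avgOp u p ∈ polys n := by
  refine integral_mem_of_finiteDimensional (μ := partnerLaw u) (polys n)
    (fun q ξ => -defect p (ξ, q)) (fun q => ?_) (integrable_defect_partner u hp)
  have h1 : (fun ξ => p (colMap (ξ, q)).1) ∈ polys n := by
    have := comp_mem_polys hp (ContinuousLinearMap.id ℝ Vel - lineProj q.2) (lineProj q.2 q.1)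
    simp only [colMap_fst_eq]
    exact this
  have h2 : (fun ξ => p (colMap (ξ, q)).2.1) ∈ polys n := by
    have := comp_mem_polys hp (lineProj q.2) (q.1 - lineProj q.2 q.1)
    simpa only [colMap_snd_eq] using this
  exact Submodule.neg_mem _ (Submodule.sub_mem _ (Submodule.sub_mem _ (Submodule.add_mem _ h1 h2) hp)
    (const_mem_polys n (p q.1)))

theorem defect_congr (u : FluidState) {φ ψ : Vel → ℝ} (h : φ =ᵐ[gauss u] ψ) :
    defect φ =ᵐ[encounterLaw u] defect ψ := by
  have q : ∀ {T : Encounter → Encounter}, MeasurePreserving T (encounterLaw u) (encounterLaw u) →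
      ∀ᵐ x ∂encounterLaw u, φ (T x).1 = ψ (T x).1 := fun hT =>
    (fst_comp_law u hT).quasiMeasurePreserving.ae_eq_comp h
  filter_upwards [q (colMap_law u), q ((swapMap_law u).comp (colMap_law u)),
    q (MeasurePreserving.id _), q (swapMap_law u)] with x h1 h2 h3 h4
  simp only [Function.comp, swapMap, id] at h2 h3 h4
  simp only [defect, h1, h2, h3, h4]

/-- The symmetrization `inner_defectSq_eq` followed by integration over the partner. -/
theorem defectSq_polyLp (u : FluidState) {n : ℕ} (p : polys n) :
    defectSq u (polyLp u n p) = (4 : ℝ) • polyLp u n ⟨avgOp u p, avgOp_mem_polys u p.2⟩ := by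
  refine ext_inner_right ℝ fun ψ => ?_
  rw [inner_defectSq_eq, inner_smul_left, inner_eq_integral]
  have hd : defect (polyLp u n p) =ᵐ[encounterLaw u] defect p :=
    defect_congr u (coeFn_polyLp u n p)
  have hD : MemLp (defect p) 2 (encounterLaw u) :=
    (memLp_congr_ae ((coeFn_defectOp u (polyLp u n p)).trans hd)).1 (Lp.memLp _)
  have hψ : MemLp (fun x : Encounter => ψ x.1) 2 (encounterLaw u) :=
    (Lp.memLp ψ).comp_measurePreserving (fst_law u)
  have hI : Integrable (fun x : Encounter => defect p x * ψ x.1) (encounterLaw u) :=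
    hD.integrable_mul hψ
  have e1 : ∫ x, defect (polyLp u n p) x * ψ x.1 ∂encounterLaw u =
      ∫ x, defect p x * ψ x.1 ∂encounterLaw u := by
    refine integral_congr_ae ?_
    filter_upwards [hd] with x hx
    rw [hx]
  have e2 : ∫ x, defect p x * ψ x.1 ∂encounterLaw u = -∫ ξ, avgOp u p ξ * ψ ξ ∂gauss u := by
    rw [encounterLaw, integral_prod _ hI, ← integral_neg]
    refine integral_congr_ae (Filter.Eventually.of_forall fun ξ => ?_)
    simp only [avgOp, integral_mul_const, integral_neg]
    ring
  have e3 : ∫ ξ, polyLp u n ⟨avgOp u p, avgOp_mem_polys u p.2⟩ ξ * ψ ξ ∂gauss u =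
      ∫ ξ, avgOp u p ξ * ψ ξ ∂gauss u := by
    refine integral_congr_ae ?_
    filter_upwards [coeFn_polyLp u n ⟨avgOp u p, avgOp_mem_polys u p.2⟩] with ξ hξ
    rw [hξ]
  rw [e1, e2, e3]
  simp

/-! ### Leading parts of eigenpolynomials -/

/-- The summand |p b| is there only for n = 0, where k = 0 leaves p b and k > 0 divides by zero,
which gives zero. -/
theorem scaled_bound {k : ℕ} {p : Vel → ℝ} {C : ℝ} (hC0 : 0 ≤ C)
    (hC : ∀ ξ, |p ξ| ≤ C * (1 + ‖ξ‖) ^ k) (a b : Vel) (n : ℕ) :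
    |p ((n : ℝ) • a + b) / (n : ℝ) ^ k| ≤ C * (1 + ‖a‖ + ‖b‖) ^ k + |p b| := by
  rcases Nat.eq_zero_or_pos n with rfl | hn
  · rcases Nat.eq_zero_or_pos k with rfl | hk
    · simp
      exact hC0
    · rw [Nat.cast_zero, zero_pow hk.ne', div_zero, abs_zero]
      positivity
  · have hn1 : (1 : ℝ) ≤ n := by exact_mod_cast hn
    have hn0 : (0 : ℝ) < (n : ℝ) ^ k := by positivity
    rw [abs_div, abs_of_pos hn0]
    refine le_trans ?_ (le_add_of_nonneg_right (abs_nonneg _))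
    rw [div_le_iff₀ hn0, mul_assoc, ← mul_pow]
    refine (hC _).trans (mul_le_mul_of_nonneg_left (pow_le_pow_left₀ (by positivity) ?_ k) hC0)
    have h1 := norm_add_le ((n : ℝ) • a) b
    rw [norm_smul, Real.norm_of_nonneg (by positivity)] at h1
    nlinarith [norm_nonneg a, norm_nonneg b]

open Filter Topology in
theorem tendsto_scaled {k : ℕ} {h r : Vel → ℝ} (hh : h ∈ homLin ^ (k + 1)) (hr : r ∈ polys k)
    (a b : Vel) : Tendsto (fun n : ℕ => (h + r) ((n : ℝ) • a + b) / (n : ℝ) ^ (k + 1)) atTop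
      (𝓝 (h a)) := by
  have hinv : Tendsto (fun n : ℕ => ((n : ℝ))⁻¹) atTop (𝓝 0) := tendsto_inv_atTop_nhds_zero_nat
  have hcont := continuous_of_mem_polys (homLin_pow_le_polys _ hh)
  have t1 : Tendsto (fun n : ℕ => h (a + ((n : ℝ))⁻¹ • b)) atTop (𝓝 (h a)) := by
    have h0 : Tendsto (fun n : ℕ => a + ((n : ℝ))⁻¹ • b) atTop (𝓝 a) := by
      have := (hinv.smul_const b).const_add a
      simpa using this
    exact (hcont.tendsto a).comp h0
  obtain ⟨C, hC0, hC⟩ := exists_bound_of_mem_polys hr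
  have t2 : Tendsto (fun n : ℕ => r ((n : ℝ) • a + b) / (n : ℝ) ^ (k + 1)) atTop (𝓝 0) := by
    refine squeeze_zero_norm (a := fun n : ℕ => (C * (1 + ‖a‖ + ‖b‖) ^ k + |r b|) * ((n : ℝ))⁻¹) ?_ ?_
    · intro n
      have := scaled_bound hC0 hC a b n
      rw [pow_succ, ← div_div, Real.norm_eq_abs, abs_div, Nat.abs_cast, div_eq_mul_inv _ (n : ℝ)]
      exact mul_le_mul_of_nonneg_right this (by positivity)
    · have := hinv.const_mul (C * (1 + ‖a‖ + ‖b‖) ^ k + |r b|)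
      simpa using this
  have t3 := t1.add t2
  rw [add_zero] at t3
  refine t3.congr' ?_
  filter_upwards [eventually_gt_atTop 0] with n hn
  have hn0 : (n : ℝ) ≠ 0 := by exact_mod_cast hn.ne'
  have e : (n : ℝ) • a + b = (n : ℝ) • (a + ((n : ℝ))⁻¹ • b) := by
    rw [smul_add, smul_smul, mul_inv_cancel₀ hn0, one_smul]
  rw [Pi.add_apply, add_div]
  congr 1
  rw [e, homLin_pow_homogeneous hh]
  field_simp

-- Evaluate the eigenvalue equation at n x, divide by n^{k+1} and let n → ∞. The partner ξ_*
-- disappears in the limit, as if it were at rest: ξ' becomes x - Px and ξ'_* becomes Px, with P the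
-- projection onto the line of Ω.
open Filter Topology in
theorem leading_part_eq (u : FluidState) {k : ℕ} {h r : Vel → ℝ} (hh : h ∈ homLin ^ (k + 1))
    (hr : r ∈ polys k) {μ : ℝ} (hμ : ∀ ξ, avgOp u (h + r) ξ = μ * (h + r) ξ) (x : Vel) :
    (1 - μ) * h x = ∫ Ω, (h (x - lineProj Ω x) + h (lineProj Ω x)) ∂unifSph := by
  have hp : h + r ∈ polys (k + 1) :=
    Submodule.add_mem _ (homLin_pow_le_polys _ hh) (polys_mono (Nat.le_succ k) hr)
  have hcp := continuous_of_mem_polys hp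
  have hch := continuous_of_mem_polys (homLin_pow_le_polys _ hh)
  obtain ⟨C, hC0, hC⟩ := exists_bound_of_mem_polys hp
  set p := h + r with hpdef
  have h00 : h 0 = 0 := by
    have := homLin_pow_homogeneous hh 0 0
    simpa using this
  have hlp : Continuous fun Ω : Sph => lineProj Ω x := by
    simp only [lineProj_apply]
    fun_prop
  set G : ℕ → Vel × Sph → ℝ := fun n q =>
    p ((n : ℝ) • x + 0) / (n : ℝ) ^ (k + 1) + p ((n : ℝ) • (0 : Vel) + q.1) / (n : ℝ) ^ (k + 1) -
    p ((n : ℝ) • (x - lineProj q.2 x) + lineProj q.2 q.1) / (n : ℝ) ^ (k + 1) -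
    p ((n : ℝ) • lineProj q.2 x + (q.1 - lineProj q.2 q.1)) / (n : ℝ) ^ (k + 1) with hG
  have hGe : ∀ n : ℕ, ∀ q : Vel × Sph, G n q = -defect p ((n : ℝ) • x, q) / (n : ℝ) ^ (k + 1) := by
    intro n q
    simp only [hG, defect, colMap_fst_eq, colMap_snd_eq, map_smul, smul_sub, smul_zero, add_zero,
      zero_add]
    ring
  have lim1 : Tendsto (fun n : ℕ => ∫ q, G n q ∂partnerLaw u) atTop
      (𝓝 (∫ q : Vel × Sph, (h x + h 0 - h (x - lineProj q.2 x) - h (lineProj q.2 x))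
        ∂partnerLaw u)) := by
    -- The factor 8 counts four summands, each at most twice the displayed power.
    refine tendsto_integral_of_dominated_convergence
      (fun q : Vel × Sph => 8 * (C * ((1 + ‖x‖) + ‖q.1‖) ^ (k + 1))) ?_ ?_ ?_ ?_
    · intro n
      rw [show G n = _ from funext (hGe n)]
      exact ((integrable_defect_partner u hp _).div_const _).aestronglyMeasurable
    · exact ((((integrable_pow_gauss u (1 + ‖x‖) (by linarith [norm_nonneg x]) (k + 1)).comp_fst
        unifSph).const_mul C).const_mul 8)
    · intro n
      refine Eventually.of_forall fun q => ?_
      have b : ∀ a b : Vel, ‖a‖ ≤ ‖x‖ → ‖b‖ ≤ ‖q.1‖ →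
          |p ((n : ℝ) • a + b) / (n : ℝ) ^ (k + 1)| ≤ 2 * (C * ((1 + ‖x‖) + ‖q.1‖) ^ (k + 1)) := by
        intro a b ha hb
        have h1 := scaled_bound hC0 hC a b n
        have h2 := hC b
        have h3 : C * (1 + ‖a‖ + ‖b‖) ^ (k + 1) ≤ C * ((1 + ‖x‖) + ‖q.1‖) ^ (k + 1) := by gcongr
        have h4 : C * (1 + ‖b‖) ^ (k + 1) ≤ C * ((1 + ‖x‖) + ‖q.1‖) ^ (k + 1) := by
          gcongr
          linarith [norm_nonneg x]
        linarith
      have b1 := b x 0 le_rfl (by simp)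
      have b2 := b 0 q.1 (by simp) le_rfl
      have b3 := b (x - lineProj q.2 x) (lineProj q.2 q.1) (norm_sub_lineProj_le _ _)
        (norm_lineProj_le _ _)
      have b4 := b (lineProj q.2 x) (q.1 - lineProj q.2 q.1) (norm_lineProj_le _ _)
        (norm_sub_lineProj_le _ _)
      simp only [hG, Real.norm_eq_abs]
      rw [abs_le] at *
      constructor <;> linarith [b1.1, b1.2, b2.1, b2.2, b3.1, b3.2, b4.1, b4.2]
    · refine Eventually.of_forall fun q => ?_
      exact (((tendsto_scaled hh hr x 0).add (tendsto_scaled hh hr 0 q.1)).sub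
        (tendsto_scaled hh hr _ _)).sub (tendsto_scaled hh hr _ _)
  have lim2 : Tendsto (fun n : ℕ => ∫ q, G n q ∂partnerLaw u) atTop (𝓝 (μ * h x)) := by
    have e : ∀ n : ℕ, ∫ q, G n q ∂partnerLaw u = μ * (p ((n : ℝ) • x + 0) / (n : ℝ) ^ (k + 1)) := by
      intro n
      simp only [hGe]
      rw [integral_div]
      have := hμ ((n : ℝ) • x)
      rw [avgOp] at this
      rw [this, add_zero]
      ring
    simp only [e]
    exact (tendsto_scaled hh hr x 0).const_mul μ
  have key := tendsto_nhds_unique lim2 lim1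
  have hcont : Continuous fun Ω : Sph => h (x - lineProj Ω x) + h (lineProj Ω x) :=
    (hch.comp (continuous_const.sub hlp)).add (hch.comp hlp)
  have hint : Integrable (fun Ω : Sph => h (x - lineProj Ω x) + h (lineProj Ω x)) unifSph := by
    have : Integrable (fun Ω : Sph => h (x - lineProj Ω x) + h (lineProj Ω x)) surface :=
      hcont.integrable_of_hasCompactSupport (HasCompactSupport.of_compactSpace _)
    rw [unifSph, withDensity_const]
    exact this.smul_measure (ENNReal.inv_ne_top.2 surface_univ_ne_zero)
  have e2 : ∫ q : Vel × Sph, (h x + h 0 - h (x - lineProj q.2 x) - h (lineProj q.2 x))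
        ∂partnerLaw u = ∫ Ω, (h x - (h (x - lineProj Ω x) + h (lineProj Ω x))) ∂unifSph := by
    have := integral_fun_snd (μ := gauss u) (ν := unifSph)
      (fun Ω : Sph => h x - (h (x - lineProj Ω x) + h (lineProj Ω x)))
    simp only [probReal_univ, one_smul] at this
    rw [← this, partnerLaw]
    refine integral_congr_ae (Eventually.of_forall fun q => ?_)
    simp only [h00]
    ring
  rw [e2, integral_sub (integrable_const _) hint, integral_const, probReal_univ, one_smul] at key
  linarith

/-- `∫ (t² - t⁴)` for `t = Ω · e`, normalized. -/
def sphereGap : ℝ := ∫ Ω : Sph, ((Ω : Vel) 0 ^ 2 - (Ω : Vel) 0 ^ 4) ∂unifSph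

theorem unifSph_eq_smul : unifSph = (surface Set.univ)⁻¹ • surface := withDensity_const _

theorem integrable_unifSph {f : Sph → ℝ} (hf : Integrable f surface) : Integrable f unifSph := by
  rw [unifSph_eq_smul]
  exact hf.smul_measure (ENNReal.inv_ne_top.2 surface_univ_ne_zero)

theorem integrable_sphereGap :
    Integrable (fun Ω : Sph => (Ω : Vel) 0 ^ 2 - (Ω : Vel) 0 ^ 4) surface := by
  have : Continuous fun Ω : Sph => (Ω : Vel) 0 ^ 2 - (Ω : Vel) 0 ^ 4 := by fun_prop
  exact this.integrable_of_hasCompactSupport (HasCompactSupport.of_compactSpace _)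

theorem sphereGap_pos : 0 < sphereGap := by
  have h1 : 0 < ∫ Ω : Sph, ((Ω : Vel) 0 ^ 2 - (Ω : Vel) 0 ^ 4) ∂surface := by
    have h0 : ∀ᵐ Ω : Sph ∂surface, 0 < (Ω : Vel) 0 ^ 2 - (Ω : Vel) 0 ^ 4 := by
      filter_upwards [surface_coord_ne_zero, surface_coord_sq_lt_one] with Ω h1 h2
      have := pow_pos (sq_pos_of_ne_zero h1) 1
      nlinarith
    rw [integral_pos_iff_support_of_nonneg_ae (h0.mono fun Ω h => h.le) integrable_sphereGap]
    rw [pos_iff_ne_zero]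
    intro h
    have h2 := measure_eq_zero_iff_ae_notMem.1 h
    have h3 : ∀ᵐ Ω : Sph ∂surface, False := by
      filter_upwards [h0, h2] with Ω h4 h5
      exact h5 h4.ne'
    rw [Filter.eventually_false_iff_eq_bot, ae_eq_bot] at h3
    exact Measure.toSphere_ne_zero _ h3
  rw [sphereGap, unifSph_eq_smul, integral_smul_measure]
  refine smul_pos (ENNReal.toReal_pos ?_ ?_) h1
  · exact ENNReal.inv_ne_zero.2 (measure_ne_top _ _)
  · exact ENNReal.inv_ne_top.2 surface_univ_ne_zero

theorem integral_unifSph_inner {x : Vel} (hx : ‖x‖ = 1) :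
    ∫ Ω : Sph, (inner ℝ (Ω : Vel) x ^ 2 - inner ℝ (Ω : Vel) x ^ 4) ∂unifSph = sphereGap := by
  rw [sphereGap, unifSph_eq_smul, integral_smul_measure, integral_smul_measure,
    surface_integral_inner_eq x (g := fun t => t ^ 2 - t ^ 4) (by fun_prop)]
  simp only [hx, one_mul]

/-- Here a³ + b³ = (a + b)(1 - ab), and (a + b)² = 1 + 2ab ≤ (1 + ab)². Degree 3 is the first one
with a strict loss; for squares the sum is exactly 1, as the conserved energy demands. -/
theorem cube_add_cube_le {a b : ℝ} (ha : 0 ≤ a) (hb : 0 ≤ b) (h : a ^ 2 + b ^ 2 = 1) :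
    a ^ 3 + b ^ 3 ≤ 1 - a ^ 2 * b ^ 2 := by
  have hp : a * b ≤ 1 / 2 := by nlinarith [sq_nonneg (a - b)]
  have h1 : a + b ≤ 1 + a * b := by
    refine abs_le_of_sq_le_sq' ?_ (by positivity) |>.2
    nlinarith [mul_nonneg ha hb]
  have h2 : a ^ 3 + b ^ 3 = (a + b) * (1 - a * b) := by rw [← h]; ring
  rw [h2]
  nlinarith

theorem exists_max_homogeneous {d : ℕ} {h : Vel → ℝ} (hc : Continuous h)
    (hh : ∀ (t : ℝ) (x : Vel), h (t • x) = t ^ d * h x) :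
    ∃ x : Vel, ‖x‖ = 1 ∧ ∀ y, |h y| ≤ |h x| * ‖y‖ ^ d := by
  obtain ⟨x, hx, hmax⟩ := (isCompact_sphere (0 : Vel) 1).exists_isMaxOn
    (f := fun x => |h x|) ⟨axis, by simp [axis]⟩ hc.abs.continuousOn
  refine ⟨x, by simpa using hx, fun y => ?_⟩
  have key : ∀ z : Vel, ‖z‖ = 1 → |h z| ≤ |h x| := fun z hz => hmax (by simpa using hz)
  rcases eq_or_ne y 0 with rfl | hy
  · have h0 := hh 0 x
    rw [zero_smul] at h0
    rw [h0, abs_mul, abs_pow, abs_zero, norm_zero, mul_comm]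
  · have hy' : ‖y‖ ≠ 0 := norm_ne_zero_iff.2 hy
    have h1 := key (‖y‖⁻¹ • y) (by rw [norm_smul, norm_inv, norm_norm, inv_mul_cancel₀ hy'])
    have h2 := hh ‖y‖ (‖y‖⁻¹ • y)
    rw [smul_smul, mul_inv_cancel₀ hy', one_smul] at h2
    rw [h2, abs_mul, abs_pow, abs_norm, mul_comm]
    exact mul_le_mul_of_nonneg_right h1 (by positivity)

/-- At a maximum point x of |h| on the unit sphere, homogeneity bounds the right side of
`leading_part_eq` by |h x| times the mean of a^{k+1} + b^{k+1}, with a = ‖x - Px‖ and b = ‖Px‖.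
Since k + 1 ≥ 3 this mean is at most 1 - `sphereGap`, for every degree. -/
theorem sphereGap_le_eigenvalue (u : FluidState) {k : ℕ} (hk : 2 ≤ k) {h r : Vel → ℝ}
    (hh : h ∈ homLin ^ (k + 1)) (h0 : h ≠ 0) (hr : r ∈ polys k) {μ : ℝ}
    (hμ : ∀ ξ, avgOp u (h + r) ξ = μ * (h + r) ξ) : sphereGap ≤ μ := by
  have hhom := homLin_pow_homogeneous hh
  have hch := continuous_of_mem_polys (homLin_pow_le_polys _ hh)
  obtain ⟨x, hx, hmax⟩ := exists_max_homogeneous hch hhom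
  have hpos : 0 < |h x| := by
    refine lt_of_le_of_ne (abs_nonneg _) fun h1 => h0 (funext fun y => ?_)
    have := hmax y
    rw [← h1, zero_mul] at this
    simpa using this
  have key := leading_part_eq u hh hr hμ x
  have hb : ∀ Ω : Sph, ‖h (x - lineProj Ω x) + h (lineProj Ω x)‖ ≤
      |h x| * (1 - (inner ℝ (Ω : Vel) x ^ 2 - inner ℝ (Ω : Vel) x ^ 4)) := by
    intro Ω
    have e := norm_sub_lineProj_sq Ω x
    rw [hx, one_pow] at e
    have ec : ‖lineProj Ω x‖ ^ 2 = inner ℝ (Ω : Vel) x ^ 2 := by rw [norm_lineProj, sq_abs]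
    set a := ‖x - lineProj Ω x‖ with ha
    set b := ‖lineProj Ω x‖ with hb
    have ha0 : 0 ≤ a := norm_nonneg _
    have hb0 : 0 ≤ b := norm_nonneg _
    have ha1 : a ≤ 1 := by rw [ha, ← hx]; exact norm_sub_lineProj_le Ω x
    have hb1 : b ≤ 1 := by rw [hb, ← hx]; exact norm_lineProj_le Ω x
    have h1 := hmax (x - lineProj Ω x)
    have h2 := hmax (lineProj Ω x)
    have h3 := abs_add_le (h (x - lineProj Ω x)) (h (lineProj Ω x))
    have h4 : a ^ (k + 1) ≤ a ^ 3 := pow_le_pow_of_le_one ha0 ha1 (by omega)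
    have h5 : b ^ (k + 1) ≤ b ^ 3 := pow_le_pow_of_le_one hb0 hb1 (by omega)
    have h6 := cube_add_cube_le ha0 hb0 (by linarith)
    have h7 : a ^ 2 * b ^ 2 = inner ℝ (Ω : Vel) x ^ 2 - inner ℝ (Ω : Vel) x ^ 4 := by
      rw [e, ec]; ring
    rw [Real.norm_eq_abs]
    rw [h7] at h6
    have h8 := mul_le_mul_of_nonneg_left (h4.trans_eq rfl) hpos.le
    have h9 := mul_le_mul_of_nonneg_left (h5.trans_eq rfl) hpos.le
    have h10 := mul_le_mul_of_nonneg_left h6 hpos.le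
    rw [mul_add] at h10
    linarith
  have hI : Integrable (fun Ω : Sph => inner ℝ (Ω : Vel) x ^ 2 - inner ℝ (Ω : Vel) x ^ 4)
      unifSph := by
    refine integrable_unifSph ?_
    have : Continuous fun Ω : Sph => inner ℝ (Ω : Vel) x ^ 2 - inner ℝ (Ω : Vel) x ^ 4 := by fun_prop
    exact this.integrable_of_hasCompactSupport (HasCompactSupport.of_compactSpace _)
  have hle := norm_integral_le_of_norm_le (((integrable_const 1).sub hI).const_mul |h x|)
    (Filter.Eventually.of_forall hb)
  rw [integral_const_mul] at hle
  simp only [Pi.sub_apply] at hle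
  rw [integral_sub (integrable_const _) hI, integral_unifSph_inner hx, ← key, norm_mul,
    Real.norm_eq_abs, Real.norm_eq_abs, mul_comm] at hle
  simp only [integral_const, probReal_univ, smul_eq_mul, mul_one] at hle
  have h1 := le_of_mul_le_mul_left hle hpos
  have h2 := le_abs_self (1 - μ)
  linarith

/-! ### Collision invariants and the gap in the eigenvalues -/

/-- The collision invariants `α + β · ξ + γ |ξ|²`. -/
def invariants : Submodule ℝ (Vel → ℝ) := affLin ⊔ Submodule.span ℝ {fun ξ : Vel => ‖ξ‖ ^ 2}

theorem mem_invariants {p : Vel → ℝ} : p ∈ invariants ↔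
    ∃ (α : ℝ) (β : Vel) (γ : ℝ), p = fun ξ => α + inner ℝ β ξ + γ * ‖ξ‖ ^ 2 := by
  constructor
  · intro h
    obtain ⟨y, hy, z, hz, rfl⟩ := Submodule.mem_sup.1 h
    obtain ⟨c, b, rfl⟩ := mem_affLin.1 hy
    obtain ⟨g, rfl⟩ := Submodule.mem_span_singleton.1 hz
    exact ⟨c, b, g, rfl⟩
  · rintro ⟨α, β, γ, rfl⟩
    exact Submodule.mem_sup.2 ⟨_, mem_affLin.2 ⟨α, β, rfl⟩, _,
      Submodule.mem_span_singleton.2 ⟨γ, rfl⟩, rfl⟩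

theorem norm_sq_mem_polys : (fun ξ : Vel => ‖ξ‖ ^ 2) ∈ polys 2 := by
  have e : (fun ξ : Vel => ‖ξ‖ ^ 2) = ∑ i : Fin 3, (fun ξ : Vel =>
      inner ℝ (EuclideanSpace.single i (1 : ℝ)) ξ) * fun ξ : Vel =>
      inner ℝ (EuclideanSpace.single i (1 : ℝ)) ξ := by
    ext ξ
    rw [EuclideanSpace.real_norm_sq_eq]
    simp [EuclideanSpace.inner_single_left, Fin.sum_univ_three, sq]
  rw [e]
  refine Submodule.sum_mem _ fun i _ => ?_
  rw [polys, pow_two]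
  exact Submodule.mul_mem_mul (homLin_le_affLin (inner_mem_homLin _))
    (homLin_le_affLin (inner_mem_homLin _))

theorem polys_one : polys 1 = affLin := pow_one _

theorem invariants_le_polys : invariants ≤ polys 2 := by
  refine sup_le ?_ ?_
  · rw [← polys_one]
    exact polys_mono (by norm_num)
  · rw [Submodule.span_singleton_le_iff_mem]
    exact norm_sq_mem_polys

theorem defect_invariants {p : Vel → ℝ} (hp : p ∈ invariants) (x : Encounter) : defect p x = 0 := by
  obtain ⟨α, β, γ, rfl⟩ := mem_invariants.1 hp
  have h1 := norm_sq_colMap 0 x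
  simp only [sub_zero] at h1
  have h2 : (colMap x).1 + (colMap x).2.1 = x.1 + x.2.1 := by
    simp only [colMap, postVel, postVelStar]
    abel
  have h3 := congrArg (fun y => inner ℝ β y) h2
  simp only [inner_add_right] at h3
  simp only [defect]
  linear_combination h3 + γ * h1

theorem defect_add (p q : Vel → ℝ) (x : Encounter) :
    defect (p + q) x = defect p x + defect q x := by
  simp only [defect, Pi.add_apply]
  ring

/-- Splitting 2eᵢ into the orthogonal vectors eᵢ + eⱼ and eᵢ - eⱼ shows 4h(eᵢ) = 2h(eᵢ) + 2h(eⱼ), so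
h takes one value on the basis; additivity along coordinates finishes. -/
theorem orthogonally_additive_eq {h : Vel → ℝ} (hh : ∀ (t : ℝ) (x : Vel), h (t • x) = t ^ 2 * h x)
    (hadd : ∀ a b : Vel, inner ℝ a b = 0 → h (a + b) = h a + h b) :
    ∃ c : ℝ, h = fun x => c * ‖x‖ ^ 2 := by
  let e : Fin 3 → Vel := fun i => EuclideanSpace.single i (1 : ℝ)
  have hee : ∀ i j, i ≠ j → inner ℝ (e i) (e j) = 0 := by
    intro i j hij
    simp [e, EuclideanSpace.inner_single_left, hij]
  have hii : ∀ i, inner ℝ (e i) (e i) = 1 := by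
    intro i
    simp [e]
  have heq : ∀ i j, i ≠ j → h (e i) = h (e j) := by
    intro i j hij
    have h1 := hadd (e i) (e j) (hee i j hij)
    have h2 := hadd (e i) ((-1 : ℝ) • e j) (by rw [inner_smul_right, hee i j hij, mul_zero])
    have h3 := hadd (e i + e j) (e i + (-1 : ℝ) • e j) (by
      rw [inner_add_left, inner_add_right, inner_add_right, inner_smul_right, inner_smul_right,
        hii, hii, hee i j hij, hee j i hij.symm]
      ring)
    have h4 : e i + e j + (e i + (-1 : ℝ) • e j) = (2 : ℝ) • e i := by
      rw [two_smul, neg_one_smul]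
      abel
    rw [h4, hh, h1, h2, hh] at h3
    linarith
  refine ⟨h (e 0), funext fun x => ?_⟩
  have hx : x = x 0 • e 0 + (x 1 • e 1 + x 2 • e 2) := by
    ext i
    fin_cases i <;> simp [e]
  have h5 := hadd (x 1 • e 1) (x 2 • e 2) (by
    rw [inner_smul_left, inner_smul_right, hee 1 2 (by decide)]; simp)
  have h6 := hadd (x 0 • e 0) (x 1 • e 1 + x 2 • e 2) (by
    rw [inner_add_right, inner_smul_left, inner_smul_right, inner_smul_left, inner_smul_right,
      hee 0 1 (by decide), hee 0 2 (by decide)]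
    simp)
  rw [← hx, h5, hh, hh, hh, ← heq 0 1 (by decide), ← heq 0 2 (by decide)] at h6
  rw [h6, EuclideanSpace.real_norm_sq_eq, Fin.sum_univ_three]
  ring

/-- The affine part is invariant, so the quadratic part h has no defect either. Collisions with a
particle at rest make h additive on orthogonal vectors. -/
theorem mem_invariants_of_defect {p : Vel → ℝ} (hp : p ∈ polys 2) (h0 : ∀ x, defect p x = 0) :
    p ∈ invariants := by
  rw [polys_succ] at hp
  obtain ⟨h, hh, r, hr, rfl⟩ := Submodule.mem_sup.1 hp
  rw [polys_one] at hr
  have hr' : r ∈ invariants := Submodule.mem_sup_left hr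
  have hd : ∀ x, defect h x = 0 := by
    intro x
    have := h0 x
    rwa [defect_add, defect_invariants hr', add_zero] at this
  have hhom := homLin_pow_homogeneous hh
  have h00 : h 0 = 0 := by
    have := hhom 0 0
    simpa using this
  obtain ⟨c, hc⟩ := orthogonally_additive_eq hhom (by
    intro a b hab
    rcases eq_or_ne b 0 with rfl | hb
    · rw [add_zero, h00, add_zero]
    · have hb' : ‖b‖ ≠ 0 := norm_ne_zero_iff.2 hb
      let Ω : Sph := ⟨‖b‖⁻¹ • b, by simp [norm_smul, inv_mul_cancel₀ hb']⟩
      have hP : lineProj Ω (a + b) = b := by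
        have e : (Ω : Vel) = ‖b‖⁻¹ • b := rfl
        rw [lineProj_apply, e, inner_smul_left, inner_add_right, real_inner_comm, hab,
          real_inner_self_eq_norm_sq, smul_smul]
        simp only [zero_add, RCLike.conj_to_real]
        rw [show ‖b‖⁻¹ * ‖b‖ ^ 2 * ‖b‖⁻¹ = 1 by field_simp, one_smul]
      -- With Ω along b, the velocities a + b and 0 become a and b.
      have := hd (a + b, (0, Ω))
      rw [defect, colMap_fst_eq, colMap_snd_eq] at this
      simp only [hP, map_zero, add_zero, sub_zero, h00, add_sub_cancel_right] at this
      linarith)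
  refine Submodule.add_mem _ ?_ hr'
  rw [hc]
  exact mem_invariants.2 ⟨0, 0, c, by ext ξ; simp⟩

/-- `avgOp` on polynomials of degree at most `n`. -/
def avgEnd (u : FluidState) (n : ℕ) : polys n →ₗ[ℝ] polys n where
  toFun p := ⟨avgOp u p, avgOp_mem_polys u p.2⟩
  map_add' p q := by
    refine Subtype.ext (funext fun ξ => ?_)
    change avgOp u (p + q) ξ = avgOp u p ξ + avgOp u q ξ
    simp only [avgOp, defect_add, neg_add]
    exact integral_add (integrable_defect_partner u p.2 ξ) (integrable_defect_partner u q.2 ξ)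
  map_smul' c p := by
    refine Subtype.ext (funext fun ξ => ?_)
    change avgOp u (c • (p : Vel → ℝ)) ξ = c * avgOp u p ξ
    simp only [avgOp]
    rw [← integral_const_mul]
    refine integral_congr_ae (Filter.Eventually.of_forall fun q => ?_)
    simp only [defect, Pi.smul_apply, smul_eq_mul]
    ring

theorem four_mul_eigenvalue (u : FluidState) {n : ℕ} (p : polys n) {μ : ℝ}
    (hμ : ∀ ξ, avgOp u p ξ = μ * (p : Vel → ℝ) ξ) :
    4 * μ * ‖polyLp u n p‖ ^ 2 = ‖defectOp u (polyLp u n p)‖ ^ 2 := by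
  rw [← real_inner_self_eq_norm_sq (defectOp u _), ← inner_defectSq, defectSq_polyLp]
  have : (⟨avgOp u p, avgOp_mem_polys u p.2⟩ : polys n) = μ • p :=
    Subtype.ext (funext fun ξ => hμ ξ)
  rw [this, map_smul, inner_smul_left, inner_smul_left, real_inner_self_eq_norm_sq]
  simp
  ring

/-- The defect of a polynomial is continuous and the law of encounters has full support, so
vanishing almost everywhere is vanishing. -/
theorem eq_zero_of_defectOp (u : FluidState) {n : ℕ} (p : polys n)
    (h : defectOp u (polyLp u n p) = 0) (x : Encounter) : defect p x = 0 := by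
  have h1 : defect p =ᵐ[encounterLaw u] fun _ => (0 : ℝ) := by
    have h2 := coeFn_defectOp u (polyLp u n p)
    rw [h] at h2
    exact ((defect_congr u (coeFn_polyLp u n p)).symm.trans h2.symm).trans (Lp.coeFn_zero _ _ _)
  have hc := continuous_of_mem_polys p.2
  have hcm := continuous_colMap
  have hcd : Continuous (defect p) :=
    (((hc.comp (continuous_fst.comp hcm)).add
      (hc.comp (continuous_fst.comp (continuous_snd.comp hcm)))).sub (hc.comp continuous_fst)).sub
      (hc.comp (continuous_fst.comp continuous_snd))
  have := (Continuous.ae_eq_iff_eq (encounterLaw u) hcd continuous_const).1 h1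
  exact congrFun this x

theorem _root_.Set.Finite.exists_pos_le {S : Set ℝ} (hS : S.Finite) :
    ∃ g : ℝ, 0 < g ∧ ∀ μ ∈ S, 0 < μ → g ≤ μ := by
  induction S, hS using Set.Finite.induction_on with
  | empty => exact ⟨1, one_pos, by simp⟩
  | @insert a S _ _ ih =>
    obtain ⟨g, hg, h⟩ := ih
    rcases le_or_gt a 0 with ha | ha
    · refine ⟨g, hg, ?_⟩
      rintro μ (rfl | hμ) h0
      · linarith
      · exact h μ hμ h0
    · refine ⟨min g a, lt_min hg ha, ?_⟩
      rintro μ (rfl | hμ) h0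
      · exact min_le_right _ _
      · exact (min_le_left _ _).trans (h μ hμ h0)

/-- Degree at least 3 is covered by `sphereGap_le_eigenvalue`. In degree at most 2 there are
finitely many eigenvalues, none is negative, and eigenvalue zero means a vanishing defect. One g
serves all degrees. -/
theorem exists_eigenvalue_gap (u : FluidState) : ∃ g : ℝ, 0 < g ∧ ∀ (n : ℕ) (p : Vel → ℝ),
    p ∈ polys n → p ≠ 0 → ∀ μ : ℝ, (∀ ξ, avgOp u p ξ = μ * p ξ) → p ∈ invariants ∨ g ≤ μ := by
  obtain ⟨g, hg, hfin⟩ := (Module.End.finite_hasEigenvalue (avgEnd u 2)).exists_pos_le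
  refine ⟨min g sphereGap, lt_min hg sphereGap_pos, ?_⟩
  have base : ∀ p : Vel → ℝ, p ∈ polys 2 → p ≠ 0 → ∀ μ : ℝ, (∀ ξ, avgOp u p ξ = μ * p ξ) →
      p ∈ invariants ∨ min g sphereGap ≤ μ := by
    intro p hp h0 μ hμ
    have h4 := four_mul_eigenvalue u ⟨p, hp⟩ hμ
    have hne : polyLp u 2 ⟨p, hp⟩ ≠ 0 := by
      intro h
      have := polyLp_injective u 2 (h.trans (map_zero _).symm)
      exact h0 (congrArg Subtype.val this)
    have hn : 0 < ‖polyLp u 2 ⟨p, hp⟩‖ ^ 2 := by positivity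
    rcases lt_trichotomy μ 0 with h | h | h
    · have := sq_nonneg ‖defectOp u (polyLp u 2 ⟨p, hp⟩)‖
      nlinarith
    · left
      rw [h, mul_zero, zero_mul] at h4
      have h5 : defectOp u (polyLp u 2 ⟨p, hp⟩) = 0 := by
        rw [← norm_eq_zero]
        exact pow_eq_zero_iff two_ne_zero |>.1 h4.symm
      exact mem_invariants_of_defect hp (eq_zero_of_defectOp u ⟨p, hp⟩ h5)
    · right
      refine (min_le_left _ _).trans (hfin μ ?_ h)
      refine Module.End.hasEigenvalue_of_hasEigenvector (x := ⟨p, hp⟩)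
        ⟨Module.End.mem_eigenspace_iff.2 (Subtype.ext (funext hμ)), fun h => h0 ?_⟩
      exact congrArg Subtype.val h
  intro n
  induction n with
  | zero => exact fun p hp => base p (polys_mono (by norm_num) hp)
  | succ n ih =>
    intro p hp h0 μ hμ
    rcases le_or_gt (n + 1) 2 with hn | hn
    · exact base p (polys_mono hn hp) h0 μ hμ
    · rw [polys_succ] at hp
      obtain ⟨h, hh, r, hr, rfl⟩ := Submodule.mem_sup.1 hp
      -- A vanishing leading part means that the degree is lower, and the induction applies.
      rcases eq_or_ne h 0 with rfl | hne
      · rw [zero_add] at h0 hμ ⊢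
        exact ih r hr h0 μ hμ
      · right
        exact (min_le_right _ _).trans (sphereGap_le_eigenvalue u (by omega) hh hne hr hμ)

/-! ### Completeness of the polynomials in L²(M) -/

theorem pow_inner_mem_polys (t : Vel) (n : ℕ) : (fun ξ : Vel => inner ℝ ξ t ^ n) ∈ polys n := by
  have : (fun ξ : Vel => inner ℝ ξ t ^ n) = (fun ξ : Vel => inner ℝ t ξ) ^ n := by
    ext ξ
    rw [Pi.pow_apply, real_inner_comm]
  rw [this]
  exact Submodule.pow_mem_pow _ (homLin_le_affLin (inner_mem_homLin t)) n

theorem integrable_exp_mul (u : FluidState) (φ : GaussL2 u) (c : ℝ) :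
    Integrable (fun ξ => Real.exp (c * ‖ξ‖) * |φ ξ|) (gauss u) := by
  have h1 : MemLp (fun ξ : Vel => Real.exp (c * ‖ξ‖)) 2 (gauss u) := by
    rw [memLp_two_iff_integrable_sq (by fun_prop)]
    have := integrable_exp_gauss u (2 * c)
    refine this.congr (Filter.Eventually.of_forall fun ξ => ?_)
    simp only
    rw [← Real.exp_nat_mul]
    congr 1
    push_cast
    ring
  exact h1.integrable_mul (Lp.memLp φ).abs

/-- Expand the exponential in its power series; every term integrates a polynomial against φ. The
series is dominated by e^{‖t‖‖ξ‖}|φ|, which is integrable because of the Gaussian weight. -/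
theorem integral_char_eq_zero (u : FluidState) (φ : GaussL2 u)
    (h : ∀ (n : ℕ) (p : polys n), inner ℝ (polyLp u n p) φ = 0) (t : Vel) :
    ∫ ξ, Complex.exp (inner ℝ ξ t * Complex.I) * (φ ξ : ℂ) ∂gauss u = 0 := by
  have hsum := hasSum_integral_of_dominated_convergence (μ := gauss u)
    (F := fun (n : ℕ) (ξ : Vel) => (inner ℝ ξ t * Complex.I) ^ n / (n.factorial : ℂ) * (φ ξ : ℂ))
    (f := fun ξ => Complex.exp (inner ℝ ξ t * Complex.I) * (φ ξ : ℂ))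
    (fun (n : ℕ) (ξ : Vel) => (‖t‖ * ‖ξ‖) ^ n / (n.factorial : ℝ) * |φ ξ|) ?_ ?_ ?_ ?_ ?_
  · have hz : ∀ n : ℕ, ∫ ξ, (inner ℝ ξ t * Complex.I) ^ n / (n.factorial : ℂ) * (φ ξ : ℂ) ∂gauss u =
        0 := by
      intro n
      have h1 := h n ⟨_, pow_inner_mem_polys t n⟩
      rw [inner_eq_integral] at h1
      have h2 : ∫ ξ, inner ℝ ξ t ^ n * φ ξ ∂gauss u = 0 := by
        rw [← h1]
        refine integral_congr_ae ?_
        filter_upwards [coeFn_polyLp u n ⟨_, pow_inner_mem_polys t n⟩] with ξ hξ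
        rw [hξ]
      have e : ∀ ξ : Vel, (inner ℝ ξ t * Complex.I) ^ n / (n.factorial : ℂ) * (φ ξ : ℂ) =
          (Complex.I ^ n / (n.factorial : ℂ)) * ((inner ℝ ξ t ^ n * φ ξ : ℝ) : ℂ) := by
        intro ξ
        push_cast
        ring
      simp only [e]
      rw [integral_const_mul, integral_complex_ofReal, h2]
      simp
    simp only [hz] at hsum
    exact hsum.unique hasSum_zero
  · intro n
    have := Lp.aestronglyMeasurable φ
    exact (by fun_prop : Continuous fun ξ : Vel =>
      (inner ℝ ξ t * Complex.I) ^ n / (n.factorial : ℂ)).aestronglyMeasurable.mul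
        (Complex.continuous_ofReal.comp_aestronglyMeasurable this)
  · intro n
    refine Filter.Eventually.of_forall fun ξ => ?_
    rw [norm_mul, norm_div, norm_pow, norm_mul, Complex.norm_I, mul_one, Complex.norm_real,
      Complex.norm_real, Complex.norm_natCast, Real.norm_eq_abs, Real.norm_eq_abs]
    have h1 := abs_real_inner_le_norm ξ t
    rw [mul_comm] at h1
    gcongr
  · refine Filter.Eventually.of_forall fun ξ => ?_
    exact (Real.summable_pow_div_factorial _).mul_right _
  · refine (integrable_exp_mul u φ ‖t‖).congr (Filter.Eventually.of_forall fun ξ => ?_)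
    simp only
    rw [tsum_mul_right, Real.exp_eq_exp_ℝ, NormedSpace.exp_eq_tsum_div]
  · refine Filter.Eventually.of_forall fun ξ => ?_
    have := NormedSpace.expSeries_div_hasSum_exp (𝔸 := ℂ) (inner ℝ ξ t * Complex.I)
    rw [← Complex.exp_eq_exp_ℂ] at this
    exact this.mul_right _

/-- The positive and the negative part of φ define finite measures with the same characteristic
function, hence they are equal. -/
theorem eq_zero_of_orthogonal_polys (u : FluidState) (φ : GaussL2 u)
    (h : ∀ (n : ℕ) (p : polys n), inner ℝ (polyLp u n p) φ = 0) : φ = 0 := by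
  have hφ : Integrable φ (gauss u) := (Lp.memLp φ).integrable (by norm_num)
  have hfin : ∀ ψ : Vel → ℝ, Integrable ψ (gauss u) →
      IsFiniteMeasure ((gauss u).withDensity fun ξ => ENNReal.ofReal (ψ ξ)) := fun ψ hψ =>
    isFiniteMeasure_withDensity_ofReal hψ.2
  have hm := (Lp.stronglyMeasurable φ).measurable
  have f1 := hfin φ hφ
  have f2 := hfin (fun ξ => -φ ξ) hφ.neg
  have hmeas : (gauss u).withDensity (fun ξ => ENNReal.ofReal (φ ξ)) =
      (gauss u).withDensity fun ξ => ENNReal.ofReal (-φ ξ) := by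
    refine Measure.ext_of_charFun (funext fun t => ?_)
    have key := integral_char_eq_zero u φ h t
    have hw : ∀ ψ : Vel → ℝ, Measurable ψ →
        charFun ((gauss u).withDensity fun ξ => ENNReal.ofReal (ψ ξ)) t =
          ∫ ξ, ((max (ψ ξ) 0 : ℝ) : ℂ) * Complex.exp (inner ℝ ξ t * Complex.I) ∂gauss u := by
      intro ψ hψ
      rw [charFun_apply, integral_withDensity_eq_integral_toReal_smul hψ.ennreal_ofReal
        (Filter.Eventually.of_forall fun _ => ENNReal.ofReal_lt_top)]
      refine integral_congr_ae (Filter.Eventually.of_forall fun ξ => ?_)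
      simp only [ENNReal.toReal_ofReal']
      rfl
    rw [hw φ hm, hw (fun ξ => -φ ξ) hm.neg, ← sub_eq_zero]
    have hI : ∀ ψ : Vel → ℝ, Integrable ψ (gauss u) →
        Integrable (fun ξ => ((max (ψ ξ) 0 : ℝ) : ℂ) * Complex.exp (inner ℝ ξ t * Complex.I))
          (gauss u) := by
      intro ψ hψ
      have h1 : Integrable (fun ξ => ((max (ψ ξ) 0 : ℝ) : ℂ)) (gauss u) := hψ.pos_part.ofReal
      refine h1.norm.mono' (h1.aestronglyMeasurable.mul ((by fun_prop : Continuous fun ξ : Vel =>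
        Complex.exp (inner ℝ ξ t * Complex.I)).aestronglyMeasurable))
        (Filter.Eventually.of_forall fun ξ => ?_)
      rw [norm_mul, Complex.norm_exp_ofReal_mul_I, mul_one]
    rw [← integral_sub (hI _ hφ) (hI (fun ξ => -φ ξ) hφ.neg), ← key]
    refine integral_congr_ae (Filter.Eventually.of_forall fun ξ => ?_)
    simp only
    rw [← sub_mul, mul_comm, ← Complex.ofReal_sub]
    congr 2
    rw [max_comm, max_comm (-φ ξ)]
    rcases le_total 0 (φ ξ) with h0 | h0
    · rw [max_eq_right h0, max_eq_left (by linarith), sub_zero]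
    · rw [max_eq_left h0, max_eq_right (by linarith)]
      ring
  have hae := (withDensity_eq_iff_of_sigmaFinite hm.ennreal_ofReal.aemeasurable
    hm.neg.ennreal_ofReal.aemeasurable).1 hmeas
  refine Lp.ext (Filter.EventuallyEq.trans ?_ (Lp.coeFn_zero _ _ _).symm)
  filter_upwards [hae] with ξ hξ
  simp only [Pi.neg_apply] at hξ
  rcases lt_trichotomy (φ ξ) 0 with h0 | h0 | h0
  · rw [ENNReal.ofReal_of_nonpos h0.le, eq_comm, ENNReal.ofReal_eq_zero] at hξ
    linarith
  · exact h0
  · rw [ENNReal.ofReal_of_nonpos (by linarith : -φ ξ ≤ 0), ENNReal.ofReal_eq_zero] at hξ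
    linarith

/-! ### Spectral gap for the constant kernel -/

theorem exists_near_invariant_of_symmetric {E : Type*} [NormedAddCommGroup E] [InnerProductSpace ℝ E]
    [FiniteDimensional ℝ E] {T : E →ₗ[ℝ] E} (hT : T.IsSymmetric) {g : ℝ} (N : Submodule ℝ E)
    (hpos : ∀ x, 0 ≤ inner ℝ (T x) x) (hN : ∀ (x : E) (μ : ℝ), x ≠ 0 → T x = μ • x → x ∈ N ∨ g ≤ μ)
    (x : E) : ∃ y ∈ N, g * ‖x - y‖ ^ 2 ≤ inner ℝ (T x) x := by
  classical
  set b := hT.eigenvectorBasis rfl with hb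
  set ev := hT.eigenvalues rfl with hev
  have hTb : ∀ i, T (b i) = ev i • b i := fun i => hT.apply_eigenvectorBasis rfl i
  have hnn : ∀ i, 0 ≤ ev i := by
    intro i
    have := hpos (b i)
    rw [hTb, inner_smul_left, real_inner_self_eq_norm_sq, b.norm_eq_one] at this
    simpa using this
  have hne : ∀ i, b i ≠ 0 := fun i h => by
    have := b.norm_eq_one i
    rw [h, norm_zero] at this
    norm_num at this
  -- y keeps the components along eigenvectors that lie in N; all others have eigenvalue at least g.
  set c : Fin (Module.finrank ℝ E) → ℝ := fun i => if b i ∈ N then inner ℝ (b i) x else 0 with hc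
  refine ⟨∑ i, c i • b i, Submodule.sum_mem _ fun i _ => ?_, ?_⟩
  · simp only [hc]
    split_ifs with h
    · exact N.smul_mem _ h
    · rw [zero_smul]
      exact N.zero_mem
  · have e1 : ‖x - ∑ i, c i • b i‖ ^ 2 = ∑ i, (inner ℝ (b i) x - c i) ^ 2 := by
      rw [← b.sum_sq_norm_inner_right]
      refine Finset.sum_congr rfl fun i _ => ?_
      rw [inner_sub_right, b.orthonormal.inner_right_fintype, Real.norm_eq_abs, sq_abs]
    have e2 : inner ℝ (T x) x = ∑ i, ev i * inner ℝ (b i) x ^ 2 := by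
      rw [← b.sum_inner_mul_inner]
      refine Finset.sum_congr rfl fun i _ => ?_
      rw [hT x (b i), hTb, inner_smul_right, real_inner_comm]
      ring
    rw [e1, e2, Finset.mul_sum]
    refine Finset.sum_le_sum fun i _ => ?_
    simp only [hc]
    split_ifs with h
    · have := mul_nonneg (hnn i) (sq_nonneg (inner ℝ (b i) x))
      simpa using this
    · rw [sub_zero]
      exact mul_le_mul_of_nonneg_right ((hN (b i) (ev i) (hne i) (hTb i)).resolve_left h) (sq_nonneg _)

/-- The collision invariants in `L²(M)`. -/
def invLp (u : FluidState) : Submodule ℝ (GaussL2 u) :=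
  (invariants.comap (polys 2).subtype).map (polyLp u 2)

instance (u : FluidState) : FiniteDimensional ℝ (invLp u) := by
  unfold invLp
  infer_instance

theorem polyLp_mem_invLp (u : FluidState) {n : ℕ} (p : polys n) (hp : (p : Vel → ℝ) ∈ invariants) :
    polyLp u n p ∈ invLp u :=
  ⟨⟨p, invariants_le_polys hp⟩, hp, rfl⟩

/-- The operator D†D preserves the finite-dimensional space of polynomials of degree at most n and
is diagonalizable there. That g does not depend on n is what allows the passage to the closure. -/
theorem exists_gap_polys (u : FluidState) : ∃ g : ℝ, 0 < g ∧ ∀ (n : ℕ) (p : polys n),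
    g * ‖polyLp u n p - (invLp u).starProjection (polyLp u n p)‖ ^ 2 ≤
      ‖defectOp u (polyLp u n p)‖ ^ 2 := by
  obtain ⟨g, hg, hgap⟩ := exists_eigenvalue_gap u
  refine ⟨4 * g, by positivity, fun n p => ?_⟩
  let V := LinearMap.range (polyLp u n)
  have hV : ∀ v ∈ V, (defectSq u : GaussL2 u →ₗ[ℝ] GaussL2 u) v ∈ V := by
    rintro _ ⟨q, rfl⟩
    change defectSq u (polyLp u n q) ∈ V
    rw [defectSq_polyLp]
    exact V.smul_mem _ ⟨_, rfl⟩
  have hT := (defectSq_isSymmetric u).restrict_invariant hV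
  have hpos : ∀ x : V, 0 ≤ inner ℝ ((defectSq u : GaussL2 u →ₗ[ℝ] GaussL2 u).restrict hV x) x := by
    intro x
    change 0 ≤ inner ℝ (defectSq u (x : GaussL2 u)) (x : GaussL2 u)
    rw [inner_defectSq]
    exact real_inner_self_nonneg
  have hN : ∀ (x : V) (μ : ℝ), x ≠ 0 →
      (defectSq u : GaussL2 u →ₗ[ℝ] GaussL2 u).restrict hV x = μ • x →
      x ∈ (invLp u).comap V.subtype ∨ 4 * g ≤ μ := by
    intro x μ hx hμ
    obtain ⟨_, q, rfl⟩ := x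
    have h1 : defectSq u (polyLp u n q) = μ • polyLp u n q := congrArg Subtype.val hμ
    rw [defectSq_polyLp, ← map_smul, ← map_smul] at h1
    have h2 := polyLp_injective u n h1
    have h3 : ∀ ξ, avgOp u q ξ = (μ / 4) * (q : Vel → ℝ) ξ := by
      intro ξ
      have := congrFun (congrArg Subtype.val h2) ξ
      change 4 * avgOp u q ξ = μ * (q : Vel → ℝ) ξ at this
      linarith
    have h0 : (q : Vel → ℝ) ≠ 0 := by
      intro h
      refine hx (Subtype.ext ?_)
      have : q = 0 := Subtype.ext h
      change polyLp u n q = 0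
      rw [this, map_zero]
    rcases hgap n q q.2 h0 _ h3 with h | h
    · left
      exact polyLp_mem_invLp u q h
    · right
      linarith
  obtain ⟨y, hy, hle⟩ := exists_near_invariant_of_symmetric hT ((invLp u).comap V.subtype) hpos hN
    ⟨polyLp u n p, p, rfl⟩
  -- The orthogonal projection is at least as close as the invariant y found in the
  -- finite-dimensional space.
  have h1 : ‖polyLp u n p - (invLp u).starProjection (polyLp u n p)‖ ≤
      ‖polyLp u n p - (y : GaussL2 u)‖ := by
    rw [Submodule.starProjection_minimal]
    exact ciInf_le ⟨0, by rintro _ ⟨z, rfl⟩; exact norm_nonneg _⟩ (⟨y, hy⟩ : invLp u)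
  have h2 : inner ℝ (defectSq u (polyLp u n p)) (polyLp u n p) =
      ‖defectOp u (polyLp u n p)‖ ^ 2 := by
    rw [inner_defectSq, real_inner_self_eq_norm_sq]
  rw [← h2]
  refine le_trans ?_ hle
  have h3 := pow_le_pow_left₀ (norm_nonneg _) h1 2
  exact mul_le_mul_of_nonneg_left h3 (by positivity)

theorem dense_polys (u : FluidState) :
    Dense {φ : GaussL2 u | ∃ (n : ℕ) (p : polys n), φ = polyLp u n p} := by
  let S : ℕ → Submodule ℝ (GaussL2 u) := fun n => LinearMap.range (polyLp u n)
  have hdir : Directed (· ≤ ·) S := Monotone.directed_le fun m n hmn => by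
    rintro _ ⟨p, rfl⟩
    exact ⟨⟨p, polys_mono hmn p.2⟩, rfl⟩
  have htop : (⨆ n, S n).topologicalClosure = ⊤ := by
    rw [Submodule.topologicalClosure_eq_top_iff, Submodule.eq_bot_iff]
    intro φ hφ
    refine eq_zero_of_orthogonal_polys u φ fun n p => ?_
    exact hφ _ (Submodule.mem_iSup_of_mem n ⟨p, rfl⟩)
  have h1 := Submodule.dense_iff_topologicalClosure_eq_top.2 htop
  refine h1.mono fun φ hφ => ?_
  obtain ⟨n, p, rfl⟩ := (Submodule.mem_iSup_of_directed S hdir).1 hφ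
  exact ⟨n, p, rfl⟩

/-- Both sides are continuous in φ, and polynomials are dense. -/
theorem exists_gap (u : FluidState) : ∃ g : ℝ, 0 < g ∧ ∀ φ : GaussL2 u,
    g * ‖φ - (invLp u).starProjection φ‖ ^ 2 ≤ ‖defectOp u φ‖ ^ 2 := by
  obtain ⟨g, hg, h⟩ := exists_gap_polys u
  refine ⟨g, hg, fun φ => ?_⟩
  refine (dense_polys u).induction (P := fun φ => g * ‖φ - (invLp u).starProjection φ‖ ^ 2 ≤
    ‖defectOp u φ‖ ^ 2) ?_ ?_ φ
  · rintro _ ⟨n, p, rfl⟩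
    exact h n p
  · exact isClosed_le (by fun_prop) (by fun_prop)

/-! ### The hard-sphere law and the quadratic form in ℍ^{1/2} -/

theorem ofReal_mul_inv_area (t : ℝ) :
    ENNReal.ofReal t * (surface Set.univ)⁻¹ = ENNReal.ofReal (t * area⁻¹) := by
  have := area_pos
  rw [ENNReal.ofReal_mul' (by positivity), ENNReal.ofReal_inv_of_pos area_pos, ofReal_area]

/-- The law of encounters weighted with the hard-sphere kernel. -/
def hardSphereLaw (u : FluidState) : Measure Encounter :=
  (encounterLaw u).withDensity fun x => ENNReal.ofReal (kernelB x)

theorem measurable_kernelB_ofReal : Measurable fun x : Encounter => ENNReal.ofReal (kernelB x) :=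
  continuous_kernelB.measurable.ennreal_ofReal

/-- The density of `hardSphereLaw`. -/
def hardSphereDensity (u : FluidState) (x : Encounter) : ℝ :=
  (mass u ^ 2 * area)⁻¹ * (maxwellian u x.1 * maxwellian u x.2.1 * kernelB x)

theorem measurable_hardSphereDensity (u : FluidState) :
    Measurable fun x => ENNReal.ofReal (hardSphereDensity u x) := by
  have h1 := measurable_maxwellian u
  have h2 := continuous_kernelB.measurable
  unfold hardSphereDensity
  fun_prop

theorem hardSphereDensity_nonneg (u : FluidState) (x : Encounter) : 0 ≤ hardSphereDensity u x := by
  have := mass_pos u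
  have := area_pos
  have := maxwellian_pos u x.1
  have := maxwellian_pos u x.2.1
  have := kernelB_nonneg x
  unfold hardSphereDensity
  positivity

theorem hardSphereLaw_eq (u : FluidState) : hardSphereLaw u =
    encounterMeasure.withDensity fun x => ENNReal.ofReal (hardSphereDensity u x) := by
  rw [hardSphereLaw, encounterLaw_eq, ← withDensity_mul _ (measurable_encounterDensity u)
    measurable_kernelB_ofReal]
  congr 1
  ext x
  have := mass_pos u
  have := area_pos
  have := maxwellian_pos u x.1
  have := maxwellian_pos u x.2.1
  rw [Pi.mul_apply, encounterDensity_eq, ofReal_mul_inv_area, ← ENNReal.ofReal_mul (by positivity),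
    hardSphereDensity]
  congr 1
  field_simp

theorem integrable_hardSphereLaw_iff (u : FluidState) (G : Encounter → ℝ) :
    Integrable G (hardSphereLaw u) ↔
      Integrable (fun x => maxwellian u x.1 * maxwellian u x.2.1 * kernelB x * G x)
        encounterMeasure := by
  have h1 := mass_pos u
  have h2 := area_pos
  rw [hardSphereLaw_eq, integrable_withDensity_iff_integrable_smul'
    (measurable_hardSphereDensity u) (Filter.Eventually.of_forall fun _ => ENNReal.ofReal_lt_top)]
  have e : ∀ x, (ENNReal.ofReal (hardSphereDensity u x)).toReal • G x =
      (mass u ^ 2 * area)⁻¹ * (maxwellian u x.1 * maxwellian u x.2.1 * kernelB x * G x) := by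
    intro x
    rw [ENNReal.toReal_ofReal (hardSphereDensity_nonneg u x), hardSphereDensity, smul_eq_mul]
    ring
  simp only [e]
  exact integrable_const_mul_iff (isUnit_iff_ne_zero.2 (by positivity)) _

theorem integral_hardSphereLaw (u : FluidState) (G : Encounter → ℝ) :
    ∫ x, G x ∂hardSphereLaw u = (mass u ^ 2 * area)⁻¹ *
      ∫ x, maxwellian u x.1 * maxwellian u x.2.1 * kernelB x * G x ∂encounterMeasure := by
  rw [hardSphereLaw_eq, integral_withDensity_eq_integral_toReal_smul
    (measurable_hardSphereDensity u) (Filter.Eventually.of_forall fun _ => ENNReal.ofReal_lt_top),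
    ← integral_const_mul]
  refine integral_congr_ae (Filter.Eventually.of_forall fun x => ?_)
  simp only
  rw [ENNReal.toReal_ofReal (hardSphereDensity_nonneg u x), hardSphereDensity, smul_eq_mul]
  ring

theorem swapMap_hardSphereLaw (u : FluidState) :
    MeasurePreserving swapMap (hardSphereLaw u) (hardSphereLaw u) :=
  (swapMap_law u).withDensity_of_invariant measurable_kernelB_ofReal fun x => by
    rw [kernelB_swapMap]

theorem colMap_hardSphereLaw (u : FluidState) :
    MeasurePreserving colMap (hardSphereLaw u) (hardSphereLaw u) :=
  (colMap_law u).withDensity_of_invariant measurable_kernelB_ofReal fun x => by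
    rw [kernelB_colMap]

theorem memLp_defect {μ : Measure Encounter} (hs : MeasurePreserving swapMap μ μ)
    (hc : MeasurePreserving colMap μ μ) {φ : Vel → ℝ} (hφ : MemLp (fun x => φ x.1) 2 μ) :
    MemLp (defect φ) 2 μ := by
  have h := fun {T : Encounter → Encounter} (hT : MeasurePreserving T μ μ) =>
    hφ.comp_measurePreserving hT
  exact (((h hc).add (h (hs.comp hc))).sub hφ).sub (h hs)

/-- The symmetrization of `inner_defectSq_eq` for an arbitrary invariant measure, here needed with
the kernel B included. -/
theorem integral_defect_sq {μ : Measure Encounter} (hs : MeasurePreserving swapMap μ μ)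
    (hc : MeasurePreserving colMap μ μ) {φ : Vel → ℝ} (hφ : MemLp (fun x => φ x.1) 2 μ) :
    ∫ x, defect φ x ^ 2 ∂μ = -4 * ∫ x, defect φ x * φ x.1 ∂μ := by
  have hD := memLp_defect hs hc hφ
  have hψ : ∀ {T : Encounter → Encounter}, MeasurePreserving T μ μ →
      Integrable (fun x => defect φ x * φ (T x).1) μ := fun hT =>
    hD.integrable_mul (hφ.comp_measurePreserving hT)
  have hcomp : ∀ {T : Encounter → Encounter}, MeasurePreserving T μ μ →
      ∫ x, defect φ (T x) * φ (T x).1 ∂μ = ∫ x, defect φ x * φ x.1 ∂μ := by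
    intro T hT
    have h := integral_map (μ := μ) hT.measurable.aemeasurable (f := fun x => defect φ x * φ x.1)
      (by rw [hT.map_eq]; exact (hψ (MeasurePreserving.id _)).aestronglyMeasurable)
    rw [hT.map_eq] at h
    exact h.symm
  have i1 := hψ hc
  have i2 := hψ (hs.comp hc)
  have i3 := hψ (MeasurePreserving.id _)
  have i4 := hψ hs
  have c1 := hcomp hc
  have c2 := hcomp (hs.comp hc)
  have c4 := hcomp hs
  simp only [Function.comp, defect_swapMap, defect_colMap, neg_mul, integral_neg] at c1 c2 c4
  have e : ∫ x, defect φ x ^ 2 ∂μ =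
      ∫ x, ((fun x => defect φ x * φ (colMap x).1) +
        (fun x => defect φ x * φ ((swapMap ∘ colMap) x).1) -
        (fun x => defect φ x * φ (id x).1) - fun x => defect φ x * φ (swapMap x).1) x ∂μ := by
    refine integral_congr_ae (Filter.Eventually.of_forall fun x => ?_)
    simp only [Pi.add_apply, Pi.sub_apply, Function.comp, swapMap, id]
    rw [sq]
    nth_rewrite 2 [defect]
    ring
  rw [e, integral_sub' ((i1.add i2).sub i3) i4, integral_sub' (i1.add i2) i3, integral_add' i1 i2]
  simp only [Function.comp, id]
  linarith

/-- The square of f/M against M M_* B is the frequency term M⁻¹ f² M_* B, which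
`trilinear_integrable` covers. -/
theorem memLp_ratio (u : FluidState) {f : Vel → ℝ} (hf : Measurable f)
    (hnf : nsq u (1 / 2) 0 1 f ≠ ⊤) :
    MemLp (fun x : Encounter => f x.1 / maxwellian u x.1) 2 (hardSphereLaw u) := by
  have hM := measurable_maxwellian u
  have hnM := nsq_maxwellian_ne_top u (s := 1 / 2) (by norm_num) (le_refl (0 : ℝ))
  have j := trilinear_integrable u le_rfl le_rfl (isEncounterSymmetry_id u) hf hM hf hnf hnM hnf
  have hm : Measurable fun x : Encounter => f x.1 / maxwellian u x.1 := by fun_prop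
  rw [memLp_two_iff_integrable_sq hm.aestronglyMeasurable, integrable_hardSphereLaw_iff]
  refine j.congr (Filter.Eventually.of_forall fun x => ?_)
  have := (maxwellian_pos u x.1).ne'
  simp only [weight_half, id]
  field_simp

/-- The linearized H-theorem: writing f = M φ, each product of f with M at one pair of velocities
equals M M_* φ by conservation of energy, so L becomes the defect of φ, and symmetrization gives its
square. -/
theorem neg_pairing_half (u : FluidState) {f : Vel → ℝ} (hf : Measurable f)
    (hnf : nsq u (1 / 2) 0 1 f ≠ ⊤) :
    -pairing u (1 / 2) 0 (linCollision (maxwellian u) f) f = mass u ^ 2 * area / 4 *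
      ∫ x, defect (fun ξ => f ξ / maxwellian u ξ) x ^ 2 ∂hardSphereLaw u := by
  have h1 := mass_pos u
  have h2 := area_pos
  have hM := measurable_maxwellian u
  have hnM := nsq_maxwellian_ne_top u (s := 1 / 2) (by norm_num) (le_refl (0 : ℝ))
  have hcol := isEncounterSymmetry_colMap u
  have hswap := isEncounterSymmetry_swapMap u
  rw [integral_defect_sq (swapMap_hardSphereLaw u) (colMap_hardSphereLaw u)
    (φ := fun ξ => f ξ / maxwellian u ξ) (memLp_ratio u hf hnf), integral_hardSphereLaw,
    pairing_linCollision u le_rfl le_rfl hM hf hnM hnf]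
  have j1 := trilinear_integrable u le_rfl le_rfl (hswap.comp hcol) hf hM hf hnf hnM hnf
  have j2 := trilinear_integrable u le_rfl le_rfl hswap hf hM hf hnf hnM hnf
  have j3 := trilinear_integrable u le_rfl le_rfl hcol hf hM hf hnf hnM hnf
  have j4 := trilinear_integrable u le_rfl le_rfl (isEncounterSymmetry_id u) hf hM hf hnf hnM hnf
  rw [← integral_sub' j1 j2, add_sub_assoc, ← integral_sub' j3 j4,
    ← integral_add' (j1.sub j2) (j3.sub j4)]
  have e : ∀ c : ℝ, mass u ^ 2 * area / 4 * (-4 * ((mass u ^ 2 * area)⁻¹ * c)) = -c := by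
    intro c
    field_simp
  rw [e]
  congr 1
  refine integral_congr_ae (Filter.Eventually.of_forall fun x => ?_)
  have ha := (maxwellian_pos u x.1).ne'
  have hb := (maxwellian_pos u x.2.1).ne'
  have hc := (maxwellian_pos u (colMap x).1).ne'
  have hd := (maxwellian_pos u (colMap x).2.1).ne'
  have hE := maxwellian_colMap u x
  simp only [Pi.add_apply, Pi.sub_apply, weight_half, defect, id, Function.comp, swapMap]
  have k1 : f (colMap x).2.1 * maxwellian u (colMap x).1 =
      maxwellian u x.1 * maxwellian u x.2.1 * (f (colMap x).2.1 / maxwellian u (colMap x).2.1) := by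
    rw [← hE]; field_simp
  have k2 : f (colMap x).1 * maxwellian u (colMap x).2.1 =
      maxwellian u x.1 * maxwellian u x.2.1 * (f (colMap x).1 / maxwellian u (colMap x).1) := by
    rw [← hE]; field_simp
  rw [k1, k2]
  field_simp
  ring

/-! ### Slow encounters and the gap for hard spheres -/

theorem unifSph_band_eq (w : Vel) (δ : ℝ) :
    unifSph {Ω : Sph | |inner ℝ (Ω : Vel) w| < δ} = unifSph {Ω : Sph | ‖w‖ * |(Ω : Vel) 0| < δ} := by
  obtain ⟨T, hT, h⟩ := exists_sphere_rotation w
  have hm : MeasurableSet {Ω : Sph | |inner ℝ (Ω : Vel) w| < δ} :=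
    measurableSet_lt (by fun_prop) measurable_const
  rw [unifSph_eq_smul, Measure.smul_apply, Measure.smul_apply, ← hT.measure_preimage hm.nullMeasurableSet]
  congr 2
  ext Ω
  simp only [Set.preimage_ofPred_eq, Set.mem_ofPred_eq, h, abs_mul, abs_norm]

theorem gauss_ball_le (u : FluidState) (ξ : Vel) (η : ℝ) :
    gauss u (Metric.ball ξ η) ≤
      ENNReal.ofReal (amp u / mass u) * volume (Metric.ball (0 : Vel) η) := by
  rw [gauss, withDensity_apply _ Metric.isOpen_ball.measurableSet]
  calc _ ≤ ∫⁻ _ in Metric.ball ξ η, ENNReal.ofReal (amp u / mass u) := by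
        refine lintegral_mono fun y => ?_
        exact ENNReal.ofReal_le_ofReal
          (div_le_div_of_nonneg_right (maxwellian_le_amp u y) (mass_pos u).le)
    _ = _ := by
        rw [setLIntegral_const, ← Measure.addHaar_ball_center volume ξ η]

-- B is small only if ξ_* is near ξ or Ω is nearly orthogonal to ξ - ξ_*. Both probabilities are
-- small uniformly in ξ, since the density of the Maxwellian is bounded and the law of Ω is rotation
-- invariant.
open Filter Topology in
theorem exists_slow_le (u : FluidState) {ε : ℝ} (hε : 0 < ε) :
    ∃ δ : ℝ, 0 < δ ∧ ∀ ξ : Vel, partnerLaw u {q | kernelB (ξ, q) < δ} ≤ ENNReal.ofReal ε := by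
  have hε' : 0 < ENNReal.ofReal (ε / 2) := by simpa using hε
  have t1 : Tendsto (fun η : ℝ => ENNReal.ofReal (amp u / mass u) * volume (Metric.ball (0 : Vel) η))
      (𝓝[>] 0) (𝓝 0) := by
    have h1 : ∀ η : ℝ, 0 < η → volume (Metric.ball (0 : Vel) η) =
        ENNReal.ofReal (η ^ 3) * volume (Metric.ball (0 : Vel) 1) := by
      intro η hη
      rw [Measure.addHaar_ball_of_pos _ _ hη]
      simp
    have h2 : Tendsto (fun η : ℝ => ENNReal.ofReal (amp u / mass u) *
        (ENNReal.ofReal (η ^ 3) * volume (Metric.ball (0 : Vel) 1))) (𝓝[>] 0)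
        (𝓝 (ENNReal.ofReal (amp u / mass u) * (0 * volume (Metric.ball (0 : Vel) 1)))) := by
      refine ENNReal.Tendsto.const_mul (ENNReal.Tendsto.mul_const ?_
        (Or.inr measure_ball_lt_top.ne)) (Or.inr ENNReal.ofReal_ne_top)
      have : Tendsto (fun η : ℝ => ENNReal.ofReal (η ^ 3)) (𝓝 0) (𝓝 (ENNReal.ofReal (0 ^ 3))) :=
        (ENNReal.continuous_ofReal.comp (continuous_pow 3)).tendsto 0
      simp only [ne_eq, OfNat.ofNat_ne_zero, not_false_eq_true, zero_pow, ENNReal.ofReal_zero] at this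
      exact this.mono_left nhdsWithin_le_nhds
    rw [zero_mul, mul_zero] at h2
    refine h2.congr' ?_
    filter_upwards [self_mem_nhdsWithin] with η hη
    rw [h1 η hη]
  have t2 : Tendsto (fun η : ℝ => unifSph {Ω : Sph | |(Ω : Vel) 0| < η}) (𝓝[>] 0) (𝓝 0) := by
    have := ENNReal.Tendsto.const_mul (a := (surface Set.univ)⁻¹) tendsto_surface_band
      (Or.inr (ENNReal.inv_ne_top.2 surface_univ_ne_zero))
    rw [mul_zero] at this
    refine this.congr fun η => ?_
    rw [unifSph_eq_smul, Measure.smul_apply, smul_eq_mul]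
  obtain ⟨η, hη1, hη0⟩ := ((t1.eventually (eventually_le_nhds hε')).and self_mem_nhdsWithin).exists
  obtain ⟨θ, hθ1, hθ0⟩ := ((t2.eventually (eventually_le_nhds hε')).and self_mem_nhdsWithin).exists
  have hη : 0 < η := hη0
  have hθ : 0 < θ := hθ0
  refine ⟨θ * η, by positivity, fun ξ => ?_⟩
  have hm : MeasurableSet {q : Vel × Sph | kernelB (ξ, q) < θ * η} :=
    measurableSet_lt (continuous_kernelB.measurable.comp measurable_prodMk_left) measurable_const
  have hp : ∀ y : Vel, unifSph (Prod.mk y ⁻¹' {q : Vel × Sph | kernelB (ξ, q) < θ * η}) ≤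
      (Metric.ball ξ η).indicator 1 y + ENNReal.ofReal (ε / 2) := by
    intro y
    by_cases hy : y ∈ Metric.ball ξ η
    · rw [Set.indicator_of_mem hy]
      exact prob_le_one.trans le_self_add
    · rw [Set.indicator_of_notMem hy, zero_add]
      refine le_trans ?_ hθ1
      have e : Prod.mk y ⁻¹' {q : Vel × Sph | kernelB (ξ, q) < θ * η} =
          {Ω : Sph | |inner ℝ (Ω : Vel) (ξ - y)| < θ * η} := rfl
      rw [e, unifSph_band_eq]
      refine measure_mono fun Ω hΩ => ?_
      simp only [Set.mem_ofPred_eq] at hΩ ⊢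
      have h1 : η ≤ ‖ξ - y‖ := by
        rw [Metric.mem_ball, not_lt, dist_comm, dist_eq_norm] at hy
        exact hy
      have h2 := mul_le_mul_of_nonneg_right h1 (abs_nonneg ((Ω : Vel) 0))
      nlinarith
  rw [partnerLaw, Measure.prod_apply hm]
  calc _ ≤ ∫⁻ y, ((Metric.ball ξ η).indicator 1 y + ENNReal.ofReal (ε / 2)) ∂gauss u :=
        lintegral_mono hp
    _ = gauss u (Metric.ball ξ η) + ENNReal.ofReal (ε / 2) := by
        rw [lintegral_add_right _ measurable_const,
          lintegral_indicator_one Metric.isOpen_ball.measurableSet, lintegral_const, measure_univ,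
          mul_one]
    _ ≤ ENNReal.ofReal (ε / 2) + ENNReal.ofReal (ε / 2) :=
        add_le_add ((gauss_ball_le u ξ η).trans hη1) le_rfl
    _ = ENNReal.ofReal ε := by
        rw [← ENNReal.ofReal_add (by positivity) (by positivity), add_halves]

theorem lintegral_sq_eq_norm {α : Type*} [MeasurableSpace α] {μ : Measure α} (h : Lp ℝ 2 μ) :
    ∫⁻ x, ENNReal.ofReal (h x ^ 2) ∂μ = ENNReal.ofReal (‖h‖ ^ 2) := by
  rw [← real_inner_self_eq_norm_sq, inner_eq_integral, ← ofReal_integral_eq_lintegral_ofReal]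
  · simp only [sq]
  · exact (Lp.memLp h).integrable_sq
  · exact Filter.Eventually.of_forall fun x => sq_nonneg _

/-- `4 ψ²` on the set of slow encounters. -/
def slowPart (δ : ℝ) (ψ : Vel → ℝ) (x : Encounter) : ENNReal :=
  {x : Encounter | kernelB x < δ}.indicator (fun x => 4 * ENNReal.ofReal (ψ x.1 ^ 2)) x

theorem measurableSet_slow (δ : ℝ) : MeasurableSet {x : Encounter | kernelB x < δ} :=
  measurableSet_lt continuous_kernelB.measurable measurable_const

theorem measurable_slowPart (δ : ℝ) {ψ : Vel → ℝ} (hψ : Measurable ψ) :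
    Measurable (slowPart δ ψ) :=
  Measurable.indicator (by fun_prop) (measurableSet_slow δ)

theorem lintegral_slowPart_le (u : FluidState) {δ ε : ℝ}
    (h : ∀ ξ : Vel, partnerLaw u {q | kernelB (ξ, q) < δ} ≤ ENNReal.ofReal ε) {ψ : Vel → ℝ}
    (hψ : Measurable ψ) : ∫⁻ x, slowPart δ ψ x ∂encounterLaw u ≤
      4 * ENNReal.ofReal ε * ∫⁻ ξ, ENNReal.ofReal (ψ ξ ^ 2) ∂gauss u := by
  rw [encounterLaw, lintegral_prod _ (measurable_slowPart δ hψ).aemeasurable,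
    ← lintegral_const_mul _ (by fun_prop)]
  refine lintegral_mono fun ξ => ?_
  have hm : MeasurableSet {q : Vel × Sph | kernelB (ξ, q) < δ} :=
    measurableSet_lt (continuous_kernelB.measurable.comp measurable_prodMk_left) measurable_const
  have e : ∀ q, slowPart δ ψ (ξ, q) = {q : Vel × Sph | kernelB (ξ, q) < δ}.indicator
      (fun _ => 4 * ENNReal.ofReal (ψ ξ ^ 2)) q := fun q => rfl
  simp only [e]
  rw [lintegral_indicator_const hm, mul_right_comm]
  exact mul_le_mul_left (mul_le_mul_right (h ξ) _) _

theorem defect_sq_le (φ : Vel → ℝ) (x : Encounter) :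
    defect φ x ^ 2 ≤ 4 * φ x.1 ^ 2 + 4 * φ x.2.1 ^ 2 + 4 * φ (colMap x).1 ^ 2 +
      4 * φ (colMap x).2.1 ^ 2 := by
  simp only [defect]
  generalize φ (colMap x).1 = a
  generalize φ (colMap x).2.1 = b
  generalize φ x.1 = c
  generalize φ x.2.1 = d
  nlinarith [sq_nonneg (a - b), sq_nonneg (a + c), sq_nonneg (a + d), sq_nonneg (b + c),
    sq_nonneg (b + d), sq_nonneg (c - d)]

/-- Where B ≥ δ the defect is paid by B/δ. Elsewhere it is bounded by 4 times the sum of the four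
squares; since B is invariant under the symmetries, each square contributes the same amount, 4ε∫ψ²,
which explains 16. -/
theorem lintegral_defect_le (u : FluidState) {δ ε : ℝ} (hδ : 0 < δ)
    (h : ∀ ξ : Vel, partnerLaw u {q | kernelB (ξ, q) < δ} ≤ ENNReal.ofReal ε) {ψ : Vel → ℝ}
    (hψ : Measurable ψ) : ∫⁻ x, ENNReal.ofReal (defect ψ x ^ 2) ∂encounterLaw u ≤
      ENNReal.ofReal δ⁻¹ * ∫⁻ x, ENNReal.ofReal (defect ψ x ^ 2) ∂hardSphereLaw u +
      16 * ENNReal.ofReal ε * ∫⁻ ξ, ENNReal.ofReal (ψ ξ ^ 2) ∂gauss u := by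
  have hB := continuous_kernelB.measurable
  have hcm := continuous_colMap.measurable
  have hsm := (swapMap_law u).measurable
  have hD : Measurable (defect ψ) :=
    (((hψ.comp (measurable_fst.comp hcm)).add
      (hψ.comp (measurable_fst.comp (measurable_snd.comp hcm)))).sub (hψ.comp measurable_fst)).sub
      (hψ.comp (measurable_fst.comp measurable_snd))
  have hS := measurable_slowPart δ hψ
  have hpt : ∀ x, ENNReal.ofReal (defect ψ x ^ 2) ≤
      ENNReal.ofReal δ⁻¹ * (ENNReal.ofReal (kernelB x) * ENNReal.ofReal (defect ψ x ^ 2)) +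
      (slowPart δ ψ x + (slowPart δ ψ (swapMap x) + (slowPart δ ψ (colMap x) +
        slowPart δ ψ ((swapMap ∘ colMap) x)))) := by
    intro x
    rcases lt_or_ge (kernelB x) δ with hx | hx
    · refine le_trans ?_ le_add_self
      have i1 : x ∈ {x : Encounter | kernelB x < δ} := hx
      have i2 : swapMap x ∈ {x : Encounter | kernelB x < δ} := by
        simpa only [Set.mem_ofPred_eq, kernelB_swapMap] using hx
      have i3 : colMap x ∈ {x : Encounter | kernelB x < δ} := by
        simpa only [Set.mem_ofPred_eq, kernelB_colMap] using hx
      have i4 : (swapMap ∘ colMap) x ∈ {x : Encounter | kernelB x < δ} := by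
        simpa only [Function.comp, Set.mem_ofPred_eq, kernelB_colMap, kernelB_swapMap] using hx
      have four : ∀ t : ℝ, 4 * ENNReal.ofReal t = ENNReal.ofReal (4 * t) := fun t => by
        rw [ENNReal.ofReal_mul (by norm_num), ENNReal.ofReal_ofNat]
      simp only [slowPart, Set.indicator_of_mem i1, Set.indicator_of_mem i2, Set.indicator_of_mem i3,
        Set.indicator_of_mem i4, four]
      rw [← ENNReal.ofReal_add (by positivity) (by positivity),
        ← ENNReal.ofReal_add (by positivity) (by positivity),
        ← ENNReal.ofReal_add (by positivity) (by positivity)]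
      refine ENNReal.ofReal_le_ofReal ((defect_sq_le ψ x).trans (le_of_eq ?_))
      simp only [Function.comp, swapMap]
      ring
    · refine le_trans ?_ le_self_add
      rw [← ENNReal.ofReal_mul (kernelB_nonneg x), ← ENNReal.ofReal_mul (by positivity)]
      refine ENNReal.ofReal_le_ofReal ?_
      rw [← mul_assoc, inv_mul_eq_div]
      exact le_mul_of_one_le_left (sq_nonneg _) ((one_le_div hδ).2 hx)
  have m1 : Measurable fun x => ENNReal.ofReal (kernelB x) * ENNReal.ofReal (defect ψ x ^ 2) := by
    fun_prop
  have key := lintegral_slowPart_le u h hψ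
  have ms : Measurable fun x => slowPart δ ψ (swapMap x) := hS.comp hsm
  have mc : Measurable fun x => slowPart δ ψ (colMap x) := hS.comp hcm
  refine (lintegral_mono hpt).trans ?_
  rw [lintegral_add_left (m1.const_mul _), lintegral_const_mul _ m1,
    lintegral_add_left hS, lintegral_add_left ms, lintegral_add_left mc,
    (swapMap_law u).lintegral_comp hS, (colMap_law u).lintegral_comp hS,
    ((swapMap_law u).comp (colMap_law u)).lintegral_comp hS]
  have m2 : Measurable fun x => ENNReal.ofReal (defect ψ x ^ 2) := by fun_prop
  rw [hardSphereLaw, lintegral_withDensity_eq_lintegral_mul _ measurable_kernelB_ofReal m2]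
  refine add_le_add le_rfl ?_
  refine (add_le_add key (add_le_add key (add_le_add key key))).trans (le_of_eq ?_)
  ring

theorem nsq_half_mul (u : FluidState) (ψ : Vel → ℝ) :
    nsq u (1 / 2) 0 0 (fun ξ => maxwellian u ξ * ψ ξ) =
      ENNReal.ofReal (mass u) * ∫⁻ ξ, ENNReal.ofReal (ψ ξ ^ 2) ∂gauss u := by
  have hm := mass_pos u
  rw [gauss, lintegral_withDensity_eq_lintegral_mul_non_measurable _ (measurable_gaussDensity u)
    (Filter.Eventually.of_forall fun _ => ENNReal.ofReal_lt_top),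
    ← lintegral_const_mul' _ _ ENNReal.ofReal_ne_top, nsq]
  refine lintegral_congr fun ξ => ?_
  have hM := maxwellian_pos u ξ
  rw [Pi.mul_apply, gaussDensity, weight_half, ← ENNReal.ofReal_mul (by positivity),
    ← ENNReal.ofReal_mul (by positivity), ← ENNReal.ofReal_mul (by positivity)]
  congr 1
  rw [zpow_zero]
  field_simp

theorem nsq_congr (u : FluidState) (s lam : ℝ) (k : ℤ) {f g : Vel → ℝ} (h : f =ᵐ[volume] g) :
    nsq u s lam k f = nsq u s lam k g := by
  refine lintegral_congr_ae ?_
  filter_upwards [h] with ξ hξ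
  rw [hξ]

theorem memLp_gauss_of_nsq (u : FluidState) {φ : Vel → ℝ} (hφ : Measurable φ)
    (h : nsq u (1 / 2) 0 0 (fun ξ => maxwellian u ξ * φ ξ) < ⊤) : MemLp φ 2 (gauss u) := by
  have hmass := mass_pos u
  refine ⟨hφ.aestronglyMeasurable, ?_⟩
  rw [nsq_half_mul] at h
  have h2 : ∫⁻ ξ, ENNReal.ofReal (φ ξ ^ 2) ∂gauss u < ⊤ := by
    rcases ENNReal.mul_lt_top_iff.1 h with h | h | h
    · exact h.2
    · rw [ENNReal.ofReal_eq_zero] at h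
      linarith
    · rw [h]
      exact ENNReal.zero_lt_top
  rw [eLpNorm_lt_top_iff_lintegral_rpow_enorm_lt_top (by norm_num) (by norm_num)]
  refine lt_of_le_of_lt (le_of_eq (lintegral_congr fun ξ => ?_)) h2
  rw [Real.enorm_eq_ofReal_abs, ENNReal.toReal_ofNat, ENNReal.rpow_ofNat,
    ← ENNReal.ofReal_pow (abs_nonneg _), sq_abs]

/-- Transfers the gap from classes in L²(M) to functions, with the invariant part removed by a
genuine polynomial q. -/
theorem exists_gap_function (u : FluidState) {g : ℝ} (hgap : ∀ φ : GaussL2 u,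
    g * ‖φ - (invLp u).starProjection φ‖ ^ 2 ≤ ‖defectOp u φ‖ ^ 2) {φ : Vel → ℝ}
    (hL2 : MemLp φ 2 (gauss u)) : ∃ q ∈ invariants, ∃ N D : ℝ, 0 ≤ N ∧ g * N ≤ D ∧ 0 ≤ D ∧
      ∫⁻ ξ, ENNReal.ofReal ((φ ξ - q ξ) ^ 2) ∂gauss u = ENNReal.ofReal N ∧
      ∫⁻ x, ENNReal.ofReal (defect (fun ξ => φ ξ - q ξ) x ^ 2) ∂encounterLaw u =
        ENNReal.ofReal D := by
  obtain ⟨q, hq, hPq⟩ := Submodule.starProjection_apply_mem (invLp u) (hL2.toLp φ)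
  have hΨ : (hL2.toLp φ - (invLp u).starProjection (hL2.toLp φ) : GaussL2 u) =ᵐ[gauss u]
      fun ξ => φ ξ - (q : Vel → ℝ) ξ := by
    rw [← hPq]
    filter_upwards [Lp.coeFn_sub (hL2.toLp φ) (polyLp u 2 q), hL2.coeFn_toLp, coeFn_polyLp u 2 q]
      with ξ h1 h2 h3
    rw [h1, Pi.sub_apply, h2, h3]
  have hPP : (invLp u).starProjection (hL2.toLp φ - (invLp u).starProjection (hL2.toLp φ)) = 0 := by
    rw [map_sub, (invLp u).starProjection_eq_self_iff.2
      (Submodule.starProjection_apply_mem (invLp u) _), sub_self]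
  generalize hL2.toLp φ - (invLp u).starProjection (hL2.toLp φ) = Ψ at hΨ hPP
  have hg := hgap Ψ
  rw [hPP, sub_zero] at hg
  refine ⟨q, hq, ‖Ψ‖ ^ 2, ‖defectOp u Ψ‖ ^ 2, sq_nonneg _, hg, sq_nonneg _, ?_, ?_⟩
  · rw [← lintegral_sq_eq_norm]
    refine lintegral_congr_ae ?_
    filter_upwards [hΨ] with ξ h1
    rw [h1]
  · rw [← lintegral_sq_eq_norm]
    refine lintegral_congr_ae ?_
    filter_upwards [coeFn_defectOp u Ψ, defect_congr u hΨ] with x h1 h2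
    rw [h1, h2]

/-- Slow encounters cost a small multiple of ∫ψ², which the gap for the constant kernel absorbs once
ψ = φ - q has no invariant part. Subtracting q does not change the defect. -/
theorem exists_hardSphere_gap_function (u : FluidState) : ∃ c : ℝ, 0 < c ∧ ∀ φ : Vel → ℝ,
    Measurable φ → MemLp φ 2 (gauss u) → MemLp (fun x : Encounter => φ x.1) 2 (hardSphereLaw u) →
    ∃ q ∈ invariants, ∃ N : ℝ, 0 ≤ N ∧
      ∫⁻ ξ, ENNReal.ofReal ((φ ξ - q ξ) ^ 2) ∂gauss u = ENNReal.ofReal N ∧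
      c * N ≤ ∫ x, defect φ x ^ 2 ∂hardSphereLaw u := by
  obtain ⟨g, hg, hgap⟩ := exists_gap u
  -- 16 · g/32 = g/2, so half of the gap survives.
  obtain ⟨δ, hδ, hslow⟩ := exists_slow_le u (ε := g / 32) (by positivity)
  refine ⟨g / 2 * δ, by positivity, fun φ hφm hL2 hL2' => ?_⟩
  obtain ⟨q, hq, N, D, hN0, hND, hD0, hN, hD⟩ := exists_gap_function u hgap hL2
  have hψm : Measurable fun ξ => φ ξ - q ξ :=
    hφm.sub (continuous_of_mem_polys (invariants_le_polys hq)).measurable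
  have hdef : ∀ x, defect (fun ξ => φ ξ - q ξ) x = defect φ x := by
    intro x
    have h1 := defect_invariants hq x
    simp only [defect] at h1 ⊢
    linarith
  have hHs := memLp_defect (swapMap_hardSphereLaw u) (colMap_hardSphereLaw u) hL2'
  have hH : ∫⁻ x, ENNReal.ofReal (defect (fun ξ => φ ξ - q ξ) x ^ 2) ∂hardSphereLaw u =
      ENNReal.ofReal (∫ x, defect φ x ^ 2 ∂hardSphereLaw u) := by
    simp only [hdef]
    exact (ofReal_integral_eq_lintegral_ofReal hHs.integrable_sq
      (Filter.Eventually.of_forall fun x => sq_nonneg _)).symm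
  have key := lintegral_defect_le u hδ hslow hψm
  have hI : 0 ≤ ∫ x, defect φ x ^ 2 ∂hardSphereLaw u := integral_nonneg fun x => sq_nonneg _
  rw [hD, hN, hH] at key
  generalize ∫ x, defect φ x ^ 2 ∂hardSphereLaw u = I at key hI ⊢
  have sixteen : ∀ t : ℝ, 16 * ENNReal.ofReal t = ENNReal.ofReal (16 * t) := fun t => by
    rw [ENNReal.ofReal_mul (by norm_num), ENNReal.ofReal_ofNat]
  rw [sixteen, ← ENNReal.ofReal_mul (by positivity), ← ENNReal.ofReal_mul (by positivity),
    ← ENNReal.ofReal_add (by positivity) (by positivity), ENNReal.ofReal_le_ofReal_iff (by positivity)]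
    at key
  refine ⟨q, hq, N, hN0, hN, ?_⟩
  have h5 : g / 2 * N ≤ δ⁻¹ * I := by linarith
  rw [inv_mul_eq_div, le_div_iff₀ hδ] at h5
  linarith

/-- The spectral gap of the linearized hard-sphere operator in `ℍ^{1/2}`. -/
theorem exists_hardSphere_gap (u : FluidState) : ∃ c : ℝ, 0 < c ∧ ∀ f : Vel → ℝ, Measurable f →
    nsq u (1 / 2) 0 1 f ≠ ⊤ → ∃ q ∈ invariants,
      nsq u (1 / 2) 0 0 (fun ξ => f ξ - maxwellian u ξ * q ξ) ≠ ⊤ ∧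
      c * (nsq u (1 / 2) 0 0 (fun ξ => f ξ - maxwellian u ξ * q ξ)).toReal ≤
        -pairing u (1 / 2) 0 (linCollision (maxwellian u) f) f := by
  obtain ⟨c, hc, hgap⟩ := exists_hardSphere_gap_function u
  have hmass := mass_pos u
  have harea := area_pos
  refine ⟨c * mass u * area / 4, by positivity, fun f hf hnf => ?_⟩
  have hφm : Measurable fun ξ => f ξ / maxwellian u ξ := hf.div (measurable_maxwellian u)
  have hfφ : ∀ ξ, maxwellian u ξ * (f ξ / maxwellian u ξ) = f ξ := fun ξ =>
    mul_div_cancel₀ _ (maxwellian_pos u ξ).ne'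
  have hL2 := memLp_gauss_of_nsq u hφm (by
    simp only [hfφ]
    exact (nsq_zero_le_one u (1 / 2) le_rfl f).trans_lt hnf.lt_top)
  obtain ⟨q, hq, N, hN0, hN, hle⟩ := hgap _ hφm hL2 (memLp_ratio u hf hnf)
  have hfq : (fun ξ => f ξ - maxwellian u ξ * q ξ) =
      fun ξ => maxwellian u ξ * (f ξ / maxwellian u ξ - q ξ) := by
    funext ξ
    rw [mul_sub, hfφ]
  have e : nsq u (1 / 2) 0 0 (fun ξ => f ξ - maxwellian u ξ * q ξ) = ENNReal.ofReal (mass u * N) := by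
    rw [hfq, nsq_half_mul, hN, ← ENNReal.ofReal_mul hmass.le]
  refine ⟨q, hq, by rw [e]; exact ENNReal.ofReal_ne_top, ?_⟩
  rw [e, ENNReal.toReal_ofReal (by positivity), neg_pairing_half u hf hnf]
  have h7 := mul_le_mul_of_nonneg_left hle (show 0 ≤ mass u ^ 2 * area / 4 by positivity)
  linarith

/-! ### Dual families, perturbed coercivity and the moments -/

/-- The Riesz representatives, in the span, of the coordinate functionals. -/
theorem _root_.LinearIndependent.exists_dual_family {H : Type*} [NormedAddCommGroup H]
    [InnerProductSpace ℝ H] {ι : Type*} [Fintype ι] [DecidableEq ι] {v : ι → H}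
    (hv : LinearIndependent ℝ v) : ∃ d : ι → H, (∀ i, d i ∈ Submodule.span ℝ (Set.range v)) ∧
      ∀ i j, inner ℝ (d i) (v j) = if i = j then 1 else 0 := by
  let b := Module.Basis.span hv
  have : FiniteDimensional ℝ (Submodule.span ℝ (Set.range v)) := b.finiteDimensional_of_finite
  let d : ι → Submodule.span ℝ (Set.range v) := fun i =>
    (InnerProductSpace.toDual ℝ _).symm (LinearMap.toContinuousLinearMap (b.coord i))
  refine ⟨fun i => d i, fun i => (d i).2, fun i j => ?_⟩
  have h1 : inner ℝ (d i) (b j) = b.coord i (b j) := by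
    simp only [d, InnerProductSpace.toDual_symm_apply]
    rfl
  have h2 : ((b j : Submodule.span ℝ (Set.range v)) : H) = v j :=
    congrArg Subtype.val (Module.Basis.span_apply hv j)
  rw [← h2, ← Submodule.coe_inner, h1, Module.Basis.coord_apply, Module.Basis.repr_self]
  simp [Finsupp.single_apply, eq_comm]

/-- With φ = ψ + η, Young's inequality spends half of c‖ψ‖² on the mixed terms, and ‖φ‖² ≤ 2‖ψ‖² +
2‖η‖² turns the other half into c/4 ‖φ‖². -/
theorem exists_coercive_near {H : Type*} [NormedAddCommGroup H] [InnerProductSpace ℝ H]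
    (b : H →L[ℝ] H →L[ℝ] ℝ) (N : Submodule ℝ H) {c : ℝ} (hc : 0 < c)
    (h : ∀ ψ ∈ N, c * ‖ψ‖ ^ 2 ≤ b ψ ψ) : ∃ C : ℝ, 0 ≤ C ∧ ∀ φ : H, ∀ ψ ∈ N,
      c / 4 * ‖φ‖ ^ 2 - C * ‖φ - ψ‖ ^ 2 ≤ b φ φ := by
  set L := ‖b‖ with hL
  have hL0 : 0 ≤ L := norm_nonneg b
  refine ⟨2 * L ^ 2 / c + L + c / 2, by positivity, fun φ ψ hψ => ?_⟩
  obtain ⟨η, rfl⟩ : ∃ η, φ = ψ + η := ⟨φ - ψ, by abel⟩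
  rw [add_sub_cancel_left]
  have e : b (ψ + η) (ψ + η) = b ψ ψ + b ψ η + b η ψ + b η η := by
    simp only [map_add, add_apply]
    ring
  have hb : ∀ x y, -(L * ‖x‖ * ‖y‖) ≤ b x y := fun x y => by
    have := b.le_opNorm₂ x y
    rw [Real.norm_eq_abs] at this
    exact (abs_le.1 this).1
  have h1 := h ψ hψ
  have h2 := hb ψ η
  have h3 := hb η ψ
  have h4 := hb η η
  have h5 := norm_add_le ψ η
  have h6 : ‖ψ + η‖ ^ 2 ≤ 2 * ‖ψ‖ ^ 2 + 2 * ‖η‖ ^ 2 := by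
    have := pow_le_pow_left₀ (norm_nonneg _) h5 2
    nlinarith [sq_nonneg (‖ψ‖ - ‖η‖)]
  have h7 : 2 * (L * ‖ψ‖ * ‖η‖) ≤ c / 2 * ‖ψ‖ ^ 2 + 2 * L ^ 2 / c * ‖η‖ ^ 2 := by
    have := sq_nonneg (c * ‖ψ‖ - 2 * L * ‖η‖)
    rw [show c / 2 * ‖ψ‖ ^ 2 + 2 * L ^ 2 / c * ‖η‖ ^ 2 =
      (c ^ 2 * ‖ψ‖ ^ 2 + 4 * L ^ 2 * ‖η‖ ^ 2) / (2 * c) by field_simp; ring,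
      le_div_iff₀ (by positivity)]
    nlinarith
  rw [e]
  nlinarith

/-- The collision invariants, then the remaining products of them with `ξ₁`. -/
def moments : Fin 9 → Vel → ℝ :=
  ![fun _ => 1, fun ξ => ξ 0, fun ξ => ξ 1, fun ξ => ξ 2, fun ξ => ‖ξ‖ ^ 2,
    fun ξ => ξ 0 * ξ 0, fun ξ => ξ 0 * ξ 1, fun ξ => ξ 0 * ξ 2, fun ξ => ξ 0 * ‖ξ‖ ^ 2]

theorem coord_mem_affLin (i : Fin 3) : (fun ξ : Vel => ξ i) ∈ affLin := by
  have : (fun ξ : Vel => ξ i) = fun ξ : Vel => inner ℝ (EuclideanSpace.single i (1 : ℝ)) ξ := by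
    ext ξ
    simp [EuclideanSpace.inner_single_left]
  rw [this]
  exact homLin_le_affLin (inner_mem_homLin _)

theorem coord_mul_mem_polys {n : ℕ} {p : Vel → ℝ} (hp : p ∈ polys n) (i : Fin 3) :
    (fun ξ : Vel => ξ i * p ξ) ∈ polys (n + 1) := by
  rw [polys, pow_succ']
  exact Submodule.mul_mem_mul (coord_mem_affLin i) hp

theorem coord_mem_polys (i : Fin 3) : (fun ξ : Vel => ξ i) ∈ polys 1 := by
  rw [polys_one]
  exact coord_mem_affLin i

theorem moments_mem (i : Fin 9) : moments i ∈ polys 3 := by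
  have h1 := fun j => polys_mono (show 1 ≤ 3 by norm_num) (coord_mem_polys j)
  have h2 := fun j => polys_mono (show 2 ≤ 3 by norm_num) (coord_mul_mem_polys (coord_mem_polys j) 0)
  have h3 := polys_mono (show 2 ≤ 3 by norm_num) norm_sq_mem_polys
  have h4 := coord_mul_mem_polys norm_sq_mem_polys 0
  fin_cases i
  · exact const_mem_polys 3 1
  · exact h1 0
  · exact h1 1
  · exact h1 2
  · exact h3
  · exact h2 0
  · exact h2 1
  · exact h2 2
  · exact h4

theorem moments_independent {c : Fin 9 → ℝ} (h : ∀ ξ, ∑ i, c i * moments i ξ = 0) : c = 0 := by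
  have key : ∀ x y z : ℝ, c 0 + c 1 * x + c 2 * y + c 3 * z + c 4 * (x ^ 2 + y ^ 2 + z ^ 2) +
      c 5 * (x * x) + c 6 * (x * y) + c 7 * (x * z) + c 8 * (x * (x ^ 2 + y ^ 2 + z ^ 2)) = 0 := by
    intro x y z
    have := h !₂[x, y, z]
    have hn : ‖(!₂[x, y, z] : Vel)‖ ^ 2 = x ^ 2 + y ^ 2 + z ^ 2 := by
      rw [EuclideanSpace.real_norm_sq_eq, Fin.sum_univ_three]
      simp
    simp only [Fin.sum_univ_succ, moments] at this
    simp [hn] at this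
    rw [← this]
    ring
  -- Nine evaluation points for nine unknown coefficients.
  have k0 := key 0 0 0
  have k1 := key 0 1 0
  have k2 := key 0 (-1) 0
  have k3 := key 0 0 1
  have k4 := key 1 0 0
  have k5 := key (-1) 0 0
  have k6 := key 2 0 0
  have k7 := key 1 1 0
  have k8 := key 1 0 1
  norm_num at k0 k1 k2 k3 k4 k5 k6 k7 k8
  funext i
  fin_cases i <;> simp <;> linarith

/-- The moment functions in `L²(M)`. -/
def momentLp (u : FluidState) (i : Fin 9) : GaussL2 u := polyLp u 3 ⟨moments i, moments_mem i⟩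

theorem linearIndependent_momentLp (u : FluidState) : LinearIndependent ℝ (momentLp u) := by
  rw [Fintype.linearIndependent_iff]
  intro c hc i
  have h1 : polyLp u 3 (∑ i, c i • (⟨moments i, moments_mem i⟩ : polys 3)) = polyLp u 3 0 := by
    rw [map_sum, map_zero, ← hc]
    simp only [map_smul, momentLp]
  have h2 := congrArg Subtype.val (polyLp_injective u 3 h1)
  have h3 : c = 0 := moments_independent fun ξ => by
    have := congrFun h2 ξ
    simpa [Submodule.coe_sum, Finset.sum_apply] using this
  rw [h3]
  rfl

/-- The dual vectors lie in the span of the moments, so they are polynomials themselves; this makes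
the compensator bounded on the weighted spaces. -/
theorem exists_dual_moments (u : FluidState) : ∃ d : Fin 9 → polys 3,
    ∀ i j, inner ℝ (polyLp u 3 (d i)) (momentLp u j) = if i = j then 1 else 0 := by
  obtain ⟨d, hd, h⟩ := (linearIndependent_momentLp u).exists_dual_family
  have hle : Submodule.span ℝ (Set.range (momentLp u)) ≤ LinearMap.range (polyLp u 3) := by
    rw [Submodule.span_le]
    rintro _ ⟨i, rfl⟩
    exact ⟨_, rfl⟩
  choose e he using fun i => hle (hd i)
  exact ⟨e, fun i j => by rw [he, h]⟩

/-- The index of the `j`-th collision invariant among the moments. -/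
def lowIndex : Fin 5 → Fin 9 := ![0, 1, 2, 3, 4]

/-- The index of `ξ₁` times the `j`-th collision invariant among the moments. -/
def highIndex : Fin 5 → Fin 9 := ![1, 5, 6, 7, 8]

theorem highIndex_moment (j : Fin 5) (ξ : Vel) :
    moments (highIndex j) ξ = ξ 0 * moments (lowIndex j) ξ := by
  fin_cases j <;> simp [highIndex, lowIndex, moments]

theorem exists_coeff {Q : Vel → ℝ} (hQ : Q ∈ invariants) :
    ∃ a : Fin 5 → ℝ, ∀ ξ, Q ξ = ∑ j, a j * moments (lowIndex j) ξ := by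
  obtain ⟨α, β, γ, rfl⟩ := mem_invariants.1 hQ
  refine ⟨![α, β 0, β 1, β 2, γ], fun ξ => ?_⟩
  have : inner ℝ β ξ = β 0 * ξ 0 + β 1 * ξ 1 + β 2 * ξ 2 := by
    rw [PiLp.inner_apply, Fin.sum_univ_three]
    simp [mul_comm]
  simp only [this, Fin.sum_univ_five]
  simp [lowIndex, moments]
  ring

/-! ### The form of the compensator on collision invariants -/

/-- Multiplication of polynomials by `ξ₁`. -/
def mulCoord {n : ℕ} (p : polys n) : polys (n + 1) :=
  ⟨fun ξ => ξ 0 * (p : Vel → ℝ) ξ, coord_mul_mem_polys p.2 0⟩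

theorem inner_polyLp (u : FluidState) {n : ℕ} (p : polys n) (φ : GaussL2 u) :
    inner ℝ (polyLp u n p) φ = ∫ ξ, (p : Vel → ℝ) ξ * φ ξ ∂gauss u := by
  rw [inner_eq_integral]
  refine integral_congr_ae ?_
  filter_upwards [coeFn_polyLp u n p] with ξ hξ
  rw [hξ]

theorem inner_polyLp_mulCoord (u : FluidState) {m n : ℕ} (p : polys m) (q : polys n) :
    inner ℝ (polyLp u (m + 1) (mulCoord p)) (polyLp u n q) =
      inner ℝ (polyLp u m p) (polyLp u (n + 1) (mulCoord q)) := by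
  rw [inner_polyLp, inner_polyLp]
  refine integral_congr_ae ?_
  filter_upwards [coeFn_polyLp u n q, coeFn_polyLp u (n + 1) (mulCoord q)] with ξ h1 h2
  rw [h1, h2]
  simp only [mulCoord]
  ring

/-- The quadratic form of the compensator, `Σ (p_j ξ₁, φ) (q_j, φ) - (q_j ξ₁, φ) (p_j, φ)`. -/
def compForm (u : FluidState) (p q : Fin 5 → polys 3) : GaussL2 u →L[ℝ] GaussL2 u →L[ℝ] ℝ :=
  ∑ j, ((innerSL ℝ (polyLp u 4 (mulCoord (p j)))).smulRight (innerSL ℝ (polyLp u 3 (q j))) -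
    (innerSL ℝ (polyLp u 4 (mulCoord (q j)))).smulRight (innerSL ℝ (polyLp u 3 (p j))))

theorem compForm_apply (u : FluidState) (p q : Fin 5 → polys 3) (φ ψ : GaussL2 u) :
    compForm u p q φ ψ = ∑ j, (inner ℝ (polyLp u 4 (mulCoord (p j))) φ * inner ℝ (polyLp u 3 (q j)) ψ -
      inner ℝ (polyLp u 4 (mulCoord (q j))) φ * inner ℝ (polyLp u 3 (p j)) ψ) := by
  simp only [compForm, sum_apply, sub_apply, ContinuousLinearMap.smulRight_apply,
    smul_apply, innerSL_apply_apply, smul_eq_mul]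

/-- For Q = Σ aⱼ mⱼ, the function q_j dual to m_j reads aⱼ off Q, and p_j dual to ξ₁m_j reads aⱼ off
ξ₁Q, so the first products sum to Σ aⱼ². The moment ξ₁ belongs to both lists (index 1), but no j has
both factors of the subtracted product nonzero. -/
theorem exists_compensator (u : FluidState) : ∃ (p q : Fin 5 → polys 3) (c : ℝ), 0 < c ∧
    ∀ ψ ∈ invLp u, c * ‖ψ‖ ^ 2 ≤ compForm u p q ψ ψ := by
  obtain ⟨d, hd⟩ := exists_dual_moments u
  set m : ℝ := ∑ j, ‖momentLp u (lowIndex j)‖ ^ 2 with hm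
  have hm0 : 0 ≤ m := Finset.sum_nonneg fun j _ => sq_nonneg _
  refine ⟨fun j => d (highIndex j), fun j => d (lowIndex j), (1 + m)⁻¹, by positivity, ?_⟩
  rintro _ ⟨Q, hQ, rfl⟩
  obtain ⟨a, ha⟩ := exists_coeff hQ
  have e1 : polyLp u 2 Q = ∑ j, a j • momentLp u (lowIndex j) := by
    have : polyLp u 2 Q = polyLp u 3 (∑ j, a j •
        (⟨moments (lowIndex j), moments_mem _⟩ : polys 3)) := by
      have e : ∑ j, a j • (⟨moments (lowIndex j), moments_mem _⟩ : polys 3) =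
          ⟨Q, polys_mono (by norm_num) Q.2⟩ := by
        refine Subtype.ext (funext fun ξ => ?_)
        have := ha ξ
        simp only [Submodule.coe_subtype] at this
        simp [Finset.sum_apply, this]
      rw [e]
      rfl
    rw [this, map_sum]
    simp only [map_smul, momentLp]
  have e2 : polyLp u 3 (mulCoord Q) = ∑ j, a j • momentLp u (highIndex j) := by
    have e : mulCoord Q = ∑ j, a j • (⟨moments (highIndex j), moments_mem _⟩ : polys 3) := by
      refine Subtype.ext (funext fun ξ => ?_)
      have := ha ξ
      simp only [Submodule.coe_subtype] at this
      simp only [mulCoord, Submodule.coe_sum, Submodule.coe_smul, Finset.sum_apply, Pi.smul_apply,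
        smul_eq_mul, this, highIndex_moment, Finset.mul_sum]
      refine Finset.sum_congr rfl fun j _ => by ring
    rw [e, map_sum]
    simp only [map_smul, momentLp]
  have hval : compForm u (fun j => d (highIndex j)) (fun j => d (lowIndex j)) (polyLp u 2 Q)
      (polyLp u 2 Q) = ∑ j, a j ^ 2 := by
    rw [compForm_apply]
    simp only [inner_polyLp_mulCoord]
    rw [e1, e2]
    simp only [Fin.sum_univ_five, inner_add_right, inner_smul_right, hd]
    simp [highIndex, lowIndex]
    ring
  rw [hval, inv_mul_le_iff₀ (by positivity)]
  have h1 : ‖polyLp u 2 Q‖ ≤ ∑ j, |a j| * ‖momentLp u (lowIndex j)‖ := by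
    rw [e1]
    refine (norm_sum_le _ _).trans (le_of_eq (Finset.sum_congr rfl fun j _ => ?_))
    rw [norm_smul, Real.norm_eq_abs]
  have h2 := pow_le_pow_left₀ (norm_nonneg _) h1 2
  have h3 := Finset.sum_mul_sq_le_sq_mul_sq Finset.univ (fun j => |a j|)
    fun j => ‖momentLp u (lowIndex j)‖
  simp only [sq_abs] at h3
  have h4 : 0 ≤ ∑ j, a j ^ 2 := Finset.sum_nonneg fun j _ => sq_nonneg _
  rw [← hm] at h3
  linarith

/-! ### The compensator as an operator on the weighted spaces -/

/-- `∫ ⟨ξ⟩ M p²`. -/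
def polyMoment (u : FluidState) (p : Vel → ℝ) : ENNReal :=
  ∫⁻ ξ, ENNReal.ofReal (japanese ξ * maxwellian u ξ * p ξ ^ 2)

theorem polyMoment_ne_top (u : FluidState) {n : ℕ} {p : Vel → ℝ} (hp : p ∈ polys n) :
    polyMoment u p ≠ ⊤ := by
  obtain ⟨C, hC0, hC⟩ := exists_bound_of_mem_polys hp
  have h1 := ((integrable_pow_gauss u 1 le_rfl (2 * n + 1)).const_mul (C ^ 2))
  rw [integrable_gauss_iff] at h1
  refine (lt_of_le_of_lt (lintegral_mono fun ξ => ENNReal.ofReal_le_ofReal ?_)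
    h1.lintegral_lt_top).ne
  have hM := maxwellian_pos u ξ
  have hJ := japanese_le ξ
  have hp2 : p ξ ^ 2 ≤ (C * (1 + ‖ξ‖) ^ n) ^ 2 := by
    rw [← sq_abs]
    exact pow_le_pow_left₀ (abs_nonneg _) (hC ξ) 2
  have h2 : japanese ξ * p ξ ^ 2 ≤ (1 + ‖ξ‖) * (C * (1 + ‖ξ‖) ^ n) ^ 2 :=
    mul_le_mul hJ hp2 (sq_nonneg _) (by positivity)
  calc japanese ξ * maxwellian u ξ * p ξ ^ 2 = maxwellian u ξ * (japanese ξ * p ξ ^ 2) := by ring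
    _ ≤ maxwellian u ξ * ((1 + ‖ξ‖) * (C * (1 + ‖ξ‖) ^ n) ^ 2) :=
      mul_le_mul_of_nonneg_left h2 hM.le
    _ = _ := by ring

theorem lintegral_poly_mul_sq_le (u : FluidState) {n : ℕ} {p : Vel → ℝ} (hp : p ∈ polys n)
    {f : Vel → ℝ} (hf : AEStronglyMeasurable f volume) :
    (∫⁻ ξ, ENNReal.ofReal |p ξ * f ξ|) ^ 2 ≤ polyMoment u p * nsq u (1 / 2) 0 (-1) f := by
  have hM := measurable_maxwellian u
  have hJ := continuous_japanese.measurable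
  have hpm := (continuous_of_mem_polys hp).measurable
  have h := cauchySchwarz_lintegral volume
    (f := fun ξ => ENNReal.ofReal (√(japanese ξ * maxwellian u ξ) * |p ξ|))
    (g := fun ξ => ENNReal.ofReal ((√(japanese ξ * maxwellian u ξ))⁻¹ * |f ξ|))
    (Measurable.aemeasurable (by fun_prop)) (by
      have h1 : AEMeasurable f volume := hf.aemeasurable
      have h2 : AEMeasurable (fun ξ => (√(japanese ξ * maxwellian u ξ))⁻¹) volume :=
        Measurable.aemeasurable (by fun_prop)
      exact (h2.mul h1.abs).ennreal_ofReal)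
  have hs : ∀ ξ, 0 < √(japanese ξ * maxwellian u ξ) := fun ξ =>
    Real.sqrt_pos.2 (mul_pos (japanese_pos ξ) (maxwellian_pos u ξ))
  have hs2 : ∀ ξ, √(japanese ξ * maxwellian u ξ) ^ 2 = japanese ξ * maxwellian u ξ := fun ξ =>
    Real.sq_sqrt (mul_pos (japanese_pos ξ) (maxwellian_pos u ξ)).le
  have e1 : ∀ ξ, ENNReal.ofReal (√(japanese ξ * maxwellian u ξ) * |p ξ|) *
      ENNReal.ofReal ((√(japanese ξ * maxwellian u ξ))⁻¹ * |f ξ|) = ENNReal.ofReal |p ξ * f ξ| := by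
    intro ξ
    have := hs ξ
    rw [← ENNReal.ofReal_mul (by positivity), abs_mul]
    congr 1
    field_simp
  have e2 : ∀ ξ, ENNReal.ofReal (√(japanese ξ * maxwellian u ξ) * |p ξ|) ^ 2 =
      ENNReal.ofReal (japanese ξ * maxwellian u ξ * p ξ ^ 2) := by
    intro ξ
    rw [← ENNReal.ofReal_pow (by positivity), mul_pow, hs2, sq_abs]
  have e3 : ∀ ξ, ENNReal.ofReal ((√(japanese ξ * maxwellian u ξ))⁻¹ * |f ξ|) ^ 2 =
      ENNReal.ofReal (japanese ξ ^ (-1 : ℤ) * weight u (1 / 2) 0 ξ) * ENNReal.ofReal (f ξ ^ 2) := by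
    intro ξ
    have h1 := japanese_pos ξ
    have h2 := maxwellian_pos u ξ
    rw [← ENNReal.ofReal_pow (by positivity), mul_pow, inv_pow, hs2, sq_abs, weight_half,
      ← ENNReal.ofReal_mul (by positivity), zpow_neg_one, mul_inv]
  simp only [e1, e2, e3] at h
  exact h

theorem _root_.ENNReal.le_rpow_half_mul {x y a : ENNReal} (h : x ^ 2 ≤ a * y ^ 2) :
    x ≤ a ^ (2⁻¹ : ℝ) * y := by
  rw [← ENNReal.rpow_le_rpow_iff (z := 2) (by norm_num), ENNReal.mul_rpow_of_nonneg _ _ (by norm_num),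
    ← ENNReal.rpow_mul]
  simpa using h

theorem lintegral_poly_mul_le (u : FluidState) {n : ℕ} {p : Vel → ℝ} (hp : p ∈ polys n)
    {f : Vel → ℝ} (hf : AEStronglyMeasurable f volume) :
    ∫⁻ ξ, ENNReal.ofReal |p ξ * f ξ| ≤ polyMoment u p ^ (2⁻¹ : ℝ) *
      eLpNorm f 2 (weightMeasure u (1 / 2) 0 (-1)) := by
  have h := lintegral_poly_mul_sq_le u hp hf
  rw [← eLpNorm_sq_eq_nsq] at h
  exact ENNReal.le_rpow_half_mul h

theorem integrable_poly_mul (u : FluidState) {n : ℕ} {p : Vel → ℝ} (hp : p ∈ polys n)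
    {f : Vel → ℝ} (hf : AEStronglyMeasurable f volume) (hn : nsq u (1 / 2) 0 (-1) f ≠ ⊤) :
    Integrable fun ξ => p ξ * f ξ := by
  refine ⟨(continuous_of_mem_polys hp).aestronglyMeasurable.mul hf, ?_⟩
  have h := lintegral_poly_mul_sq_le u hp hf
  have h2 : (∫⁻ ξ, ENNReal.ofReal |p ξ * f ξ|) ^ 2 ≠ ⊤ :=
    ne_top_of_le_ne_top (ENNReal.mul_ne_top (polyMoment_ne_top u hp) hn) h
  rw [Ne, ENNReal.pow_eq_top_iff] at h2
  simp only [ne_eq, OfNat.ofNat_ne_zero, not_false_eq_true, and_true] at h2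
  rw [hasFiniteIntegral_iff_norm]
  simp only [Real.norm_eq_abs]
  exact lt_top_iff_ne_top.2 h2

theorem enorm_integral_poly_mul_le (u : FluidState) {n : ℕ} {p : Vel → ℝ} (hp : p ∈ polys n)
    {f : Vel → ℝ} (hf : AEStronglyMeasurable f volume) :
    ‖∫ ξ, p ξ * f ξ‖ₑ ≤ polyMoment u p ^ (2⁻¹ : ℝ) *
      eLpNorm f 2 (weightMeasure u (1 / 2) 0 (-1)) := by
  refine (enorm_integral_le_lintegral_enorm _).trans (le_trans (le_of_eq ?_)
    (lintegral_poly_mul_le u hp hf))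
  simp only [Real.enorm_eq_ofReal_abs]

theorem nsq_eq_enorm_sq {u : FluidState} {s lam : ℝ} {k : ℤ} (f : WeightedL2 u s lam k) :
    nsq u s lam k f = ‖f‖ₑ ^ 2 := by
  rw [← eLpNorm_sq_eq_nsq, Lp.enorm_def]

theorem nsq_toReal {u : FluidState} {s lam : ℝ} {k : ℤ} (f : WeightedL2 u s lam k) :
    (nsq u s lam k f).toReal = ‖f‖ ^ 2 := by
  rw [nsq_eq_enorm_sq, ENNReal.toReal_pow, toReal_enorm]

theorem nsq_coe_ne_top {u : FluidState} {s lam : ℝ} {k : ℤ} (f : WeightedL2 u s lam k) :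
    nsq u s lam k f ≠ ⊤ := by
  rw [nsq_eq_enorm_sq]
  exact ENNReal.pow_ne_top enorm_ne_top

theorem ae_volume_of_ae_weight {u : FluidState} {s lam : ℝ} (hl : 0 ≤ lam) {k : ℤ} {P : Vel → Prop}
    (h : ∀ᵐ ξ ∂weightMeasure u s lam k, P ξ) : ∀ᵐ ξ, P ξ :=
  (absolutelyContinuous_weightMeasure u s hl k).ae_le h

theorem nsq_half_coe_ne_top {u : FluidState} {s lam : ℝ} (hs : 1 / 2 ≤ s) (hl : 0 ≤ lam) {k : ℤ}
    (f : WeightedL2 u s lam k) : nsq u (1 / 2) 0 k f ≠ ⊤ := by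
  have h := nsq_coe_ne_top f
  refine ne_top_of_le_ne_top ?_ (nsq_half_le u hs hl f)
  finiteness

theorem eLpNorm_half_le {u : FluidState} {s lam : ℝ} (hs : 1 / 2 ≤ s) (hl : 0 ≤ lam) {k : ℤ}
    (f : Vel → ℝ) : eLpNorm f 2 (weightMeasure u (1 / 2) 0 k) ≤
      ENNReal.ofReal (amp u ^ (2 * s - 1)) ^ (2⁻¹ : ℝ) * eLpNorm f 2 (weightMeasure u s lam k) := by
  have h := nsq_half_le u hs hl (k := k) f
  rw [← eLpNorm_sq_eq_nsq, ← eLpNorm_sq_eq_nsq] at h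
  exact ENNReal.le_rpow_half_mul h

/-- The functional `f ↦ ∫ p f` on `⟨ξ⟩^{1/2} ℍ̃^s`. -/
def polyFunctional (u : FluidState) {s lam : ℝ} (hs : 1 / 2 ≤ s) (hl : 0 ≤ lam) {n : ℕ}
    (p : polys n) : WeightedL2 u s lam (-1) →L[ℝ] ℝ :=
  LinearMap.mkContinuous
    { toFun := fun f => ∫ ξ, (p : Vel → ℝ) ξ * f ξ
      map_add' := fun f g => by
        have hi := fun h : WeightedL2 u s lam (-1) => integrable_poly_mul u p.2
          (Lp.stronglyMeasurable h).aestronglyMeasurable (nsq_half_coe_ne_top hs hl h)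
        rw [← integral_add (hi f) (hi g)]
        refine integral_congr_ae ?_
        filter_upwards [ae_volume_of_ae_weight hl (Lp.coeFn_add f g)] with ξ h
        rw [h, Pi.add_apply, mul_add]
      map_smul' := fun c f => by
        rw [RingHom.id_apply, smul_eq_mul, ← integral_const_mul]
        refine integral_congr_ae ?_
        filter_upwards [ae_volume_of_ae_weight hl (Lp.coeFn_smul c f)] with ξ h
        rw [h, Pi.smul_apply, smul_eq_mul]
        ring }
    (polyMoment u p ^ (2⁻¹ : ℝ) * ENNReal.ofReal (amp u ^ (2 * s - 1)) ^ (2⁻¹ : ℝ)).toReal (by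
      intro f
      have h1 := (enorm_integral_poly_mul_le u p.2
        (Lp.stronglyMeasurable f).aestronglyMeasurable).trans
        (mul_le_mul_right (eLpNorm_half_le hs hl f) _)
      rw [← mul_assoc, ← Lp.enorm_def] at h1
      have hT : polyMoment u p ^ (2⁻¹ : ℝ) * ENNReal.ofReal (amp u ^ (2 * s - 1)) ^ (2⁻¹ : ℝ) ≠ ⊤ :=
        ENNReal.mul_ne_top (ENNReal.rpow_ne_top_of_nonneg (by norm_num) (polyMoment_ne_top u p.2))
          (ENNReal.rpow_ne_top_of_nonneg (by norm_num) ENNReal.ofReal_ne_top)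
      have h2 := ENNReal.toReal_mono (ENNReal.mul_ne_top hT enorm_ne_top) h1
      rwa [ENNReal.toReal_mul, toReal_enorm, toReal_enorm] at h2)

theorem polyFunctional_apply (u : FluidState) {s lam : ℝ} (hs : 1 / 2 ≤ s) (hl : 0 ≤ lam) {n : ℕ}
    (p : polys n) (f : WeightedL2 u s lam (-1)) :
    polyFunctional u hs hl p f = ∫ ξ, (p : Vel → ℝ) ξ * f ξ := rfl

theorem inv_weight_le (u : FluidState) {s lam : ℝ} (hs : 1 / 2 ≤ s) (hl : 0 ≤ lam) (ξ : Vel) :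
    (weight u s lam ξ)⁻¹ ≤ amp u ^ (2 * s - 1) * maxwellian u ξ := by
  have hM := maxwellian_pos u ξ
  have h := inv_maxwellian_le u hs ξ
  have hq := Real.rpow_pos_of_pos (amp_pos u) (2 * s - 1)
  have hw := weight_pos u s hl ξ
  rw [inv_le_iff_one_le_mul₀ hw]
  have h1 : (maxwellian u ξ)⁻¹ ≤ amp u ^ (2 * s - 1) * weight u s lam ξ := by
    have : 0 ≤ amp u ^ (2 * s - 1) * (lam * (maxwellian u ξ)⁻¹) := by positivity
    rw [weight, mul_add]
    linarith
  have h2 := mul_le_mul_of_nonneg_right h1 hM.le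
  rw [inv_mul_cancel₀ hM.ne'] at h2
  linarith

theorem nsq_div_weight_le (u : FluidState) {s lam : ℝ} (hs : 1 / 2 ≤ s) (hl : 0 ≤ lam)
    (p : Vel → ℝ) : nsq u s lam 1 (fun ξ => p ξ / weight u s lam ξ) ≤
      ENNReal.ofReal (amp u ^ (2 * s - 1)) * polyMoment u p := by
  have hq := Real.rpow_pos_of_pos (amp_pos u) (2 * s - 1)
  rw [polyMoment, ← lintegral_const_mul' _ _ ENNReal.ofReal_ne_top, nsq]
  refine lintegral_mono fun ξ => ?_
  have hw := weight_pos u s hl ξ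
  have hJ := japanese_pos ξ
  rw [← ENNReal.ofReal_mul (by positivity), ← ENNReal.ofReal_mul hq.le]
  refine ENNReal.ofReal_le_ofReal ?_
  have h := mul_le_mul_of_nonneg_right (inv_weight_le u hs hl ξ)
    (show 0 ≤ japanese ξ * p ξ ^ 2 by positivity)
  calc japanese ξ ^ (1 : ℤ) * weight u s lam ξ * (p ξ / weight u s lam ξ) ^ 2
      = (weight u s lam ξ)⁻¹ * (japanese ξ * p ξ ^ 2) := by
        rw [zpow_one]
        field_simp
    _ ≤ _ := h.trans (le_of_eq (by ring))

theorem memLp_div_weight (u : FluidState) {s lam : ℝ} (hs : 1 / 2 ≤ s) (hl : 0 ≤ lam) {n : ℕ}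
    (p : polys n) :
    MemLp (fun ξ => (p : Vel → ℝ) ξ / weight u s lam ξ) 2 (weightMeasure u s lam 1) := by
  refine ⟨((continuous_of_mem_polys p.2).measurable.div
    (measurable_weight u s lam)).aestronglyMeasurable, ?_⟩
  have h := nsq_div_weight_le u hs hl p
  have h2 : nsq u s lam 1 (fun ξ => (p : Vel → ℝ) ξ / weight u s lam ξ) ≠ ⊤ :=
    ne_top_of_le_ne_top (ENNReal.mul_ne_top ENNReal.ofReal_ne_top (polyMoment_ne_top u p.2)) h
  rw [← eLpNorm_sq_eq_nsq, Ne, ENNReal.pow_eq_top_iff] at h2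
  simp only [ne_eq, OfNat.ofNat_ne_zero, not_false_eq_true, and_true] at h2
  exact lt_top_iff_ne_top.2 h2

/-- The function `p / (M^{-2s} + lam M^{-1})` in `⟨ξ⟩^{-1/2} ℍ̃^s`, which represents `f ↦ ∫ p f`. -/
def polyVector (u : FluidState) {s lam : ℝ} (hs : 1 / 2 ≤ s) (hl : 0 ≤ lam) {n : ℕ} (p : polys n) :
    WeightedL2 u s lam 1 := (memLp_div_weight u hs hl p).toLp _

theorem coeFn_polyVector (u : FluidState) {s lam : ℝ} (hs : 1 / 2 ≤ s) (hl : 0 ≤ lam) {n : ℕ}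
    (p : polys n) : polyVector u hs hl p =ᵐ[volume] fun ξ => (p : Vel → ℝ) ξ / weight u s lam ξ :=
  ae_volume_of_ae_weight hl (MemLp.coeFn_toLp _)

/-- Division by the weight removes both s and lam from the pairing. -/
theorem pairing_polyVector (u : FluidState) {s lam : ℝ} (hs : 1 / 2 ≤ s) (hl : 0 ≤ lam) {n : ℕ}
    (p : polys n) (g : Vel → ℝ) :
    pairing u s lam (polyVector u hs hl p) g = ∫ ξ, (p : Vel → ℝ) ξ * g ξ := by
  refine integral_congr_ae ?_
  filter_upwards [coeFn_polyVector u hs hl p] with ξ hξ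
  have := (weight_pos u s hl ξ).ne'
  rw [hξ]
  field_simp

theorem lintegral_pairing_sq_le (u : FluidState) (s : ℝ) {lam : ℝ} (hl : 0 ≤ lam) {g h : Vel → ℝ}
    (hg : AEStronglyMeasurable g volume) (hh : AEStronglyMeasurable h volume) :
    (∫⁻ ξ, ‖weight u s lam ξ * (g ξ * h ξ)‖ₑ) ^ 2 ≤ nsq u s lam (-1) g * nsq u s lam 1 h := by
  have hJ := continuous_japanese.measurable
  have hw := measurable_weight u s lam
  have hs : ∀ ξ, 0 < √(weight u s lam ξ) := fun ξ => Real.sqrt_pos.2 (weight_pos u s hl ξ)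
  have hj : ∀ ξ, 0 < √(japanese ξ) := fun ξ => Real.sqrt_pos.2 (japanese_pos ξ)
  have hs2 : ∀ ξ, √(weight u s lam ξ) ^ 2 = weight u s lam ξ := fun ξ =>
    Real.sq_sqrt (weight_pos u s hl ξ).le
  have hj2 : ∀ ξ, √(japanese ξ) ^ 2 = japanese ξ := fun ξ => Real.sq_sqrt (japanese_pos ξ).le
  have hm1 : Measurable fun ξ => √(weight u s lam ξ) * (√(japanese ξ))⁻¹ := by fun_prop
  have hm2 : Measurable fun ξ => √(weight u s lam ξ) * √(japanese ξ) := by fun_prop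
  have key := cauchySchwarz_lintegral volume
    (f := fun ξ => ENNReal.ofReal (√(weight u s lam ξ) * (√(japanese ξ))⁻¹ * |g ξ|))
    (g := fun ξ => ENNReal.ofReal (√(weight u s lam ξ) * √(japanese ξ) * |h ξ|))
    (hm1.aemeasurable.mul hg.aemeasurable.abs).ennreal_ofReal
    (hm2.aemeasurable.mul hh.aemeasurable.abs).ennreal_ofReal
  have e1 : ∀ ξ, ENNReal.ofReal (√(weight u s lam ξ) * (√(japanese ξ))⁻¹ * |g ξ|) *
      ENNReal.ofReal (√(weight u s lam ξ) * √(japanese ξ) * |h ξ|) =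
      ‖weight u s lam ξ * (g ξ * h ξ)‖ₑ := by
    intro ξ
    have h1 := hs ξ
    have h2 := hj ξ
    rw [← ENNReal.ofReal_mul (by positivity), Real.enorm_eq_ofReal_abs, abs_mul, abs_mul,
      abs_of_pos (weight_pos u s hl ξ)]
    congr 1
    linear_combination (|g ξ| * |h ξ|) * hs2 ξ +
      √(weight u s lam ξ) ^ 2 * |g ξ| * |h ξ| * inv_mul_cancel₀ h2.ne'
  have e2 : ∀ ξ, ENNReal.ofReal (√(weight u s lam ξ) * (√(japanese ξ))⁻¹ * |g ξ|) ^ 2 =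
      ENNReal.ofReal (japanese ξ ^ (-1 : ℤ) * weight u s lam ξ) * ENNReal.ofReal (g ξ ^ 2) := by
    intro ξ
    have h1 := hs ξ
    have h2 := japanese_pos ξ
    have h3 := weight_pos u s hl ξ
    rw [← ENNReal.ofReal_pow (by positivity), mul_pow, mul_pow, inv_pow, hs2, hj2, sq_abs,
      ← ENNReal.ofReal_mul (by positivity), zpow_neg_one, mul_comm (weight u s lam ξ)]
  have e3 : ∀ ξ, ENNReal.ofReal (√(weight u s lam ξ) * √(japanese ξ) * |h ξ|) ^ 2 =
      ENNReal.ofReal (japanese ξ ^ (1 : ℤ) * weight u s lam ξ) * ENNReal.ofReal (h ξ ^ 2) := by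
    intro ξ
    have h2 := japanese_pos ξ
    have h3 := weight_pos u s hl ξ
    rw [← ENNReal.ofReal_pow (by positivity), mul_pow, mul_pow, hs2, hj2, sq_abs,
      ← ENNReal.ofReal_mul (by positivity), zpow_one, mul_comm (weight u s lam ξ)]
  simp only [e1, e2, e3] at key
  exact key

theorem integrable_pairing (u : FluidState) (s : ℝ) {lam : ℝ} (hl : 0 ≤ lam) {g h : Vel → ℝ}
    (hg : AEStronglyMeasurable g volume) (hh : AEStronglyMeasurable h volume)
    (hng : nsq u s lam (-1) g ≠ ⊤) (hnh : nsq u s lam 1 h ≠ ⊤) :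
    Integrable fun ξ => weight u s lam ξ * (g ξ * h ξ) := by
  refine ⟨(measurable_weight u s lam).aestronglyMeasurable.mul (hg.mul hh), ?_⟩
  have h2 := ne_top_of_le_ne_top (ENNReal.mul_ne_top hng hnh) (lintegral_pairing_sq_le u s hl hg hh)
  rw [Ne, ENNReal.pow_eq_top_iff] at h2
  simp only [ne_eq, OfNat.ofNat_ne_zero, not_false_eq_true, and_true] at h2
  exact lt_top_iff_ne_top.2 h2

theorem abs_pairing_le (u : FluidState) (s : ℝ) {lam : ℝ} (hl : 0 ≤ lam) {g h : Vel → ℝ}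
    (hg : AEStronglyMeasurable g volume) (hh : AEStronglyMeasurable h volume) {A B : ℝ}
    (hA : 0 ≤ A) (hB : 0 ≤ B) (hng : nsq u s lam (-1) g ≤ ENNReal.ofReal (A ^ 2))
    (hnh : nsq u s lam 1 h ≤ ENNReal.ofReal (B ^ 2)) : |pairing u s lam g h| ≤ A * B := by
  have h1 : ‖pairing u s lam g h‖ₑ ^ 2 ≤ ENNReal.ofReal ((A * B) ^ 2) := by
    calc ‖pairing u s lam g h‖ₑ ^ 2 ≤ (∫⁻ ξ, ‖weight u s lam ξ * (g ξ * h ξ)‖ₑ) ^ 2 :=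
          ENNReal.pow_le_pow_left (enorm_integral_le_lintegral_enorm _)
      _ ≤ nsq u s lam (-1) g * nsq u s lam 1 h := lintegral_pairing_sq_le u s hl hg hh
      _ ≤ ENNReal.ofReal (A ^ 2) * ENNReal.ofReal (B ^ 2) := mul_le_mul' hng hnh
      _ = _ := by rw [← ENNReal.ofReal_mul (sq_nonneg _), mul_pow]
  rw [Real.enorm_eq_ofReal_abs, ← ENNReal.ofReal_pow (abs_nonneg _),
    ENNReal.ofReal_le_ofReal_iff (sq_nonneg _)] at h1
  exact abs_le_of_sq_le_sq' (by rwa [sq_abs, ← sq_abs]) (by positivity) |>.2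

theorem pairing_comm (u : FluidState) (s lam : ℝ) (g h : Vel → ℝ) :
    pairing u s lam g h = pairing u s lam h g := by
  simp only [pairing, mul_comm (g _)]

/-- The functional `h ↦ (h, g)` on `⟨ξ⟩^{-1/2} ℍ̃^s`. -/
def pairingFunctional (u : FluidState) (s : ℝ) {lam : ℝ} (hl : 0 ≤ lam) {g : Vel → ℝ}
    (hg : AEStronglyMeasurable g volume) (hng : nsq u s lam (-1) g ≠ ⊤) :
    WeightedL2 u s lam 1 →ₗ[ℝ] ℝ where
  toFun h := pairing u s lam h g
  map_add' h h' := by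
    have hi := fun h : WeightedL2 u s lam 1 => integrable_pairing u s hl hg
      (Lp.stronglyMeasurable h).aestronglyMeasurable hng (nsq_coe_ne_top h)
    simp only [pairing_comm u s lam _ g]
    rw [pairing, pairing, pairing, ← integral_add (hi h) (hi h')]
    refine integral_congr_ae ?_
    filter_upwards [ae_volume_of_ae_weight hl (Lp.coeFn_add h h')] with ξ e
    rw [e, Pi.add_apply]
    ring
  map_smul' c h := by
    rw [RingHom.id_apply, smul_eq_mul, pairing, pairing, ← integral_const_mul]
    refine integral_congr_ae ?_
    filter_upwards [ae_volume_of_ae_weight hl (Lp.coeFn_smul c h)] with ξ e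
    rw [e, Pi.smul_apply, smul_eq_mul]
    ring

/-- The compensator `K f = κ Σ (∫ p_j f) q_j / w - (∫ q_j f) p_j / w`. -/
def compensator (u : FluidState) {s lam : ℝ} (hs : 1 / 2 ≤ s) (hl : 0 ≤ lam) (κ : ℝ)
    (p q : Fin 5 → polys 3) : WeightedL2 u s lam (-1) →L[ℝ] WeightedL2 u s lam 1 :=
  κ • ∑ j, ((polyFunctional u hs hl (p j)).smulRight (polyVector u hs hl (q j)) -
    (polyFunctional u hs hl (q j)).smulRight (polyVector u hs hl (p j)))

theorem compensator_apply (u : FluidState) {s lam : ℝ} (hs : 1 / 2 ≤ s) (hl : 0 ≤ lam) (κ : ℝ)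
    (p q : Fin 5 → polys 3) (f : WeightedL2 u s lam (-1)) :
    compensator u hs hl κ p q f = κ • ∑ j,
      ((∫ ξ, (p j : Vel → ℝ) ξ * f ξ) • polyVector u hs hl (q j) -
        (∫ ξ, (q j : Vel → ℝ) ξ * f ξ) • polyVector u hs hl (p j)) := by
  simp only [compensator, smul_apply, sum_apply, sub_apply, ContinuousLinearMap.smulRight_apply,
    polyFunctional_apply]

theorem finiteDimensional_range_compensator (u : FluidState) {s lam : ℝ} (hs : 1 / 2 ≤ s)
    (hl : 0 ≤ lam) (κ : ℝ) (p q : Fin 5 → polys 3) :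
    FiniteDimensional ℝ (compensator u hs hl κ p q).range := by
  let S : Submodule ℝ (WeightedL2 u s lam 1) :=
    Submodule.span ℝ (Set.range fun j => polyVector u hs hl (p j)) ⊔
      Submodule.span ℝ (Set.range fun j => polyVector u hs hl (q j))
  have : FiniteDimensional ℝ (Submodule.span ℝ (Set.range fun j => polyVector u hs hl (p j))) :=
    FiniteDimensional.span_of_finite ℝ (Set.finite_range _)
  have : FiniteDimensional ℝ (Submodule.span ℝ (Set.range fun j => polyVector u hs hl (q j))) :=
    FiniteDimensional.span_of_finite ℝ (Set.finite_range _)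
  refine Submodule.finiteDimensional_of_le (S₂ := S) ?_
  rintro _ ⟨f, rfl⟩
  change compensator u hs hl κ p q f ∈ S
  rw [compensator_apply]
  refine S.smul_mem _ (S.sum_mem fun j _ => S.sub_mem (S.smul_mem _ ?_) (S.smul_mem _ ?_))
  · exact Submodule.mem_sup_right (Submodule.subset_span ⟨j, rfl⟩)
  · exact Submodule.mem_sup_left (Submodule.subset_span ⟨j, rfl⟩)

theorem pairing_compensator (u : FluidState) {s lam : ℝ} (hs : 1 / 2 ≤ s) (hl : 0 ≤ lam) (κ : ℝ)
    (p q : Fin 5 → polys 3) (f : WeightedL2 u s lam (-1)) {g : Vel → ℝ}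
    (hg : AEStronglyMeasurable g volume) (hng : nsq u s lam (-1) g ≠ ⊤) :
    pairing u s lam (compensator u hs hl κ p q f) g = κ * ∑ j,
      ((∫ ξ, (p j : Vel → ℝ) ξ * f ξ) * (∫ ξ, (q j : Vel → ℝ) ξ * g ξ) -
        (∫ ξ, (q j : Vel → ℝ) ξ * f ξ) * ∫ ξ, (p j : Vel → ℝ) ξ * g ξ) := by
  have h : ∀ n (r : polys n), pairingFunctional u s hl hg hng (polyVector u hs hl r) =
      ∫ ξ, (r : Vel → ℝ) ξ * g ξ := fun n r => pairing_polyVector u hs hl r g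
  change pairingFunctional u s hl hg hng (compensator u hs hl κ p q f) = _
  rw [compensator_apply]
  simp only [map_smul, map_sum, map_sub, h, smul_eq_mul]

theorem compensator_skew (u : FluidState) {s lam : ℝ} (hs : 1 / 2 ≤ s) (hl : 0 ≤ lam) (κ : ℝ)
    (p q : Fin 5 → polys 3) (f g : WeightedL2 u s lam (-1)) :
    pairing u s lam (compensator u hs hl κ p q f) g =
      -pairing u s lam f (compensator u hs hl κ p q g) := by
  rw [pairing_comm u s lam f, pairing_compensator u hs hl κ p q f
      (Lp.stronglyMeasurable g).aestronglyMeasurable (nsq_coe_ne_top g),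
    pairing_compensator u hs hl κ p q g
      (Lp.stronglyMeasurable f).aestronglyMeasurable (nsq_coe_ne_top f), ← mul_neg,
    ← Finset.sum_neg_distrib]
  congr 1
  refine Finset.sum_congr rfl fun j _ => by ring

/-- The property is stable under sums and multiples, so rank-one operators suffice. For these the
functional is already bounded by the ℍ^{1/2} norm, and the vector has finite ℍ^{1/2} norm. -/
theorem exists_half_bound (u : FluidState) {s lam : ℝ} (hs : 1 / 2 ≤ s) (hl : 0 ≤ lam) (κ : ℝ)
    (p q : Fin 5 → polys 3) : ∃ B : ℝ, ∀ f : WeightedL2 u s lam (-1),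
      eLpNorm (compensator u hs hl κ p q f) 2 (weightMeasure u (1 / 2) 0 1) ≤
        ENNReal.ofReal B * eLpNorm f 2 (weightMeasure u (1 / 2) 0 (-1)) := by
  let P : (WeightedL2 u s lam (-1) →L[ℝ] WeightedL2 u s lam 1) → Prop := fun K =>
    ∃ T : ENNReal, T ≠ ⊤ ∧ ∀ f, eLpNorm (K f) 2 (weightMeasure u (1 / 2) 0 1) ≤
      T * eLpNorm f 2 (weightMeasure u (1 / 2) 0 (-1))
  have trans : ∀ {g h : Vel → ℝ}, g =ᵐ[weightMeasure u s lam 1] h →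
      g =ᵐ[weightMeasure u (1 / 2) 0 1] h := fun h =>
    (weightMeasure_absolutelyContinuous u (1 / 2) 0 1).ae_le (ae_volume_of_ae_weight hl h)
  have meas : ∀ h : WeightedL2 u s lam 1,
      AEStronglyMeasurable h (weightMeasure u (1 / 2) 0 1) := fun h =>
    (Lp.stronglyMeasurable h).aestronglyMeasurable
  have hadd : ∀ K K', P K → P K' → P (K + K') := by
    rintro K K' ⟨T, hT, h⟩ ⟨T', hT', h'⟩
    refine ⟨T + T', ENNReal.add_ne_top.2 ⟨hT, hT'⟩, fun f => ?_⟩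
    rw [add_apply, eLpNorm_congr_ae (trans (Lp.coeFn_add _ _)), add_mul]
    exact (eLpNorm_add_le (meas _) (meas _) (by norm_num)).trans (add_le_add (h f) (h' f))
  have hsmul : ∀ (c : ℝ) K, P K → P (c • K) := by
    rintro c K ⟨T, hT, h⟩
    refine ⟨‖c‖ₑ * T, ENNReal.mul_ne_top enorm_ne_top hT, fun f => ?_⟩
    rw [smul_apply, eLpNorm_congr_ae (trans (Lp.coeFn_smul _ _)), eLpNorm_const_smul, mul_assoc]
    exact mul_le_mul_right (h f) _
  have hrank : ∀ (r t : polys 3),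
      P ((polyFunctional u hs hl r).smulRight (polyVector u hs hl t)) := by
    intro r t
    refine ⟨polyMoment u r ^ (2⁻¹ : ℝ) * eLpNorm (polyVector u hs hl t) 2
      (weightMeasure u (1 / 2) 0 1), ENNReal.mul_ne_top
        (ENNReal.rpow_ne_top_of_nonneg (by norm_num) (polyMoment_ne_top u r.2)) ?_, fun f => ?_⟩
    · have h := nsq_half_coe_ne_top hs hl (polyVector u hs hl t)
      rw [← eLpNorm_sq_eq_nsq, Ne, ENNReal.pow_eq_top_iff] at h
      simpa using h
    · rw [ContinuousLinearMap.smulRight_apply, eLpNorm_congr_ae (trans (Lp.coeFn_smul _ _)),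
        eLpNorm_const_smul, mul_right_comm]
      exact mul_le_mul_left (enorm_integral_poly_mul_le u r.2
        (Lp.stronglyMeasurable f).aestronglyMeasurable) _
  have hK : P (compensator u hs hl κ p q) := by
    refine hsmul _ _ (Finset.sum_induction _ P hadd ?_ fun j _ => ?_)
    · refine ⟨0, ENNReal.zero_ne_top, fun f => ?_⟩
      rw [zero_apply, eLpNorm_congr_ae (trans (Lp.coeFn_zero _ _ _)), eLpNorm_zero, zero_mul]
    · have := hadd _ _ (hrank (p j) (q j)) (hsmul (-1) _ (hrank (q j) (p j)))
      rwa [neg_one_smul, ← sub_eq_add_neg] at this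
  obtain ⟨T, hT, h⟩ := hK
  exact ⟨T.toReal, fun f => by rw [ENNReal.ofReal_toReal hT]; exact h f⟩

/-! ### Lower bound of the compensated transport term -/

theorem nsq_half_toReal (u : FluidState) {ψ : Vel → ℝ} {Ψ : GaussL2 u} (h : Ψ =ᵐ[gauss u] ψ) :
    (nsq u (1 / 2) 0 0 fun ξ => maxwellian u ξ * ψ ξ).toReal = mass u * ‖Ψ‖ ^ 2 := by
  have hm := mass_pos u
  have e : ∫⁻ ξ, ENNReal.ofReal (ψ ξ ^ 2) ∂gauss u = ENNReal.ofReal (‖Ψ‖ ^ 2) := by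
    rw [← lintegral_sq_eq_norm]
    refine lintegral_congr_ae ?_
    filter_upwards [h] with ξ hξ
    rw [hξ]
  rw [nsq_half_mul, e, ← ENNReal.ofReal_mul hm.le, ENNReal.toReal_ofReal (by positivity)]

theorem inner_polyLp_ratio (u : FluidState) {n : ℕ} (r : polys n) {f : Vel → ℝ} {Φ : GaussL2 u}
    (h : Φ =ᵐ[gauss u] fun ξ => f ξ / maxwellian u ξ) :
    mass u * inner ℝ (polyLp u n r) Φ = ∫ ξ, (r : Vel → ℝ) ξ * f ξ := by
  have hm := (mass_pos u).ne'
  have e : ∫ ξ, (r : Vel → ℝ) ξ * Φ ξ ∂gauss u =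
      ∫ ξ, (r : Vel → ℝ) ξ * (f ξ / maxwellian u ξ) ∂gauss u := by
    refine integral_congr_ae ?_
    filter_upwards [h] with ξ hξ
    rw [hξ]
  rw [inner_polyLp, e, integral_gauss, mul_inv_cancel_left₀ hm]
  refine integral_congr_ae (Filter.Eventually.of_forall fun ξ => ?_)
  have := (maxwellian_pos u ξ).ne'
  field_simp

theorem coeFn_transport {u : FluidState} {s lam : ℝ} (hl : 0 ≤ lam) (f : WeightedL2 u s lam 1) :
    transport f =ᵐ[volume] fun ξ => ξ 0 * f ξ :=
  ae_volume_of_ae_weight hl (MemLp.coeFn_toLp _)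

theorem nsq_neg_one_le (u : FluidState) (s : ℝ) {lam : ℝ} (hl : 0 ≤ lam) (f : Vel → ℝ) :
    nsq u s lam (-1) f ≤ nsq u s lam 1 f := by
  have := nsq_mono u (s := s) (lam := lam) (s' := s) (lam' := lam) (k := -1) (k' := 1) zero_le_one
    (fun ξ => ?_) f
  · simpa using this
  · have hw := weight_pos u s hl ξ
    have hJ := one_le_japanese ξ
    rw [zpow_neg_one, zpow_one, one_mul]
    exact mul_le_mul_of_nonneg_right ((inv_le_one_of_one_le₀ hJ).trans hJ) hw.le

theorem nsq_neg_one_coe_ne_top {u : FluidState} {s lam : ℝ} (hl : 0 ≤ lam)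
    (f : WeightedL2 u s lam 1) : nsq u s lam (-1) f ≠ ⊤ :=
  ne_top_of_le_ne_top (nsq_coe_ne_top f) (nsq_neg_one_le u s hl f)

/-- With Φ = f/M the left factors are inner products in L²(M), so (KAf, f) is κ times a fixed
bounded form at Φ, and `exists_coercive_near` applies. The constants come before s, lam and κ, which
keeps the later choice of κ and lam free of circularity. -/
theorem exists_compensator_bound (u : FluidState) : ∃ (p q : Fin 5 → polys 3) (c C : ℝ),
    0 < c ∧ 0 ≤ C ∧ ∀ {s lam : ℝ} (hs : 1 / 2 ≤ s) (hl : 0 ≤ lam) {κ : ℝ}, 0 ≤ κ →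
      ∀ (f : WeightedL2 u s lam 1), ∀ Q ∈ invariants,
        κ * (c * (nsq u (1 / 2) 0 0 f).toReal -
          C * (nsq u (1 / 2) 0 0 fun ξ => f ξ - maxwellian u ξ * Q ξ).toReal) ≤
        pairing u s lam (compensator u hs hl κ p q (transport f)) f := by
  obtain ⟨p, q, c₀, hc₀, h₀⟩ := exists_compensator u
  obtain ⟨C₀, hC₀, hnear⟩ := exists_coercive_near (compForm u p q) (invLp u) hc₀ h₀
  have hm := mass_pos u
  refine ⟨p, q, mass u * (c₀ / 4), mass u * C₀, by positivity, by positivity, ?_⟩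
  intro s lam hs hl κ hκ f Q hQ
  have hfm := (Lp.stronglyMeasurable f).measurable
  have hφm : Measurable fun ξ => f ξ / maxwellian u ξ := hfm.div (measurable_maxwellian u)
  have hfφ : ∀ ξ, maxwellian u ξ * (f ξ / maxwellian u ξ) = f ξ := fun ξ =>
    mul_div_cancel₀ _ (maxwellian_pos u ξ).ne'
  have hL2 := memLp_gauss_of_nsq u hφm (by
    simp only [hfφ]
    exact (nsq_zero_le_one u (1 / 2) le_rfl f).trans_lt (nsq_half_coe_ne_top hs hl f).lt_top)
  set Φ : GaussL2 u := hL2.toLp _ with hΦ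
  have hΦe : Φ =ᵐ[gauss u] fun ξ => f ξ / maxwellian u ξ := hL2.coeFn_toLp
  have hψ : (Φ - polyLp u 2 ⟨Q, invariants_le_polys hQ⟩ : GaussL2 u) =ᵐ[gauss u]
      fun ξ => f ξ / maxwellian u ξ - Q ξ := by
    filter_upwards [Lp.coeFn_sub Φ (polyLp u 2 ⟨Q, invariants_le_polys hQ⟩), hΦe,
      coeFn_polyLp u 2 ⟨Q, invariants_le_polys hQ⟩] with ξ h1 h2 h3
    rw [h1, Pi.sub_apply, h2, h3]
  have n1 := nsq_half_toReal u hΦe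
  have n2 := nsq_half_toReal u hψ
  simp only [mul_sub, hfφ] at n1 n2
  have key := hnear Φ _ (polyLp_mem_invLp u ⟨Q, invariants_le_polys hQ⟩ hQ)
  have hT : ∀ r : polys 3, ∫ ξ, (r : Vel → ℝ) ξ * transport f ξ =
      mass u * inner ℝ (polyLp u 4 (mulCoord r)) Φ := by
    intro r
    rw [inner_polyLp_ratio u (mulCoord r) hΦe]
    refine integral_congr_ae ?_
    filter_upwards [coeFn_transport hl f] with ξ hξ
    rw [hξ]
    simp only [mulCoord]
    ring
  have hE : pairing u s lam (compensator u hs hl κ p q (transport f)) f =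
      κ * (mass u ^ 2 * compForm u p q Φ Φ) := by
    rw [pairing_compensator u hs hl κ p q _ hfm.aestronglyMeasurable (nsq_neg_one_coe_ne_top hl f),
      compForm_apply]
    congr 1
    rw [Finset.mul_sum]
    refine Finset.sum_congr rfl fun j _ => ?_
    rw [hT, hT, ← inner_polyLp_ratio u (q j) hΦe, ← inner_polyLp_ratio u (p j) hΦe]
    ring
  rw [hE, n1, n2]
  refine mul_le_mul_of_nonneg_left ?_ hκ
  have := mul_le_mul_of_nonneg_left key (sq_nonneg (mass u))
  linarith

/-! ### Sum of the three lower bounds -/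

theorem nsq_lam_eq (u : FluidState) {s lam : ℝ} (hl : 0 ≤ lam) (k : ℤ) {f : Vel → ℝ}
    (hf : Measurable f) :
    nsq u s lam k f = nsq u s 0 k f + ENNReal.ofReal lam * nsq u (1 / 2) 0 k f := by
  have hd := measurable_density u s 0 k
  unfold nsq
  rw [← lintegral_const_mul' _ _ ENNReal.ofReal_ne_top, ← lintegral_add_left (by fun_prop)]
  refine lintegral_congr fun ξ => ?_
  have hJ := zpow_pos (japanese_pos ξ) k
  have hM := maxwellian_pos u ξ
  have hw := weight_pos u s le_rfl ξ
  rw [← mul_assoc, ← add_mul, weight_half, ← ENNReal.ofReal_mul hl,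
    ← ENNReal.ofReal_add (by positivity) (by positivity)]
  congr 2
  rw [weight_zero, weight]
  ring

theorem integrable_linCollision (u : FluidState) {s lam : ℝ} (hs : 1 / 2 ≤ s) (hl : 0 ≤ lam)
    {a f : Vel → ℝ} (ha : Measurable a) (hf : Measurable f)
    (hna : nsq u s lam 1 a ≠ ⊤) (hnf : nsq u s lam 1 f ≠ ⊤) :
    Integrable fun ξ => weight u s lam ξ * (linCollision a f ξ * f ξ) := by
  refine ((pairing_collision u hs hl ha hf hf hna hnf hnf).1.add
    (pairing_collision u hs hl hf ha hf hnf hna hnf).1).congr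
    (Filter.Eventually.of_forall fun ξ => ?_)
  simp only [Pi.add_apply, linCollision]
  ring

theorem pairing_lam_eq (u : FluidState) {s lam : ℝ} {g f : Vel → ℝ}
    (h1 : Integrable fun ξ => weight u s 0 ξ * (g ξ * f ξ))
    (h2 : Integrable fun ξ => weight u (1 / 2) 0 ξ * (g ξ * f ξ)) :
    pairing u s lam g f = pairing u s 0 g f + lam * pairing u (1 / 2) 0 g f := by
  unfold pairing
  rw [← integral_const_mul, ← integral_add h1 (h2.const_mul lam)]
  refine integral_congr_ae (Filter.Eventually.of_forall fun ξ => ?_)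
  have e : weight u s lam ξ = weight u s 0 ξ + lam * weight u (1 / 2) 0 ξ := by
    rw [weight_half, weight_zero, weight]
  simp only [e]
  ring

/-- Coercivity of the compensated operator at the Maxwellian. -/
theorem exists_lower_bound (u : FluidState) {s : ℝ} (hs : 1 / 2 ≤ s) (hs' : s < 1) :
    ∃ (c lam κ : ℝ) (hl : 0 ≤ lam) (p q : Fin 5 → polys 3), 0 < c ∧
      ∀ f : WeightedL2 u s lam 1, c * ‖f‖ ^ 2 ≤
        pairing u s lam (compensator u hs hl κ p q (transport f)) f -
          pairing u s lam (linCollision (maxwellian u) f) f := by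
  obtain ⟨c₁, C₂, hc₁, hC₂, hco⟩ := exists_coercive u hs hs'
  obtain ⟨c₃, hc₃, hgap⟩ := exists_hardSphere_gap u
  obtain ⟨p, q, c₄, C₄, hc₄, hC₄, hcomp⟩ := exists_compensator_bound u
  -- The compensator has to cancel the deficit C₂‖f‖²_{1/2} of the coercivity estimate.
  set κ : ℝ := C₂ / c₄ with hκ
  have hκ0 : 0 ≤ κ := by positivity
  -- The gap in ℍ^{1/2}, taken lam times, has to cancel the error κ C₄ of the compensator off the
  -- invariants.
  set lam : ℝ := κ * C₄ / c₃ with hlam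
  have hl : 0 ≤ lam := by positivity
  have hA := Real.rpow_pos_of_pos (amp_pos u) (2 * s - 1)
  -- The denominator compares the full norm with its M^{-2s} part, through M^{-1} ≤ amp^{2s-1}
  -- M^{-2s}.
  refine ⟨c₁ / (1 + lam * amp u ^ (2 * s - 1)), lam, κ, hl, p, q, by positivity, fun f => ?_⟩
  have hfm := (Lp.stronglyMeasurable f).measurable
  have hM := measurable_maxwellian u
  have hnf := nsq_coe_ne_top f
  have hnh := nsq_half_coe_ne_top hs hl f
  have hsum := nsq_lam_eq u (s := s) hl 1 hfm
  have hn0 : nsq u s 0 1 f ≠ ⊤ := by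
    refine ne_top_of_le_ne_top hnf ?_
    rw [hsum]
    exact le_self_add
  have hnorm : ‖f‖ ^ 2 ≤ (1 + lam * amp u ^ (2 * s - 1)) * (nsq u s 0 1 f).toReal := by
    have h1 : nsq u (1 / 2) 0 1 f ≤ ENNReal.ofReal (amp u ^ (2 * s - 1)) * nsq u s 0 1 f :=
      nsq_half_le u hs le_rfl f
    have h2 := ENNReal.toReal_mono (ENNReal.mul_ne_top ENNReal.ofReal_ne_top hn0) h1
    rw [ENNReal.toReal_mul, ENNReal.toReal_ofReal hA.le] at h2
    rw [← nsq_toReal, hsum, ENNReal.toReal_add hn0 (ENNReal.mul_ne_top ENNReal.ofReal_ne_top hnh),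
      ENNReal.toReal_mul, ENNReal.toReal_ofReal hl]
    have := mul_le_mul_of_nonneg_left h2 hl
    linarith
  obtain ⟨Q, hQ, -, hg⟩ := hgap f hfm hnh
  have h1 := hco f hfm hn0
  have h2 := hcomp hs hl hκ0 f Q hQ
  have i1 := integrable_linCollision u hs le_rfl hM hfm
    (nsq_maxwellian_ne_top u hs' (le_refl (0 : ℝ))) hn0
  have i2 := integrable_linCollision u le_rfl le_rfl hM hfm
    (nsq_maxwellian_ne_top u (by norm_num) (le_refl (0 : ℝ))) hnh
  have h3 := pairing_lam_eq u (lam := lam) i1 i2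
  have h4 := mul_le_mul_of_nonneg_left hg hl
  have e1 : κ * c₄ = C₂ := by rw [hκ]; field_simp
  have e2 : lam * c₃ = κ * C₄ := by rw [hlam]; field_simp
  have h5 : c₁ / (1 + lam * amp u ^ (2 * s - 1)) * ‖f‖ ^ 2 ≤ c₁ * (nsq u s 0 1 f).toReal := by
    rw [div_mul_eq_mul_div, div_le_iff₀ (by positivity)]
    have := mul_le_mul_of_nonneg_left hnorm hc₁.le
    linarith
  rw [h3]
  refine h5.trans ?_
  have e3 : κ * (c₄ * (nsq u (1 / 2) 0 0 f).toReal -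
      C₄ * (nsq u (1 / 2) 0 0 fun ξ => f ξ - maxwellian u ξ * Q ξ).toReal) =
      C₂ * (nsq u (1 / 2) 0 0 f).toReal -
      lam * (c₃ * (nsq u (1 / 2) 0 0 fun ξ => f ξ - maxwellian u ξ * Q ξ).toReal) := by
    rw [← e1, mul_sub, ← mul_assoc, ← mul_assoc, ← mul_assoc lam, e2]
  rw [e3] at h2
  linarith

/-! ### Stability under perturbation of the state -/

/-- A given a is measurable only up to a null set, while the estimates above ask for a measurable
function. -/
theorem KawashimaEstimate.congr {u : FluidState} {s lam : ℝ}
    {K : WeightedL2 u s lam (-1) →L[ℝ] WeightedL2 u s lam 1} {c C : ℝ} {a a' : Vel → ℝ}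
    (h : KawashimaEstimate u s lam K c C a') (ha : a =ᵐ[volume] a') :
    KawashimaEstimate u s lam K c C a := by
  intro f
  obtain ⟨h1, h2, h3, h4⟩ := h f
  have hff : (f : Vel → ℝ) =ᵐ[volume] f := Filter.EventuallyEq.rfl
  have hlin : linCollision a f =ᵐ[volume] linCollision a' f := by
    filter_upwards [collision_congr ha hff, collision_congr hff ha] with ξ e1 e2
    rw [linCollision, linCollision, e1, e2]
  have hp : pairing u s lam (fun ξ => K (transport f) ξ - linCollision a f ξ) f =
      pairing u s lam (fun ξ => K (transport f) ξ - linCollision a' f ξ) f := by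
    refine integral_congr_ae ?_
    filter_upwards [hlin] with ξ e
    rw [e]
  refine ⟨?_, ?_, hp ▸ h3, hp ▸ h4⟩
  · filter_upwards [h1, collisionIntegrand_congr ha hff, collisionIntegrand_congr hff ha]
      with ξ e1 e2 e3
    exact ⟨e1.1.congr e2.symm, e1.2.congr e3.symm⟩
  · exact (memLp_congr_ae ((weightMeasure_absolutelyContinuous u s lam (-1)).ae_le hlin)).2 h2

/-- The constant in the bound of the collision operator. -/
def collisionConst (u : FluidState) (s lam : ℝ) : ℝ := √(4 * bilinearConst u s lam)

theorem collisionConst_sq (u : FluidState) (s : ℝ) {lam : ℝ} (hl : 0 ≤ lam) :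
    collisionConst u s lam ^ 2 = 4 * bilinearConst u s lam := by
  have := bilinearConst_nonneg u s hl
  exact Real.sq_sqrt (by positivity)

theorem collisionConst_nonneg (u : FluidState) (s lam : ℝ) : 0 ≤ collisionConst u s lam :=
  Real.sqrt_nonneg _

theorem nsq_collision_le_sq (u : FluidState) {s lam : ℝ} (hs : 1 / 2 ≤ s) (hl : 0 ≤ lam)
    {a f : Vel → ℝ} (ha : Measurable a) (hf : Measurable f) {A B : ℝ}
    (hna : nsq u s lam 1 a ≤ ENNReal.ofReal (A ^ 2)) (hnf : nsq u s lam 1 f ≤ ENNReal.ofReal (B ^ 2)) :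
    nsq u s lam (-1) (collision a f) ≤ ENNReal.ofReal ((collisionConst u s lam * A * B) ^ 2) := by
  refine (nsq_collision_le u hs hl ha hf).trans ?_
  rw [mul_pow, mul_pow, collisionConst_sq u s hl, ENNReal.ofReal_mul' (sq_nonneg _),
    ENNReal.ofReal_mul' (sq_nonneg _)]
  gcongr

theorem abs_pairing_linCollision_le (u : FluidState) {s lam : ℝ} (hs : 1 / 2 ≤ s) (hl : 0 ≤ lam)
    {a f : Vel → ℝ} (ha : Measurable a) (hf : Measurable f) {A B : ℝ} (hA : 0 ≤ A) (hB : 0 ≤ B)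
    (hna : nsq u s lam 1 a ≤ ENNReal.ofReal (A ^ 2)) (hnf : nsq u s lam 1 f ≤ ENNReal.ofReal (B ^ 2)) :
    |pairing u s lam (linCollision a f) f| ≤ 2 * collisionConst u s lam * A * B ^ 2 := by
  have hL := collisionConst_nonneg u s lam
  have ta : nsq u s lam 1 a ≠ ⊤ := ne_top_of_le_ne_top ENNReal.ofReal_ne_top hna
  have tf : nsq u s lam 1 f ≠ ⊤ := ne_top_of_le_ne_top ENNReal.ofReal_ne_top hnf
  have b1 := abs_pairing_le u s hl (stronglyMeasurable_collision ha hf).aestronglyMeasurable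
    hf.aestronglyMeasurable (by positivity) hB (nsq_collision_le_sq u hs hl ha hf hna hnf) hnf
  have b2 := abs_pairing_le u s hl (stronglyMeasurable_collision hf ha).aestronglyMeasurable
    hf.aestronglyMeasurable (by positivity) hB (nsq_collision_le_sq u hs hl hf ha hnf hna) hnf
  have e : pairing u s lam (linCollision a f) f =
      pairing u s lam (collision a f) f + pairing u s lam (collision f a) f := by
    unfold pairing
    rw [← integral_add (pairing_collision u hs hl ha hf hf ta tf tf).1
      (pairing_collision u hs hl hf ha hf tf ta tf).1]
    refine integral_congr_ae (Filter.Eventually.of_forall fun ξ => ?_)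
    simp only [linCollision]
    ring
  rw [e]
  refine (abs_add_le _ _).trans ((add_le_add b1 b2).trans (le_of_eq (by ring)))

theorem linCollision_sub_ae (u : FluidState) {s lam : ℝ} (hs : 1 / 2 ≤ s) (hl : 0 ≤ lam)
    {a b f : Vel → ℝ} (ha : Measurable a) (hb : Measurable b) (hf : Measurable f)
    (hna : nsq u s lam 1 a ≠ ⊤) (hnb : nsq u s lam 1 b ≠ ⊤) (hnf : nsq u s lam 1 f ≠ ⊤) :
    linCollision (fun ξ => a ξ - b ξ) f =ᵐ[volume]
      fun ξ => linCollision a f ξ - linCollision b f ξ := by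
  filter_upwards [integrable_collisionIntegrand u hs hl ha hf hna hnf,
    integrable_collisionIntegrand u hs hl hf ha hnf hna,
    integrable_collisionIntegrand u hs hl hb hf hnb hnf,
    integrable_collisionIntegrand u hs hl hf hb hnf hnb] with ξ i1 i2 i3 i4
  have e1 : collision (fun ξ => a ξ - b ξ) f ξ = collision a f ξ - collision b f ξ := by
    simp only [collision]
    rw [← integral_sub i1 i3]
    refine integral_congr_ae (Filter.Eventually.of_forall fun x => ?_)
    simp only [collisionIntegrand]
    ring
  have e2 : collision f (fun ξ => a ξ - b ξ) ξ = collision f a ξ - collision f b ξ := by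
    simp only [collision]
    rw [← integral_sub i2 i4]
    refine integral_congr_ae (Filter.Eventually.of_forall fun x => ?_)
    simp only [collisionIntegrand]
    ring
  rw [linCollision, linCollision, linCollision, e1, e2]
  ring

theorem memLp_collision (u : FluidState) {s lam : ℝ} (hs : 1 / 2 ≤ s) (hl : 0 ≤ lam)
    {a f : Vel → ℝ} (ha : Measurable a) (hf : Measurable f)
    (hna : nsq u s lam 1 a ≠ ⊤) (hnf : nsq u s lam 1 f ≠ ⊤) :
    MemLp (collision a f) 2 (weightMeasure u s lam (-1)) := by
  refine ⟨(stronglyMeasurable_collision ha hf).aestronglyMeasurable, ?_⟩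
  have h := ne_top_of_le_ne_top (by finiteness) (nsq_collision_le u hs hl ha hf)
  rw [← eLpNorm_sq_eq_nsq, Ne, ENNReal.pow_eq_top_iff] at h
  simp only [ne_eq, OfNat.ofNat_ne_zero, not_false_eq_true, and_true] at h
  exact lt_top_iff_ne_top.2 h

theorem nsq_coe_eq {u : FluidState} {s lam : ℝ} {k : ℤ} (f : WeightedL2 u s lam k) :
    nsq u s lam k f = ENNReal.ofReal (‖f‖ ^ 2) := by
  rw [← nsq_toReal, ENNReal.ofReal_toReal (nsq_coe_ne_top f)]

theorem norm_transport_le {u : FluidState} {s lam : ℝ} (f : WeightedL2 u s lam 1) :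
    ‖transport f‖ ≤ ‖f‖ := by
  rw [transport, Lp.norm_toLp, Lp.norm_def]
  exact ENNReal.toReal_mono (Lp.memLp f).2.ne (eLpNorm_transport_le u s lam (Lp.stronglyMeasurable f))

theorem abs_pairing_transport_le {u : FluidState} {s lam : ℝ} (hl : 0 ≤ lam)
    (K : WeightedL2 u s lam (-1) →L[ℝ] WeightedL2 u s lam 1) (f : WeightedL2 u s lam 1) :
    |pairing u s lam (K (transport f)) f| ≤ ‖K‖ * ‖f‖ ^ 2 := by
  have h1 : ‖K (transport f)‖ ≤ ‖K‖ * ‖f‖ :=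
    (K.le_opNorm _).trans (mul_le_mul_of_nonneg_left (norm_transport_le f) (norm_nonneg K))
  have h2 := abs_pairing_le u s hl (Lp.stronglyMeasurable (K (transport f))).aestronglyMeasurable
    (Lp.stronglyMeasurable f).aestronglyMeasurable (norm_nonneg (K (transport f))) (norm_nonneg f)
    ((nsq_neg_one_le u s hl _).trans_eq (nsq_coe_eq _)) (nsq_coe_eq f).le
  refine h2.trans ((mul_le_mul_of_nonneg_right h1 (norm_nonneg f)).trans (le_of_eq (by ring)))

theorem pairing_sub_left (u : FluidState) {s lam : ℝ} {g h f : Vel → ℝ}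
    (h1 : Integrable fun ξ => weight u s lam ξ * (g ξ * f ξ))
    (h2 : Integrable fun ξ => weight u s lam ξ * (h ξ * f ξ)) :
    pairing u s lam (fun ξ => g ξ - h ξ) f = pairing u s lam g f - pairing u s lam h f := by
  unfold pairing
  rw [← integral_sub h1 h2]
  refine integral_congr_ae (Filter.Eventually.of_forall fun ξ => ?_)
  simp only
  ring

/-- The estimate at the Maxwellian extends to nearby measurable states. -/
theorem kawashimaEstimate_of_near (u : FluidState) {s lam : ℝ} (hs : 1 / 2 ≤ s) (hs' : s < 1)
    (hl : 0 ≤ lam) (K : WeightedL2 u s lam (-1) →L[ℝ] WeightedL2 u s lam 1) {δ A ε : ℝ}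
    (hlow : ∀ f : WeightedL2 u s lam 1, 2 * δ * ‖f‖ ^ 2 ≤ pairing u s lam (K (transport f)) f -
      pairing u s lam (linCollision (maxwellian u) f) f)
    (hA0 : 0 ≤ A) (hA : nsq u s lam 1 (maxwellian u) ≤ ENNReal.ofReal (A ^ 2))
    (hε0 : 0 ≤ ε) (hε : 2 * collisionConst u s lam * ε ≤ δ) {a : Vel → ℝ} (ha : Measurable a)
    (hna : nsq u s lam 1 a ≠ ⊤)
    (hnear : nsq u s lam 1 (fun ξ => a ξ - maxwellian u ξ) ≤ ENNReal.ofReal (ε ^ 2)) :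
    KawashimaEstimate u s lam K δ (‖K‖ + 2 * collisionConst u s lam * A + δ) a := by
  intro f
  have hM := measurable_maxwellian u
  have hnM := nsq_maxwellian_ne_top u hs' hl
  have hf := (Lp.stronglyMeasurable f).measurable
  have hnf := nsq_coe_ne_top f
  have hfle := (nsq_coe_eq f).le
  have hd : Measurable fun ξ => a ξ - maxwellian u ξ := ha.sub hM
  have hL := collisionConst_nonneg u s lam
  have iK : Integrable fun ξ => weight u s lam ξ * (K (transport f) ξ * f ξ) :=
    integrable_pairing u s hl (Lp.stronglyMeasurable _).aestronglyMeasurable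
      hf.aestronglyMeasurable (nsq_neg_one_coe_ne_top hl _) hnf
  have ia := integrable_linCollision u hs hl ha hf hna hnf
  have iM := integrable_linCollision u hs hl hM hf hnM hnf
  have e1 := pairing_sub_left u iK ia
  have e2 : pairing u s lam (linCollision (fun ξ => a ξ - maxwellian u ξ) f) f =
      pairing u s lam (linCollision a f) f - pairing u s lam (linCollision (maxwellian u) f) f := by
    rw [← pairing_sub_left u ia iM]
    refine integral_congr_ae ?_
    filter_upwards [linCollision_sub_ae u hs hl ha hM hf hna hnM hnf] with ξ e
    rw [e]
  -- The form of L_{a-M} is at most 2 · `collisionConst` · ε‖f‖² ≤ δ‖f‖², which is half of the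
  -- margin 2δ at the Maxwellian.
  have b1 := abs_le.1 (abs_pairing_linCollision_le u hs hl hd hf hε0 (norm_nonneg f) hnear hfle)
  have b2 := abs_le.1 (abs_pairing_linCollision_le u hs hl hM hf hA0 (norm_nonneg f) hA hfle)
  have b3 := abs_le.1 (abs_pairing_transport_le hl K f)
  have b4 := mul_le_mul_of_nonneg_right hε (sq_nonneg ‖f‖)
  have h0 := hlow f
  refine ⟨?_, ?_, ?_, ?_⟩
  · filter_upwards [integrable_collisionIntegrand u hs hl ha hf hna hnf,
      integrable_collisionIntegrand u hs hl hf ha hnf hna] with ξ i1 i2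
    exact ⟨i1, i2⟩
  · exact (memLp_collision u hs hl ha hf hna hnf).add (memLp_collision u hs hl hf ha hnf hna)
  · rw [e1]
    linarith [b1.1, b1.2]
  · rw [e1]
    linarith [b1.1, b1.2, b2.1, b2.2, b3.1, b3.2]

end Boltzmann

end

open Boltzmann
theorem mainTheorem6 (u : FluidState) (s : ℝ) (hs : 1 / 2 ≤ s) (hs' : s < 1) :
    ∃ (C δ lam : ℝ), 0 < C ∧ 0 < δ ∧ 0 ≤ lam ∧
      ∃ K : WeightedL2 u s lam (-1) →L[ℝ] WeightedL2 u s lam 1,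
        FiniteDimensional ℝ K.range ∧
        (∃ B : ℝ, ∀ f : WeightedL2 u s lam (-1),
          eLpNorm (K f) 2 (weightMeasure u (1 / 2) 0 1) ≤
            ENNReal.ofReal B * eLpNorm f 2 (weightMeasure u (1 / 2) 0 (-1))) ∧
        (∀ f g : WeightedL2 u s lam (-1),
          pairing u s lam (K f) g = -pairing u s lam f (K g)) ∧
        KawashimaEstimate u s lam K δ C (maxwellian u) ∧
        ∃ ε₀ : ℝ, 0 < ε₀ ∧ ∀ a : Vel → ℝ,
          MemLp a 2 (weightMeasure u s lam 1) →
          eLpNorm (fun ξ => a ξ - maxwellian u ξ) 2 (weightMeasure u s lam 1) ≤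
            ENNReal.ofReal ε₀ →
          KawashimaEstimate u s lam K δ C a := by
  obtain ⟨c, lam, κ, hl, p, q, hc, hlow⟩ := exists_lower_bound u hs hs'
  have hL := collisionConst_nonneg u s lam
  have hM := measurable_maxwellian u
  have hnM := nsq_maxwellian_ne_top u hs' hl
  set K := compensator u hs hl κ p q with hK
  set A : ℝ := √(nsq u s lam 1 (maxwellian u)).toReal with hA
  have hA0 : 0 ≤ A := Real.sqrt_nonneg _
  have hAle : nsq u s lam 1 (maxwellian u) ≤ ENNReal.ofReal (A ^ 2) := by
    rw [hA, Real.sq_sqrt ENNReal.toReal_nonneg, ENNReal.ofReal_toReal hnM]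
  have hlow' : ∀ f : WeightedL2 u s lam 1, 2 * (c / 2) * ‖f‖ ^ 2 ≤
      pairing u s lam (K (transport f)) f - pairing u s lam (linCollision (maxwellian u) f) f := by
    intro f
    rw [mul_div_cancel₀ c two_ne_zero]
    exact hlow f
  have hKn := norm_nonneg K
  -- Half of the coercivity constant c is reserved for the perturbation of a. In ε₀ the summand 1
  -- keeps the denominator positive.
  refine ⟨‖K‖ + 2 * collisionConst u s lam * A + c / 2, c / 2, lam, by positivity, by positivity, hl,
    K, finiteDimensional_range_compensator u hs hl κ p q, exists_half_bound u hs hl κ p q,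
    compensator_skew u hs hl κ p q, ?_, c / 2 / (2 * collisionConst u s lam + 1), by positivity, ?_⟩
  · refine kawashimaEstimate_of_near u hs hs' hl K hlow' hA0 hAle le_rfl ?_ hM hnM ?_
    · rw [mul_zero]
      positivity
    · simp [nsq]
  · intro a ha hnear
    obtain ⟨a', ham, haa⟩ := ha.1
    have haa' : a =ᵐ[MeasureTheory.volume] a' := ae_volume_of_ae_weight hl haa
    refine KawashimaEstimate.congr ?_ haa'
    have hna : nsq u s lam 1 a' ≠ ⊤ := by
      rw [← nsq_congr u s lam 1 haa', ← eLpNorm_sq_eq_nsq]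
      exact ENNReal.pow_ne_top ha.2.ne
    refine kawashimaEstimate_of_near u hs hs' hl K hlow' hA0 hAle
      (ε := c / 2 / (2 * collisionConst u s lam + 1)) (by positivity) ?_ ham.measurable hna ?_
    · rw [mul_div_assoc', div_le_iff₀ (by positivity)]
      nlinarith
    · have e : (fun ξ => a' ξ - maxwellian u ξ) =ᵐ[MeasureTheory.volume]
          fun ξ => a ξ - maxwellian u ξ := by
        filter_upwards [haa'] with ξ h
        rw [h]
      rw [nsq_congr u s lam 1 e, ← eLpNorm_sq_eq_nsq, ENNReal.ofReal_pow (by positivity)]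
      exact ENNReal.pow_le_pow_left hnear
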